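/- Let $n\ge 2$, $N=n(n-1)/2$, $\mathbf i=\sqrt{-1}$, and write $u=(u_{jk})_{1\le j<k\le n}$ for the coordinates of $\mathbb R^N$, $p_{jk}=\frac1{2\pi\mathbf i}\frac{\partial}{\partial u_{jk}}$, with $u_{jk}=p_{jk}=0$ unless $1\le j<k\le n$. Let $\mathcal D\subset L^2(\mathbb R^N)$ be the space of restrictions to $\mathbb R^N$ of entire functions on $\mathbb C^N$ that, on every strip $|\mathrm{Im}\, z_{jk}|\le r$, are $O(e^{-r'\sum|\mathrm{Re}\, z_{jk}|})$ for all $r'$; the operators $e^{2\pi b u_{jk}}$ (multiplication) and $e^{2\pi b p_{jk}}$ (the shift $u_{jk}\mapsto u_{jk}-\mathbf ib$) act on $\mathcal D$. For $b>0$ with $b^2\notin\mathbb Q$ put $q=e^{\pi \mathbf i b^2}$, $\tilde q=e^{\pi \mathbf i b^{-2}}$, $\mathfrak q=q^2$, $\tilde{\mathfrak q}=\tilde q^2$, $Q=b+b^{-1}$, $[x]_q=\frac{q^x-q^{-x}}{q-q^{-1}}$. For real parameters $\alpha=(\alpha_1,\dots,\alpha_{n-1})$ consider, for $1\le i\le n-1$,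 the operators on $\mathcal D$ $$E_i=\sum_{k=1}^{n-i}\Big[\tfrac{Q}{2b}+\tfrac{\mathbf i}b\big(\alpha_k-\sum_{j=k}^{n-i}u_{j,i+j}\big)\Big]_q e^{2\pi b(-p_{k-1,i+k-1}+p_{k-1,i+k}+p_{k,i+k-1}-p_{k,i+k})},$$ $$F_i=\sum_{k=1}^{i}\Big[\tfrac{Q}{2b}+\tfrac{\mathbf i}b\big(\alpha_k-\sum_{j=k}^{i}u_{j,i}+\sum_{j=i+1}^{n}u_{i,j}\big)\Big]_q e^{2\pi b(p_{k-1,i-1}-p_{k-1,i}-p_{k,i}+p_{k,i+1})},$$ $$K_i=e^{\pi b(\sum_{j=1}^{i-1}u_{j,i}-\sum_{j=i+1}^{n}u_{i,j}-\sum_{j=1}^{n-i}u_{j,i+j})},$$ and the modified operators $\mathbf E_i=q^iE_iK_i^i$, $\mathbf F_i=q^{i-1}F_iK_i^{1-i}$, $\mathbf K_i=K_i^2$. The operators $\tilde{\mathbf E}_i,\tilde{\mathbf F}_i,\tilde{\mathbf K}_i$ are obtained by replacing $b$ by $b^{-1}$. The modified quantum group is the subalgebra of the Drinfeld–Jimbo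 algebra $\mathcal U_q(\mathfrak{sl}(n))$ generated by the elements $q^iE_iK_i^i$, $q^{i-1}F_iK_i^{1-i}$, $K_i^{\pm2}$. The modified modular double $\mathbf U_{\mathfrak q\tilde{\mathfrak q}}(\mathfrak{sl}(n,\mathbb R))$ is the tensor product of this algebra with the one for $\tilde q$. The quantum torus $\mathbb T^{N}_{\mathfrak q\tilde{\mathfrak q}}$ is the $*$-algebra over $\mathbb C$ generated by self-adjoint invertible elements $\mathbf u_{jk},\mathbf v_{jk},\tilde{\mathbf u}_{jk},\tilde{\mathbf v}_{jk}$, $1\le j<k\le n$, with relations $\mathbf u_{jk}\mathbf v_{jk}=\mathfrak q\,\mathbf v_{jk}\mathbf u_{jk}$, $\tilde{\mathbf u}_{jk}\tilde{\mathbf v}_{jk}=\tilde{\mathfrak q}\,\tilde{\mathbf v}_{jk}\tilde{\mathbf u}_{jk}$, all other pairs of generators commuting. **Theorem.** There is a real quadratic form $f$ on $\mathbb R^N$, depending only on $n$, such that the unitary operator $M$ of multiplication by $\exp(\frac{\pi\mathbf i}{2}f(u))$ on $L^2(\mathbb R^N)$, which maps $\mathcal D$ onto itself, has the following properties for all $b>0$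 with $b^2\notin\mathbb Q$ and all $\alpha\in\mathbb R^{n-1}$. 1. $M\mathbf E_iM^{-1}$ and $M\mathbf F_iM^{-1}$ are sums of monomials in $e^{\pm2\pi bu_{jk}}$, $e^{\pm2\pi bp_{jk}}$ with complex coefficients: for each $k$ in the sums above, the $k$-th term contributes two monomials, each of them a scalar times an integral monomial in the $e^{2\pi bu_{jk}}$ times the shift operator that occurs in the $k$-th term of $E_i$, resp. $F_i$. $M\mathbf K_i^{\pm1}M^{-1}$ are monomials in $e^{\pm2\pi bu_{jk}}$. The same holds for the tilded operators with $b$ replaced by $b^{-1}$. 2. The operators $\mathbf E_i,\mathbf F_i,\mathbf K_i^{\pm1}$ and $\tilde{\mathbf E}_i,\tilde{\mathbf F}_i,\tilde{\mathbf K}_i^{\pm1}$ define a representation $\pi$ of $\mathbf U_{\mathfrak q\tilde{\mathfrak q}}(\mathfrak{sl}(n,\mathbb R))$ on $\mathcal D$, and $\mathbf u_{jk}\mapsto e^{2\pi bu_{jk}}$, $\mathbf v_{jk}\mapsto e^{2\pi bp_{jk}}$, $\tilde{\mathbf u}_{jk}\mapsto e^{2\pi b^{-1}u_{jk}}$, $\tilde{\mathbf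 v}_{jk}\mapsto e^{2\pi b^{-1}p_{jk}}$ defines a faithful representation $\rho$ of $\mathbb T^{N}_{\mathfrak q\tilde{\mathfrak q}}$ on $\mathcal D$. 3. Conjugation by $M$ gives an embedding of $\mathbf U_{\mathfrak q\tilde{\mathfrak q}}(\mathfrak{sl}(n,\mathbb R))$, realized as the algebra of operators $\pi(\mathbf U_{\mathfrak q\tilde{\mathfrak q}}(\mathfrak{sl}(n,\mathbb R)))$ generated by the modified generators and their tilded counterparts, into the quantum torus: there is an injective algebra homomorphism $\Psi:\pi(\mathbf U_{\mathfrak q\tilde{\mathfrak q}}(\mathfrak{sl}(n,\mathbb R)))\hookrightarrow\mathbb T^{N}_{\mathfrak q\tilde{\mathfrak q}}$ with $MXM^{-1}=\rho(\Psi(X))$ for all $X$. The images of $\mathbf E_i,\mathbf F_i,\mathbf K_i^{\pm1}$ and of their tilded counterparts are self-adjoint elements of the torus. -/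

import Mathlib

open Complex MeasureTheory
open scoped TensorProduct

noncomputable section

namespace PosRep

/-! ## Indices, coordinates, domain -/

/-- The set of pairs `(j, k)` with `1 ≤ j < k ≤ n`; it has `n (n - 1) / 2` elements. -/
abbrev Idx (n : ℕ) : Type :=
  {p : Fin (n + 1) × Fin (n + 1) // 0 < (p.1 : ℕ) ∧ p.1 < p.2}

/-- The basis vector attached to `(j, k)`; it is `0` unless `1 ≤ j < k ≤ n`. -/
def delta (n j k : ℕ) : Idx n → ℤ :=
  fun p => if (p.1.1 : ℕ) = j ∧ (p.1.2 : ℕ) = k then 1 else 0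

/-- The coordinate `u_{jk}` of `z`; it is `0` unless `1 ≤ j < k ≤ n`. -/
def coord {n : ℕ} (z : Idx n → ℂ) (j k : ℕ) : ℂ :=
  ∑ p : Idx n, if (p.1.1 : ℕ) = j ∧ (p.1.2 : ℕ) = k then z p else 0

/-- `∑ |Re z_a|`. -/
def reNorm {n : ℕ} (z : Idx n → ℂ) : ℝ := ∑ a, |(z a).re|

/-- The common invariant domain of all the operators below: the entire functions on `ℂ^N`,
`N = n (n - 1) / 2`, which decay faster than every exponential of `|Re z|` on every strip
`|Im z_a| ≤ r`. Restricted to `ℝ^N` they are square integrable (`toL2`). The domain contains all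
Gaussians `exp (- t ∑ z_a ^ 2 + ∑ l_a z_a)`, `t > 0`, hence it is dense in `L²(ℝ^N)`. -/
def Dom (n : ℕ) : Submodule ℂ ((Idx n → ℂ) → ℂ) where
  carrier := {g | Differentiable ℂ g ∧ ∀ r : ℝ, ∃ C : ℝ, ∀ z : Idx n → ℂ,
    (∀ a, |(z a).im| ≤ r) → ‖g z‖ ≤ C * Real.exp (-r * reNorm z)}
  add_mem' := by
    rintro g h ⟨hg, hg'⟩ ⟨hh, hh'⟩
    refine ⟨hg.add hh, fun r => ?_⟩
    obtain ⟨C, hC⟩ := hg' r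
    obtain ⟨C', hC'⟩ := hh' r
    refine ⟨C + C', fun z hz => (norm_add_le _ _).trans ?_⟩
    have h1 := hC z hz
    have h2 := hC' z hz
    linarith
  zero_mem' := ⟨differentiable_const 0, fun r => ⟨0, fun z _ => by simp⟩⟩
  smul_mem' := by
    rintro c g ⟨hg, hg'⟩
    refine ⟨hg.const_smul c, fun r => ?_⟩
    obtain ⟨C, hC⟩ := hg' r
    refine ⟨‖c‖ * C, fun z hz => ?_⟩
    rw [Pi.smul_apply, norm_smul, mul_assoc]
    exact mul_le_mul_of_nonneg_left (hC z hz) (norm_nonneg c)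

theorem reNorm_nonneg {n : ℕ} (z : Idx n → ℂ) : 0 ≤ reNorm z :=
  Finset.sum_nonneg fun _ _ => abs_nonneg _

/-- The Hilbert space `L²(ℝ^N)`. -/
abbrev L2 (n : ℕ) : Type := Lp ℂ 2 (volume : Measure (Idx n → ℝ))

/-- The point of `ℂ^N` given by a point of `ℝ^N`. -/
def realPt {n : ℕ} (x : Idx n → ℝ) : Idx n → ℂ := fun a => (x a : ℂ)

theorem continuous_realPt {n : ℕ} : Continuous (realPt (n := n)) := by
  unfold realPt; fun_prop

theorem memLp_real {n : ℕ} (g : Dom n) :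
    MemLp (fun x : Idx n → ℝ => (g : (Idx n → ℂ) → ℂ) (realPt x)) 2 volume := by
  obtain ⟨g, hg, hg'⟩ := g
  obtain ⟨C, hC⟩ := hg' 1
  have hcont : Continuous fun x : Idx n → ℝ => g (realPt x) :=
    hg.continuous.comp continuous_realPt
  have hb : ∀ x : Idx n → ℝ, ‖g (realPt x)‖ ≤ C * ∏ a, Real.exp (-|x a|) := by
    intro x
    have h := hC (realPt x) (fun a => by simp [realPt])
    rw [← Real.exp_sum, Finset.sum_neg_distrib]
    simpa [reNorm, realPt] using h
  have h1 : Integrable (fun t : ℝ => Real.exp (-|t|) ^ 2) volume := by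
    have h2 : Integrable (fun t : ℝ => Real.exp (-2 * |t|)) volume := by
      rw [← integrableOn_univ, ← Set.Iic_union_Ioi (a := (0 : ℝ))]
      refine IntegrableOn.union ?_ ?_
      · refine (integrableOn_exp_mul_Iic (a := 2) (by norm_num) 0).congr_fun (fun t ht => ?_)
          measurableSet_Iic
        simp [abs_of_nonpos (Set.mem_Iic.1 ht)]
      · refine (integrableOn_exp_mul_Ioi (a := -2) (by norm_num) 0).congr_fun (fun t ht => ?_)
          measurableSet_Ioi
        simp [abs_of_pos (Set.mem_Ioi.1 ht)]
    refine h2.congr (Filter.Eventually.of_forall fun t => ?_)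
    simp only [← Real.exp_nat_mul]
    congr 1
    push_cast
    ring
  have h3 : Integrable (fun x : Idx n → ℝ => ∏ a, Real.exp (-|x a|) ^ 2) volume :=
    Integrable.fintype_prod (f := fun _ t => Real.exp (-|t|) ^ 2) fun _ => h1
  have h4 : MemLp (fun x : Idx n → ℝ => C * ∏ a, Real.exp (-|x a|)) 2 volume := by
    refine MemLp.const_mul ?_ C
    refine (memLp_two_iff_integrable_sq ?_).2 ?_
    · exact (by fun_prop : Continuous fun x : Idx n → ℝ =>
        ∏ a, Real.exp (-|x a|)).aestronglyMeasurable
    · simpa only [← Finset.prod_pow] using h3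
  exact h4.mono' hcont.aestronglyMeasurable (Filter.Eventually.of_forall hb)

/-- Restriction to `ℝ^N`, as an element of `L²(ℝ^N)`. -/
def toL2 {n : ℕ} : Dom n →ₗ[ℂ] L2 n where
  toFun g := (memLp_real g).toLp _
  map_add' _ _ := rfl
  map_smul' _ _ := rfl

/-! ## Multiplication operators and shifts on the domain -/

/-- Entire functions of at most exponential growth in `Re z` on every strip. -/
def Tempered {n : ℕ} (h : (Idx n → ℂ) → ℂ) : Prop :=
  Differentiable ℂ h ∧ ∀ r : ℝ, ∃ A B : ℝ, ∀ z : Idx n → ℂ,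
    (∀ a, |(z a).im| ≤ r) → ‖h z‖ ≤ A * Real.exp (B * reNorm z)

/-- The operator of multiplication by the function `h`. -/
def mulOp {n : ℕ} (h : (Idx n → ℂ) → ℂ) (hh : Tempered h) : Module.End ℂ (Dom n) where
  toFun g := ⟨fun z => h z * (g : (Idx n → ℂ) → ℂ) z, by
    obtain ⟨g, hg, hg'⟩ := g
    refine ⟨hh.1.mul hg, fun r => ?_⟩
    obtain ⟨A, B, hAB⟩ := hh.2 r
    obtain ⟨C, hC⟩ := hg' (r + |B|)
    refine ⟨|A| * |C|, fun z hz => ?_⟩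
    have h1 := hAB z hz
    have h2 := hC z fun a => (hz a).trans (by linarith [abs_nonneg B])
    have hS := reNorm_nonneg z
    rw [norm_mul]
    calc ‖h z‖ * ‖g z‖
        ≤ (|A| * Real.exp (|B| * reNorm z)) * (|C| * Real.exp (-(r + |B|) * reNorm z)) := by
          refine mul_le_mul (h1.trans ?_) (h2.trans ?_) (norm_nonneg _) (by positivity)
          · exact mul_le_mul (le_abs_self A)
              (Real.exp_le_exp.2 (mul_le_mul_of_nonneg_right (le_abs_self B) hS))
              (Real.exp_pos _).le (abs_nonneg A)
          · exact mul_le_mul_of_nonneg_right (le_abs_self C) (Real.exp_pos _).le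
      _ = |A| * |C| * (Real.exp (|B| * reNorm z) * Real.exp (-(r + |B|) * reNorm z)) := by ring
      _ = |A| * |C| * Real.exp (-r * reNorm z) := by
          rw [← Real.exp_add]; congr 2; ring⟩
  map_add' g g' := Subtype.ext (funext fun z => mul_add _ _ _)
  map_smul' c g := Subtype.ext (funext fun z => by
    simp only [SetLike.val_smul, Pi.smul_apply, smul_eq_mul, RingHom.id_apply]; ring)

/-- The operator `e^{2πb ∑ m_a p_a}`, `p_a = (2πi)⁻¹ ∂/∂u_a`: it sends `g` to `u ↦ g(u - i b m)`. -/
def pExp {n : ℕ} (b : ℝ) (m : Idx n → ℤ) : Module.End ℂ (Dom n) where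
  toFun g := ⟨fun z => (g : (Idx n → ℂ) → ℂ) (fun a => z a - I * b * m a), by
    obtain ⟨g, hg, hg'⟩ := g
    refine ⟨hg.comp (by fun_prop), fun r => ?_⟩
    set s : ℝ := ∑ a, |b * m a| with hs
    have hs0 : 0 ≤ s := Finset.sum_nonneg fun _ _ => abs_nonneg _
    obtain ⟨C, hC⟩ := hg' (r + s)
    refine ⟨|C|, fun z hz => ?_⟩
    have h1 := hC (fun a => z a - I * b * m a) fun a => by
      have h2 : |b * m a| ≤ s :=
        Finset.single_le_sum (f := fun a => |b * (m a : ℝ)|) (fun _ _ => abs_nonneg _)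
          (Finset.mem_univ a)
      have h3 : (z a - I * b * m a).im = (z a).im - b * m a := by simp
      rw [h3]
      exact (abs_sub _ _).trans (add_le_add (hz a) h2)
    have h4 : reNorm (fun a => z a - I * b * m a) = reNorm z := by simp [reNorm]
    rw [h4] at h1
    refine h1.trans (mul_le_mul (le_abs_self C) (Real.exp_le_exp.2 ?_) (Real.exp_pos _).le
      (abs_nonneg C))
    nlinarith [reNorm_nonneg z, mul_nonneg hs0 (reNorm_nonneg z)]⟩
  map_add' _ _ := rfl
  map_smul' _ _ := rfl

/-! ### Growth of the multipliers that occur -/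

theorem Tempered.exp {n : ℕ} {P : (Idx n → ℂ) → ℂ} (hP : Differentiable ℂ P)
    (h : ∀ r : ℝ, ∃ A B : ℝ, ∀ z : Idx n → ℂ, (∀ a, |(z a).im| ≤ r) →
      (P z).re ≤ A + B * reNorm z) : Tempered fun z => cexp (P z) := by
  refine ⟨hP.cexp, fun r => ?_⟩
  obtain ⟨A, B, hAB⟩ := h r
  refine ⟨Real.exp A, B, fun z hz => ?_⟩
  rw [Complex.norm_exp, ← Real.exp_add]
  exact Real.exp_le_exp.2 (hAB z hz)

theorem Tempered.sub {n : ℕ} {h h' : (Idx n → ℂ) → ℂ} (hh : Tempered h) (hh' : Tempered h') :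
    Tempered fun z => h z - h' z := by
  refine ⟨hh.1.sub hh'.1, fun r => ?_⟩
  obtain ⟨A, B, hAB⟩ := hh.2 r
  obtain ⟨A', B', hAB'⟩ := hh'.2 r
  refine ⟨|A| + |A'|, max B B', fun z hz => (norm_sub_le _ _).trans ?_⟩
  have hS := reNorm_nonneg z
  rw [add_mul]
  refine add_le_add ((hAB z hz).trans ?_) ((hAB' z hz).trans ?_)
  · exact mul_le_mul (le_abs_self A) (Real.exp_le_exp.2
      (mul_le_mul_of_nonneg_right (le_max_left _ _) hS)) (Real.exp_pos _).le (abs_nonneg A)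
  · exact mul_le_mul (le_abs_self A') (Real.exp_le_exp.2
      (mul_le_mul_of_nonneg_right (le_max_right _ _) hS)) (Real.exp_pos _).le (abs_nonneg A')

theorem Tempered.div_const {n : ℕ} {h : (Idx n → ℂ) → ℂ} (hh : Tempered h) (c : ℂ) :
    Tempered fun z => h z / c := by
  refine ⟨by simpa [div_eq_mul_inv] using hh.1.mul_const c⁻¹, fun r => ?_⟩
  obtain ⟨A, B, hAB⟩ := hh.2 r
  refine ⟨A / ‖c‖, B, fun z hz => ?_⟩
  rw [norm_div, div_mul_eq_mul_div]
  exact div_le_div_of_nonneg_right (hAB z hz) (norm_nonneg c)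

/-- Entire functions of at most linear growth in `Re z` on every strip. -/
def LinGrowth {n : ℕ} (P : (Idx n → ℂ) → ℂ) : Prop :=
  Differentiable ℂ P ∧ ∀ r : ℝ, ∃ A : ℝ, ∀ z : Idx n → ℂ,
    (∀ a, |(z a).im| ≤ r) → ‖P z‖ ≤ A * (1 + reNorm z)

theorem LinGrowth.tempered {n : ℕ} {P : (Idx n → ℂ) → ℂ} (hP : LinGrowth P) :
    Tempered fun z => cexp (P z) := by
  refine Tempered.exp hP.1 fun r => ?_
  obtain ⟨A, hA⟩ := hP.2 r
  refine ⟨A, A, fun z hz => (Complex.re_le_norm _).trans ((hA z hz).trans (le_of_eq (by ring)))⟩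

theorem LinGrowth.const {n : ℕ} (c : ℂ) : LinGrowth fun _ : Idx n → ℂ => c :=
  ⟨differentiable_const c, fun _ => ⟨‖c‖, fun z _ =>
    le_mul_of_one_le_right (norm_nonneg c) (by linarith [reNorm_nonneg z])⟩⟩

theorem LinGrowth.add {n : ℕ} {P P' : (Idx n → ℂ) → ℂ} (h : LinGrowth P) (h' : LinGrowth P') :
    LinGrowth fun z => P z + P' z := by
  refine ⟨h.1.add h'.1, fun r => ?_⟩
  obtain ⟨A, hA⟩ := h.2 r
  obtain ⟨A', hA'⟩ := h'.2 r
  exact ⟨A + A', fun z hz => (norm_add_le _ _).trans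
    ((add_le_add (hA z hz) (hA' z hz)).trans (le_of_eq (by ring)))⟩

theorem LinGrowth.const_mul {n : ℕ} {P : (Idx n → ℂ) → ℂ} (c : ℂ) (h : LinGrowth P) :
    LinGrowth fun z => c * P z := by
  refine ⟨h.1.const_mul c, fun r => ?_⟩
  obtain ⟨A, hA⟩ := h.2 r
  refine ⟨‖c‖ * A, fun z hz => ?_⟩
  rw [norm_mul, mul_assoc]
  exact mul_le_mul_of_nonneg_left (hA z hz) (norm_nonneg c)

theorem LinGrowth.neg {n : ℕ} {P : (Idx n → ℂ) → ℂ} (h : LinGrowth P) :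
    LinGrowth fun z => -P z := by
  simpa using h.const_mul (-1)

theorem LinGrowth.sub {n : ℕ} {P P' : (Idx n → ℂ) → ℂ} (h : LinGrowth P) (h' : LinGrowth P') :
    LinGrowth fun z => P z - P' z := by
  simpa [sub_eq_add_neg] using h.add h'.neg

theorem LinGrowth.sum {n : ℕ} {ι : Type} (s : Finset ι) {P : ι → (Idx n → ℂ) → ℂ}
    (h : ∀ i, LinGrowth (P i)) : LinGrowth fun z => ∑ i ∈ s, P i z := by
  classical
  induction s using Finset.induction_on with
  | empty => simpa using LinGrowth.const 0
  | insert a s ha ih => simpa [Finset.sum_insert ha] using (h a).add ih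

theorem LinGrowth.apply {n : ℕ} (a : Idx n) : LinGrowth fun z : Idx n → ℂ => z a := by
  refine ⟨by fun_prop, fun r => ⟨1 + |r|, fun z hz => ?_⟩⟩
  have h1 : |(z a).re| ≤ reNorm z :=
    Finset.single_le_sum (f := fun a => |(z a).re|) (fun _ _ => abs_nonneg _) (Finset.mem_univ a)
  have h2 := (hz a).trans (le_abs_self r)
  refine (Complex.norm_le_abs_re_add_abs_im _).trans ?_
  nlinarith [reNorm_nonneg z, abs_nonneg r, mul_nonneg (abs_nonneg r) (reNorm_nonneg z)]

theorem LinGrowth.coord {n : ℕ} (j k : ℕ) : LinGrowth fun z : Idx n → ℂ => coord z j k := by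
  unfold PosRep.coord
  refine LinGrowth.sum _ fun p => ?_
  split_ifs
  · exact LinGrowth.apply p
  · exact LinGrowth.const 0

/-- The operator `e^{2πb ∑ m_a u_a}`: multiplication by `exp (2πb ∑ m_a u_a)`. -/
def uExp {n : ℕ} (b : ℝ) (m : Idx n → ℤ) : Module.End ℂ (Dom n) :=
  mulOp (fun z => cexp (2 * Real.pi * b * ∑ a, (m a : ℂ) * z a))
    (LinGrowth.tempered <| LinGrowth.const_mul _ <| LinGrowth.sum _ fun a =>
      (LinGrowth.apply a).const_mul _)

/-! ## The positive representation -/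

/-- `q = e^{πi b²}`. -/
def qPar (b : ℝ) : ℂ := cexp (Real.pi * I * b ^ 2)

/-- The quantum number `[x]_q = (q^x - q^{-x}) / (q - q⁻¹)`, `q^x = e^{πi b² x}`. -/
def qNum (b : ℝ) (x : ℂ) : ℂ :=
  (cexp (Real.pi * I * b ^ 2 * x) - cexp (-(Real.pi * I * b ^ 2 * x))) / (qPar b - (qPar b)⁻¹)

theorem tempered_qNum {n : ℕ} (b : ℝ) {P : (Idx n → ℂ) → ℂ} (h : LinGrowth P) :
    Tempered fun z => qNum b (P z) :=
  (Tempered.sub (h.const_mul _).tempered (h.const_mul _).neg.tempered).div_const _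

/-- `α_k - ∑_{j=k}^{n-i} u_{j,i+j}`. -/
def wE {n : ℕ} (α : ℕ → ℝ) (i k : ℕ) (z : Idx n → ℂ) : ℂ :=
  α k - ∑ j ∈ Finset.Icc k (n - i), coord z j (i + j)

/-- `α_k - ∑_{j=k}^{i} u_{j,i} + ∑_{j=i+1}^{n} u_{i,j}`. -/
def wF {n : ℕ} (α : ℕ → ℝ) (i k : ℕ) (z : Idx n → ℂ) : ℂ :=
  α k - ∑ j ∈ Finset.Icc k i, coord z j i + ∑ j ∈ Finset.Icc (i + 1) n, coord z i j

/-- `∑_{j=1}^{i-1} u_{j,i} - ∑_{j=i+1}^{n} u_{i,j} - ∑_{j=1}^{n-i} u_{j,i+j}`. -/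
def wH {n : ℕ} (i : ℕ) (z : Idx n → ℂ) : ℂ :=
  ∑ j ∈ Finset.Icc 1 (i - 1), coord z j i - ∑ j ∈ Finset.Icc (i + 1) n, coord z i j
    - ∑ j ∈ Finset.Icc 1 (n - i), coord z j (i + j)

/-- Exponents of `- p_{k-1,i+k-1} + p_{k-1,i+k} + p_{k,i+k-1} - p_{k,i+k}`. -/
def shiftE (n i k : ℕ) : Idx n → ℤ :=
  -delta n (k - 1) (i + k - 1) + delta n (k - 1) (i + k) + delta n k (i + k - 1)
    - delta n k (i + k)

/-- Exponents of `p_{k-1,i-1} - p_{k-1,i} - p_{k,i} + p_{k,i+1}`. -/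
def shiftF (n i k : ℕ) : Idx n → ℤ :=
  delta n (k - 1) (i - 1) - delta n (k - 1) i - delta n k i + delta n k (i + 1)

/-- The operator `E_i = ∑_{k=1}^{n-i} [Q/2b + (i/b) wE]_q e^{2πb (shiftE · p)}`, `Q = b + b⁻¹`. -/
def opE (n : ℕ) (b : ℝ) (α : ℕ → ℝ) (i : ℕ) : Module.End ℂ (Dom n) :=
  ∑ k ∈ Finset.Icc 1 (n - i),
    mulOp (fun z => qNum b ((b + b⁻¹) / (2 * b) + I / b * wE α i k z))
      (tempered_qNum b <| (LinGrowth.const _).add <| LinGrowth.const_mul _ <|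
        (LinGrowth.const _).sub <| LinGrowth.sum _ fun _ => LinGrowth.coord _ _) *
    pExp b (shiftE n i k)

/-- The operator `F_i = ∑_{k=1}^{i} [Q/2b + (i/b) wF]_q e^{2πb (shiftF · p)}`, `Q = b + b⁻¹`. -/
def opF (n : ℕ) (b : ℝ) (α : ℕ → ℝ) (i : ℕ) : Module.End ℂ (Dom n) :=
  ∑ k ∈ Finset.Icc 1 i,
    mulOp (fun z => qNum b ((b + b⁻¹) / (2 * b) + I / b * wF α i k z))
      (tempered_qNum b <| (LinGrowth.const _).add <| LinGrowth.const_mul _ <|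
        ((LinGrowth.const _).sub <| LinGrowth.sum _ fun _ => LinGrowth.coord _ _).add <|
          LinGrowth.sum _ fun _ => LinGrowth.coord _ _) *
    pExp b (shiftF n i k)

/-- The operator `K_i^m`, where `K_i` is multiplication by `e^{πb wH}`. -/
def opK (n : ℕ) (b : ℝ) (i : ℕ) (m : ℤ) : Module.End ℂ (Dom n) :=
  mulOp (fun z => cexp (Real.pi * b * m * wH i z))
    (LinGrowth.tempered <| LinGrowth.const_mul _ <|
      ((LinGrowth.sum _ fun _ => LinGrowth.coord _ _).sub
        (LinGrowth.sum _ fun _ => LinGrowth.coord _ _)).sub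
        (LinGrowth.sum _ fun _ => LinGrowth.coord _ _))

/-! ## The quantum group, its modified generators and the modified modular double -/

/-- Names of the generators `E_i, F_i, K_i, K_i⁻¹`, `1 ≤ i ≤ n - 1`; the element `i : Fin (n - 1)`
stands for the index `i + 1`. -/
inductive QGen (n : ℕ) : Type
  | E (i : Fin (n - 1))
  | F (i : Fin (n - 1))
  | K (i : Fin (n - 1))
  | Kinv (i : Fin (n - 1))

/-- The Cartan matrix of type `A_{n-1}`. -/
def cartan {n : ℕ} (i j : Fin (n - 1)) : ℤ :=
  if i = j then 2 else if (i : ℕ) + 1 = j ∨ (j : ℕ) + 1 = i then -1 else 0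

section
open FreeAlgebra QGen

/-- The Drinfeld-Jimbo relations of `U_q(sl(n))`. -/
inductive QRel (n : ℕ) (q : ℂ) : FreeAlgebra ℂ (QGen n) → FreeAlgebra ℂ (QGen n) → Prop
  | K_Kinv (i) : QRel n q (ι ℂ (K i) * ι ℂ (Kinv i)) 1
  | Kinv_K (i) : QRel n q (ι ℂ (Kinv i) * ι ℂ (K i)) 1
  | K_K (i j) : QRel n q (ι ℂ (K i) * ι ℂ (K j)) (ι ℂ (K j) * ι ℂ (K i))
  | K_E (i j) : QRel n q (ι ℂ (K i) * ι ℂ (E j)) (q ^ cartan i j • (ι ℂ (E j) * ι ℂ (K i)))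
  | K_F (i j) : QRel n q (ι ℂ (K i) * ι ℂ (F j)) (q ^ (-cartan i j) • (ι ℂ (F j) * ι ℂ (K i)))
  | E_F (i j) : QRel n q (ι ℂ (E i) * ι ℂ (F j) - ι ℂ (F j) * ι ℂ (E i))
      (if i = j then (q - q⁻¹)⁻¹ • (ι ℂ (K i) - ι ℂ (Kinv i)) else 0)
  | E_E (i j) : cartan i j = 0 → QRel n q (ι ℂ (E i) * ι ℂ (E j)) (ι ℂ (E j) * ι ℂ (E i))
  | F_F (i j) : cartan i j = 0 → QRel n q (ι ℂ (F i) * ι ℂ (F j)) (ι ℂ (F j) * ι ℂ (F i))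
  | serre_E (i j) : cartan i j = -1 → QRel n q
      (ι ℂ (E i) * ι ℂ (E i) * ι ℂ (E j) - (q + q⁻¹) • (ι ℂ (E i) * ι ℂ (E j) * ι ℂ (E i))
        + ι ℂ (E j) * ι ℂ (E i) * ι ℂ (E i)) 0
  | serre_F (i j) : cartan i j = -1 → QRel n q
      (ι ℂ (F i) * ι ℂ (F i) * ι ℂ (F j) - (q + q⁻¹) • (ι ℂ (F i) * ι ℂ (F j) * ι ℂ (F i))
        + ι ℂ (F j) * ι ℂ (F i) * ι ℂ (F i)) 0

end

/-- The quantum group `U_q(sl(n))`. -/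
abbrev Uq (n : ℕ) (q : ℂ) : Type := RingQuot (QRel n q)

/-- The generators of `U_q(sl(n))`. -/
def Uq.gen {n : ℕ} (q : ℂ) (g : QGen n) : Uq n q :=
  RingQuot.mkAlgHom ℂ (QRel n q) (FreeAlgebra.ι ℂ g)

/-- The modified generators `𝐄_i = q^i E_i K_i^i`, `𝐅_i = q^{i-1} F_i K_i^{1-i}`, `𝐊_i = K_i^2` and
`𝐊_i⁻¹` in `U_q(sl(n))`. -/
def Uq.modGen {n : ℕ} (q : ℂ) : QGen n → Uq n q
  | .E i => q ^ ((i : ℕ) + 1) • (gen q (.E i) * gen q (.K i) ^ ((i : ℕ) + 1))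
  | .F i => q ^ (i : ℕ) • (gen q (.F i) * gen q (.Kinv i) ^ (i : ℕ))
  | .K i => gen q (.K i) ^ 2
  | .Kinv i => gen q (.Kinv i) ^ 2

/-- The modified quantum group: the subalgebra of `U_q(sl(n))` generated by the modified
generators. -/
abbrev ModUq (n : ℕ) (q : ℂ) : Subalgebra ℂ (Uq n q) :=
  Algebra.adjoin ℂ (Set.range (Uq.modGen (n := n) q))

/-- The modified generators as elements of the modified quantum group. -/
def ModUq.gen {n : ℕ} (q : ℂ) (g : QGen n) : ModUq n q :=
  ⟨Uq.modGen q g, Algebra.subset_adjoin ⟨g, rfl⟩⟩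

/-- The modified modular double: two commuting copies of the modified quantum group, for
`q = e^{πi b²}` and for `q̃ = e^{πi b⁻²}`. -/
abbrev ModDouble (n : ℕ) (b : ℝ) : Type := ModUq n (qPar b) ⊗[ℂ] ModUq n (qPar b⁻¹)

/-- `b` for the untilded (`false`) and `b⁻¹` for the tilded (`true`) copy. -/
def par (b : ℝ) (s : Bool) : ℝ := if s then b⁻¹ else b

/-- The generators of the modified modular double, untilded (`false`) and tilded (`true`). -/
def ModDouble.gen {n : ℕ} (b : ℝ) : Bool → QGen n → ModDouble n b
  | false, g => ModUq.gen (qPar b) g ⊗ₜ[ℂ] 1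
  | true, g => 1 ⊗ₜ[ℂ] ModUq.gen (qPar b⁻¹) g

/-- The operators of the positive representation with parameter `α` which represent the modified
generators `𝐄_i = q^i E_i K_i^i`, `𝐅_i = q^{i-1} F_i K_i^{1-i}`, `𝐊_i = K_i^2`, `𝐊_i⁻¹`. -/
def modOp (n : ℕ) (b : ℝ) (α : ℕ → ℝ) : QGen n → Module.End ℂ (Dom n)
  | .E i => qPar b ^ ((i : ℕ) + 1) • (opE n b α (i + 1) * opK n b (i + 1) ((i : ℕ) + 1))
  | .F i => qPar b ^ (i : ℕ) • (opF n b α (i + 1) * opK n b (i + 1) (-(i : ℕ)))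
  | .K i => opK n b (i + 1) 2
  | .Kinv i => opK n b (i + 1) (-2)

/-! ## The quantum torus -/

/-- Names of the generators `𝐮_a, 𝐮_a⁻¹, 𝐯_a, 𝐯_a⁻¹` of the quantum torus, untilded (`false`) and
tilded (`true`). -/
inductive TGen (n : ℕ) : Type
  | u (s : Bool) (a : Idx n)
  | uInv (s : Bool) (a : Idx n)
  | v (s : Bool) (a : Idx n)
  | vInv (s : Bool) (a : Idx n)

section
open FreeAlgebra TGen

/-- The relations of the quantum torus: `𝐮_a 𝐯_a = 𝔮 𝐯_a 𝐮_a` with `𝔮 = q² = e^{2πi b²}`, the same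
for the tilded generators with `b` replaced by `b⁻¹`, and all other pairs commute. -/
inductive TRel (n : ℕ) (b : ℝ) : FreeAlgebra ℂ (TGen n) → FreeAlgebra ℂ (TGen n) → Prop
  | u_uInv (s a) : TRel n b (ι ℂ (u s a) * ι ℂ (uInv s a)) 1
  | uInv_u (s a) : TRel n b (ι ℂ (uInv s a) * ι ℂ (u s a)) 1
  | v_vInv (s a) : TRel n b (ι ℂ (v s a) * ι ℂ (vInv s a)) 1
  | vInv_v (s a) : TRel n b (ι ℂ (vInv s a) * ι ℂ (v s a)) 1
  | u_u (s t a c) : TRel n b (ι ℂ (u s a) * ι ℂ (u t c)) (ι ℂ (u t c) * ι ℂ (u s a))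
  | v_v (s t a c) : TRel n b (ι ℂ (v s a) * ι ℂ (v t c)) (ι ℂ (v t c) * ι ℂ (v s a))
  | u_v (s t a c) : ¬(s = t ∧ a = c) →
      TRel n b (ι ℂ (u s a) * ι ℂ (v t c)) (ι ℂ (v t c) * ι ℂ (u s a))
  | u_v_same (s a) : TRel n b (ι ℂ (u s a) * ι ℂ (v s a))
      (qPar (par b s) ^ 2 • (ι ℂ (v s a) * ι ℂ (u s a)))

end

/-- The quantum torus `𝕋^{n(n-1)/2}`. -/
abbrev Torus (n : ℕ) (b : ℝ) : Type := RingQuot (TRel n b)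

/-- The generators of the quantum torus. -/
def Torus.gen {n : ℕ} (b : ℝ) (g : TGen n) : Torus n b :=
  RingQuot.mkAlgHom ℂ (TRel n b) (FreeAlgebra.ι ℂ g)

/-- The realization `𝐮_a = e^{2πb u_a}`, `𝐯_a = e^{2πb p_a}`, and the same with `b⁻¹` for the tilded
generators. -/
def torusOp (n : ℕ) (b : ℝ) : TGen n → Module.End ℂ (Dom n)
  | .u s a => uExp (par b s) (Pi.single a 1)
  | .uInv s a => uExp (par b s) (Pi.single a (-1))
  | .v s a => pExp (par b s) (Pi.single a 1)
  | .vInv s a => pExp (par b s) (Pi.single a (-1))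

/-- The `*`-structure of the quantum torus: a conjugate linear involutive anti-automorphism which
fixes the generators. -/
structure Torus.IsStar {n : ℕ} {b : ℝ} (σ : Torus n b → Torus n b) : Prop where
  map_add : ∀ x y, σ (x + y) = σ x + σ y
  map_smul : ∀ (c : ℂ) x, σ (c • x) = (starRingEnd ℂ) c • σ x
  map_mul : ∀ x y, σ (x * y) = σ y * σ x
  involutive : ∀ x, σ (σ x) = x
  map_gen : ∀ g, σ (Torus.gen b g) = Torus.gen b g

/-! ## The unitary multiplication operator -/

/-- The quadratic form `∑ C_{ac} z_a z_c`. -/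
def quad {n : ℕ} (C : Matrix (Idx n) (Idx n) ℝ) (z : Idx n → ℂ) : ℂ :=
  ∑ a, ∑ c, (C a c : ℂ) * z a * z c

theorem tempered_quad {n : ℕ} (C : Matrix (Idx n) (Idx n) ℝ) :
    Tempered fun z => cexp (Real.pi * I / 2 * quad C z) := by
  refine Tempered.exp (by unfold quad; fun_prop) fun r => ?_
  refine ⟨0, Real.pi / 2 * ∑ a, ∑ c, |C a c| * (2 * |r|), fun z hz => ?_⟩
  have h1 : (Real.pi * I / 2 * quad C z).re = Real.pi / 2 * -(quad C z).im := by
    have : (Real.pi * I / 2 * quad C z) = ((Real.pi / 2 : ℝ) : ℂ) * (I * quad C z) := by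
      push_cast; ring
    rw [this, Complex.re_ofReal_mul, Complex.I_mul_re]
  have hre : ∀ a, |(z a).re| ≤ reNorm z := fun a =>
    Finset.single_le_sum (f := fun a => |(z a).re|) (fun _ _ => abs_nonneg _) (Finset.mem_univ a)
  have him : ∀ a, |(z a).im| ≤ |r| := fun a => (hz a).trans (le_abs_self r)
  have hS := reNorm_nonneg z
  have h2 : -(quad C z).im ≤ (∑ a, ∑ c, |C a c| * (2 * |r|)) * reNorm z := by
    rw [quad, Complex.im_sum, ← Finset.sum_neg_distrib, Finset.sum_mul]
    refine Finset.sum_le_sum fun a _ => ?_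
    rw [Complex.im_sum, ← Finset.sum_neg_distrib, Finset.sum_mul]
    refine Finset.sum_le_sum fun c _ => ?_
    rw [mul_assoc, Complex.im_ofReal_mul, Complex.mul_im]
    refine (neg_le_abs _).trans ?_
    rw [abs_mul, mul_assoc]
    refine mul_le_mul_of_nonneg_left ((abs_add_le _ _).trans ?_) (abs_nonneg _)
    rw [abs_mul, abs_mul]
    have e1 := mul_le_mul (hre a) (him c) (abs_nonneg _) hS
    have e2 := mul_le_mul (him a) (hre c) (abs_nonneg _) (abs_nonneg r)
    linarith
  rw [h1, zero_add, mul_assoc]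
  exact mul_le_mul_of_nonneg_left h2 (by positivity)

theorem quad_neg {n : ℕ} (C : Matrix (Idx n) (Idx n) ℝ) (z : Idx n → ℂ) :
    quad (-C) z = -quad C z := by
  simp [quad, Finset.sum_neg_distrib]

/-- Multiplication by `exp ((πi/2) f(u))`, `f(u) = ∑ C_{ac} u_a u_c`, as a bijection of the
domain. -/
def gaussMul {n : ℕ} (C : Matrix (Idx n) (Idx n) ℝ) : Dom n ≃ₗ[ℂ] Dom n :=
  LinearEquiv.ofLinearMap
    (mulOp (fun z => cexp (Real.pi * I / 2 * quad C z)) (tempered_quad C))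
    (mulOp (fun z => cexp (Real.pi * I / 2 * quad (-C) z)) (tempered_quad (-C)))
    (LinearMap.ext fun g => Subtype.ext <| funext fun z => by
      simp [mulOp, quad_neg, ← mul_assoc, ← Complex.exp_add])
    (LinearMap.ext fun g => Subtype.ext <| funext fun z => by
      simp [mulOp, quad_neg, ← mul_assoc, ← Complex.exp_add])

end PosRep
end

open PosRep

namespace PosRep

/-! Each term of `opE` and `opF` is a real combination of two Weyl operators, the exponentials of πb
L(u) + 2πb s(p) with integral vectors L and s: the summand Q/2b of the quantum number supplies a
factor ±i that cancels the i in q - q⁻¹ (`qNum_mul_pExp`). Products of Weyl operators are governed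
by the integers L·s', so the algebra below rests on the pairing tables `linF_dot_shiftF`,
`linE_dot_shiftE`, `linE_dot_shiftF`, `linF_dot_shiftE` and on the Cartan pairings of `linH`.

The monomials of the torus are, up to phases, the Weyl operators with L even. Conjugation by the
Gaussian with matrix C replaces L by L - Cs (`conj_weyl`), so C must satisfy Cs ≡ L modulo 2 for all
terms of the modified generators. Over the field with two elements the shifts of the F-terms form a
basis (`eq_zero_of_dot_shiftF`), so the F-conditions determine C. This C is symmetric exactly
because the pairing of the F-terms is symmetric modulo 2; the powers of K_i in the modified
generators are what makes it so (`modLinF_dot_shiftF_symm`). The E-conditions then follow by pairing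
with the basis of F-shifts (`modLinE_dot_shiftF`). A lift to integers gives the quadratic form
(`exists_integral_form`).

The Drinfeld-Jimbo relations are checked term by term. Serre relations follow from a symmetrization
identity for q-commuting elements (`serreForm_add_swap`, `pairing_adjacent`). In the commutator of
E_i and F_j only a few diagonal terms survive: one yields K_i - K_i⁻¹ when i = j, and two cancel
when i < j. The tilded and untilded modified operators commute because this is evident after
conjugation, where all exponents are even (`weyl_comm_inv`).

The torus acts faithfully: ordered monomials span it, and applied to a real Gaussian they produce
multiples of distinct characters, which are linearly independent (`torusRep_injective`). Hence the
conjugated operators have unique preimages in the torus. They are self-adjoint since the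
coefficients are real and every Weyl operator with even L is the image of a self-adjoint element
(`selfAdjointExps_eq_top`). -/

/-! ## Pairings of the exponents -/

/-- The linear form on `ℤ^N` with coefficient `f j k` at `u_{jk}`. -/
def form (n : ℕ) (f : ℕ → ℕ → ℤ) : Idx n → ℤ := fun p => f p.1.1 p.1.2

/-- The linear part of `wE`. -/
def linE (n i k : ℕ) : Idx n → ℤ := form n fun a c => if a + i = c ∧ k ≤ a then -1 else 0

/-- The linear part of `wF`. -/
def linF (n i k : ℕ) : Idx n → ℤ :=
  form n fun a c => (if a = i then 1 else 0) - (if c = i ∧ k ≤ a then 1 else 0)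

/-- The linear form `wH`. -/
def linH (n i : ℕ) : Idx n → ℤ := linE n i 1 - linF n i 1

theorem form_dot_delta (n : ℕ) (f : ℕ → ℕ → ℤ) (a c : ℕ) :
    form n f ⬝ᵥ delta n a c = if 0 < a ∧ a < c ∧ c ≤ n then f a c else 0 := by
  classical
  unfold dotProduct
  by_cases h : 0 < a ∧ a < c ∧ c ≤ n
  · rw [if_pos h, Finset.sum_eq_single (⟨(⟨a, by omega⟩, ⟨c, by omega⟩), h.1, by
      simpa using h.2.1⟩ : Idx n)]
    · simp [form, delta]
    · rintro ⟨⟨x, y⟩, hx, hxy⟩ - hne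
      simp only [delta]
      rw [if_neg, mul_zero]
      rintro ⟨rfl, rfl⟩
      exact hne rfl
    · simp
  · rw [if_neg h]
    refine Finset.sum_eq_zero fun p _ => ?_
    simp only [delta]
    rw [if_neg, mul_zero]
    rintro ⟨rfl, rfl⟩
    exact h ⟨p.2.1, p.2.2, by omega⟩

/-- The case distinctions are the boundary: the basis vectors with first index k - 1 vanish for k =
1, and the one at (k, i + k - 1) lies on the diagonal for i = 1. -/
theorem form_dot_shiftE (n : ℕ) (f : ℕ → ℕ → ℤ) (i k : ℕ) (hi : 1 ≤ i) (hk : 1 ≤ k)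
    (hkn : i + k ≤ n) :
    form n f ⬝ᵥ shiftE n i k = (if 2 ≤ k then f (k - 1) (i + k) - f (k - 1) (i + k - 1) else 0)
      + (if 2 ≤ i then f k (i + k - 1) else 0) - f k (i + k) := by
  simp only [shiftE, dotProduct_add, dotProduct_sub, dotProduct_neg, form_dot_delta]
  split_ifs <;> omega

theorem form_dot_shiftF (n : ℕ) (f : ℕ → ℕ → ℤ) (i k : ℕ) (hk : 1 ≤ k)
    (hki : k ≤ i) (hi : i < n) :
    form n f ⬝ᵥ shiftF n i k = (if 2 ≤ k then (if k < i then f (k - 1) (i - 1) else 0) - f (k - 1) i else 0)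
      - (if k < i then f k i else 0) + f k (i + 1) := by
  simp only [shiftF, dotProduct_add, dotProduct_sub, form_dot_delta]
  split_ifs <;> omega

/-- The pairing between the linear part of the `k`-th term of `F_i` and the shift in the `l`-th
term of `F_j`. -/
def pairing (i j k l : ℕ) : ℤ :=
  if i = j then (if k < l then 1 else 0) + (if k ≤ l then 1 else 0)
  else if i + 1 = j then -(if k < l then 1 else 0)
  else if j + 1 = i then -(if k ≤ l then 1 else 0) else 0

/-- The pairing between the exponents in the `k`-th term of `E_i` and the `l`-th term of `F_j`. -/
def crossPairing (i j k l : ℕ) : ℤ :=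
  if k = l then (if j = i + k then 1 else 0) - (if j + 1 = i + k then 1 else 0) else 0

theorem linF_dot_shiftF (n i j k l : ℕ) (hk : 1 ≤ k) (hki : k ≤ i) (hl : 1 ≤ l)
    (hlj : l ≤ j) (hj : j < n) : linF n i k ⬝ᵥ shiftF n j l = pairing i j k l := by
  rw [linF, form_dot_shiftF n _ j l hl hlj hj, pairing]
  grind

/-- The E-terms pair like the F-terms with the two simple roots interchanged but the term numbers
kept. This lets one combinatorial argument serve for both families. -/
theorem linE_dot_shiftE (n i j k l : ℕ) (hi : 1 ≤ i) (hk : 1 ≤ k) (hj : 1 ≤ j) (hl : 1 ≤ l)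
    (hjl : j + l ≤ n) : linE n i k ⬝ᵥ shiftE n j l = pairing j i k l := by
  rw [linE, form_dot_shiftE n _ j l hj hl hjl, pairing]
  grind

theorem linE_dot_shiftF (n i j k l : ℕ) (hi : 1 ≤ i) (hk : 1 ≤ k) (hl : 1 ≤ l)
    (hlj : l ≤ j) (hj : j < n) : linE n i k ⬝ᵥ shiftF n j l = crossPairing i j k l := by
  rw [linE, form_dot_shiftF n _ j l hl hlj hj, crossPairing]
  grind

/-- The value agrees with that of `linE_dot_shiftF`. Because of this symmetry, an E-term and an
F-term of equal sign always commute. -/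
theorem linF_dot_shiftE (n i j k l : ℕ) (hi : 1 ≤ i) (hk : 1 ≤ k) (hik : i + k ≤ n) (hl : 1 ≤ l)
    (hlj : l ≤ j) : linF n j l ⬝ᵥ shiftE n i k = crossPairing i j k l := by
  rw [linF, form_dot_shiftE n _ i k hi hk hik, crossPairing]
  grind

/-- The Cartan matrix of type `A`, with natural numbers as indices. -/
def cartanNat (i j : ℕ) : ℤ := if i = j then 2 else if i + 1 = j ∨ j + 1 = i then -1 else 0

/-- The dependence on l cancels between the two pairings that make up `linH`, so every term of E_j
has the same weight. -/
theorem linH_dot_shiftE (n i j l : ℕ) (hi : 1 ≤ i) (hj : 1 ≤ j) (hl : 1 ≤ l)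
    (hjl : j + l ≤ n) : linH n i ⬝ᵥ shiftE n j l = cartanNat i j := by
  rw [linH, sub_dotProduct, linE_dot_shiftE n i j 1 l hi le_rfl hj hl hjl,
    linF_dot_shiftE n j i l 1 hj hl hjl le_rfl hi, pairing, crossPairing, cartanNat]
  grind

theorem linH_dot_shiftF (n i j l : ℕ) (hi : 1 ≤ i) (hl : 1 ≤ l)
    (hlj : l ≤ j) (hj : j < n) : linH n i ⬝ᵥ shiftF n j l = -cartanNat i j := by
  rw [linH, sub_dotProduct, linE_dot_shiftF n i j 1 l hi le_rfl hl hlj hj,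
    linF_dot_shiftF n i j 1 l le_rfl hi hl hlj hj, pairing, crossPairing, cartanNat]
  grind

/-! ## The quadratic form -/

/-- Reduction of an integral vector modulo `2`. -/
def red {n : ℕ} (x : Idx n → ℤ) : Idx n → ZMod 2 := fun a => (x a : ZMod 2)

theorem red_dot {n : ℕ} (x y : Idx n → ℤ) : red x ⬝ᵥ red y = ((x ⬝ᵥ y : ℤ) : ZMod 2) := by
  simp [red, dotProduct]

theorem red_shiftF (n i k : ℕ) : red (shiftF n i k) = red (delta n (k - 1) (i - 1))
    - red (delta n (k - 1) i) - red (delta n k i) + red (delta n k (i + 1)) := by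
  ext a; simp [red, shiftF]

theorem delta_eq_zero {n a c : ℕ} (h : ¬(0 < a ∧ a < c ∧ c ≤ n)) : delta n a c = 0 := by
  ext p
  simp only [delta, Pi.zero_apply]
  rw [if_neg]
  rintro ⟨rfl, rfl⟩
  exact h ⟨p.2.1, p.2.2, by omega⟩

theorem dot_red_delta {n : ℕ} (x : Idx n → ZMod 2) (p : Idx n) :
    x ⬝ᵥ red (delta n p.1.1 p.1.2) = x p := by
  have : red (delta n p.1.1 p.1.2) = Pi.single p 1 := by
    ext a
    simp only [red, delta, Pi.single_apply, ← Fin.ext_iff, ← Prod.ext_iff, ← Subtype.ext_iff]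
    split_ifs <;> simp
  rw [this, dotProduct_single_one]

/-- The shifts are triangular: `shiftF n i k` is the basis vector at (k, i + 1) plus vectors whose
second index is at most i. Induction on the second index shows that they span. -/
theorem eq_zero_of_dot_shiftF {n : ℕ} (x : Idx n → ZMod 2)
    (h : ∀ i k, 1 ≤ k → k ≤ i → i < n → x ⬝ᵥ red (shiftF n i k) = 0) : x = 0 := by
  have key : ∀ c a, x ⬝ᵥ red (delta n a c) = 0 := by
    intro c
    induction c using Nat.strong_induction_on with
    | _ c ih =>
      intro a
      by_cases hac : 0 < a ∧ a < c ∧ c ≤ n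
      · obtain ⟨i, rfl⟩ : ∃ i, c = i + 1 := ⟨c - 1, by omega⟩
        have := h i a (by omega) (by omega) (by omega)
        rwa [red_shiftF, dotProduct_add, dotProduct_sub, dotProduct_sub, ih (i - 1) (by omega),
          ih i (by omega), ih i (by omega), sub_zero, sub_zero, zero_add] at this
      · rw [delta_eq_zero hac]
        simp [red, dotProduct]
  ext p
  rw [← dot_red_delta x p, key, Pi.zero_apply]

/-- The exponents of `u` in the `k`-th term of the modified operator `𝐄_i`. -/
def modLinE (n i k : ℕ) : Idx n → ℤ := linE n i k + (i : ℤ) • linH n i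

/-- The exponents of `u` in the `k`-th term of the modified operator `𝐅_i`. -/
def modLinF (n i k : ℕ) : Idx n → ℤ := linF n i k - ((i : ℤ) - 1) • linH n i

/-- For neighbours j = i + 1 the unmodified pairings are -[k < l] and -[l ≤ k], which never agree
modulo 2. The K-powers add -(i - 1) and -i, of opposite parity, and repair this. For i = j both
sides are even, or k = l. -/
theorem modLinF_dot_shiftF_symm (n i j k l : ℕ) (hk : 1 ≤ k) (hki : k ≤ i) (hi : i < n)
    (hl : 1 ≤ l) (hlj : l ≤ j) (hj : j < n) :
    ((modLinF n i k ⬝ᵥ shiftF n j l : ℤ) : ZMod 2) = (modLinF n j l ⬝ᵥ shiftF n i k : ℤ) := by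
  rw [modLinF, modLinF, sub_dotProduct, sub_dotProduct, smul_dotProduct, smul_dotProduct,
    linH_dot_shiftF n i j l (by omega) hl hlj hj, linH_dot_shiftF n j i k (by omega) hk hki hi,
    linF_dot_shiftF n i j k l hk hki hl hlj hj, linF_dot_shiftF n j i l k hl hlj hk hki hi,
    ZMod.intCast_eq_intCast_iff, pairing, pairing, cartanNat, cartanNat]
  simp only [smul_eq_mul, Int.ModEq]
  split_ifs <;> omega

/-- The cross pairings are equal, so the two sides differ by (j - 1 - i) times a Cartan entry. The
first factor is even for neighbours and the entry is even otherwise. -/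
theorem modLinE_dot_shiftF (n i j k l : ℕ) (hi : 1 ≤ i) (hk : 1 ≤ k) (hik : i + k ≤ n)
    (hl : 1 ≤ l) (hlj : l ≤ j) (hj : j < n) :
    ((modLinE n i k ⬝ᵥ shiftF n j l : ℤ) : ZMod 2) = (modLinF n j l ⬝ᵥ shiftE n i k : ℤ) := by
  rw [modLinE, modLinF, sub_dotProduct, add_dotProduct, smul_dotProduct, smul_dotProduct,
    linH_dot_shiftF n i j l hi hl hlj hj, linH_dot_shiftE n j i k (by omega) hi hk hik,
    linE_dot_shiftF n i j k l hi hk hl hlj hj, linF_dot_shiftE n i j k l hi hk hik hl hlj,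
    ZMod.intCast_eq_intCast_iff, cartanNat, cartanNat]
  simp only [smul_eq_mul, Int.ModEq]
  split_ifs <;> omega

/-- There is an integral quadratic form which is congruent modulo `2` to the one that moves the
modified operators into the quantum torus. -/
theorem exists_integral_form (n : ℕ) : ∃ C : Matrix (Idx n) (Idx n) ℤ, C.IsSymm ∧
    (∀ i k, 1 ≤ k → k ≤ i → i < n →
      ∀ a, (2 : ℤ) ∣ modLinF n i k a - (C.mulVec (shiftF n i k)) a) ∧
    (∀ i k, 1 ≤ i → 1 ≤ k → i + k ≤ n →
      ∀ a, (2 : ℤ) ∣ modLinE n i k a - (C.mulVec (shiftE n i k)) a) := by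
  classical
  -- The index p = (k, i + 1) numbers the k-th term of F_i, so S is square, with the F-shifts as
  -- columns, and L has the corresponding u-exponents as columns.
  let S : Matrix (Idx n) (Idx n) (ZMod 2) := fun a p => red (shiftF n ((p.1.2 : ℕ) - 1) p.1.1) a
  let L : Matrix (Idx n) (Idx n) (ZMod 2) := fun a p => red (modLinF n ((p.1.2 : ℕ) - 1) p.1.1) a
  have hidx : ∀ p : Idx n, 1 ≤ (p.1.1 : ℕ) ∧ (p.1.1 : ℕ) ≤ (p.1.2 : ℕ) - 1 ∧
      (p.1.2 : ℕ) - 1 < n := by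
    intro p
    have h1 := p.2.1
    have h2 : (p.1.1 : ℕ) < p.1.2 := p.2.2
    omega
  have hS : IsUnit S := by
    rw [← Matrix.vecMul_injective_iff_isUnit]
    refine (injective_iff_map_eq_zero (Matrix.vecMulLinear S)).2 fun x hx => ?_
    refine eq_zero_of_dot_shiftF x fun i k hk hki hi => ?_
    have := congrFun hx ⟨(⟨k, by omega⟩, ⟨i + 1, by omega⟩), hk, by
      simp only [Fin.mk_lt_mk]; omega⟩
    exact this
  have hSd : IsUnit S.det := (Matrix.isUnit_iff_isUnit_det S).1 hS
  have hsym : (S.transpose * L).transpose = S.transpose * L := by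
    ext p r
    have h1 := hidx p
    have h2 := hidx r
    simp only [Matrix.transpose_apply, Matrix.mul_apply]
    have := modLinF_dot_shiftF_symm n _ _ _ _ h1.1 h1.2.1 h1.2.2 h2.1 h2.2.1 h2.2.2
    rw [← red_dot, ← red_dot] at this
    simp only [dotProduct] at this
    simpa only [S, L, mul_comm] using this
  let C₂ := L * S⁻¹
  have hC₂S : C₂ * S = L := by
    simp only [C₂, Matrix.mul_assoc, Matrix.nonsing_inv_mul S hSd, Matrix.mul_one]
  -- Since C₂ S = L, the product Sᵀ C₂ S equals the symmetric matrix Sᵀ L; the invertible factors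
  -- cancel.
  have hC₂ : C₂.transpose = C₂ := by
    have hSdT : IsUnit S.transpose.det := by rwa [Matrix.det_transpose]
    have h1 : S.transpose * C₂.transpose * S = S.transpose * C₂ * S := by
      rw [Matrix.mul_assoc _ C₂, hC₂S, ← Matrix.transpose_mul, hC₂S, ← hsym, Matrix.transpose_mul,
        Matrix.transpose_transpose]
    have h2 := (hS.mul_left_inj).1 h1
    exact ((Matrix.isUnit_iff_isUnit_det _).2 hSdT).mul_right_inj.1 h2
  let C : Matrix (Idx n) (Idx n) ℤ := C₂.map fun x => (x.val : ℤ)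
  have hred : ∀ s : Idx n → ℤ, red (C.mulVec s) = C₂.mulVec (red s) := by
    intro s
    ext a
    simp [red, Matrix.mulVec, dotProduct, C]
  have hF : ∀ i k, 1 ≤ k → k ≤ i → i < n → C₂.mulVec (red (shiftF n i k)) = red (modLinF n i k) := by
    intro i k hk hki hi
    ext a
    have := congrFun (congrFun hC₂S a) ⟨(⟨k, by omega⟩, ⟨i + 1, by omega⟩), hk, by
      simp only [Fin.mk_lt_mk]; omega⟩
    rw [Matrix.mul_apply] at this
    exact this
  -- It suffices to pair with all F-shifts. By symmetry C₂ moves to the F-shift, where it is known,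
  -- and the mixed congruence closes the argument.
  have hE : ∀ i k, 1 ≤ i → 1 ≤ k → i + k ≤ n →
      C₂.mulVec (red (shiftE n i k)) = red (modLinE n i k) := by
    intro i k hi hk hik
    rw [← sub_eq_zero]
    refine eq_zero_of_dot_shiftF _ fun j l hl hlj hj => ?_
    rw [sub_dotProduct, red_dot, modLinE_dot_shiftF n i j k l hi hk hik hl hlj hj, ← red_dot,
      dotProduct_comm, Matrix.dotProduct_mulVec, ← Matrix.mulVec_transpose, hC₂, hF j l hl hlj hj,
      sub_self]
  have hdvd : ∀ x s : Idx n → ℤ, C₂.mulVec (red s) = red x → ∀ a, (2 : ℤ) ∣ x a - C.mulVec s a := by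
    intro x s h a
    have h1 := congrFun ((hred s).trans h) a
    rw [← Nat.cast_two, ← ZMod.intCast_zmod_eq_zero_iff_dvd _ 2]
    simp only [red] at h1
    rw [Int.cast_sub, h1, sub_self]
  refine ⟨C, ?_, fun i k h1 h2 h3 => hdvd _ _ (hF i k h1 h2 h3),
    fun i k h1 h2 h3 => hdvd _ _ (hE i k h1 h2 h3)⟩
  rw [Matrix.IsSymm, ← Matrix.transpose_map, hC₂]

/-! ## Weyl operators -/

theorem end_ext {n : ℕ} {X Y : Module.End ℂ (Dom n)}
    (h : ∀ (g : Dom n) (z : Idx n → ℂ),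
      (X g : (Idx n → ℂ) → ℂ) z = (Y g : (Idx n → ℂ) → ℂ) z) : X = Y :=
  LinearMap.ext fun g => Subtype.ext <| funext fun z => h g z

theorem mulOp_apply {n : ℕ} (h : (Idx n → ℂ) → ℂ) (hh : Tempered h) (g : Dom n) (z : Idx n → ℂ) :
    (mulOp h hh g : (Idx n → ℂ) → ℂ) z = h z * (g : (Idx n → ℂ) → ℂ) z := rfl

theorem pExp_apply {n : ℕ} (b : ℝ) (m : Idx n → ℤ) (g : Dom n) (z : Idx n → ℂ) :
    (pExp b m g : (Idx n → ℂ) → ℂ) z = (g : (Idx n → ℂ) → ℂ) fun a => z a - I * b * m a := rfl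

/-- `q^{x/2}` for an integer `x`. -/
noncomputable def qHalf (b : ℝ) (x : ℤ) : ℂ := cexp (Real.pi * I * b ^ 2 * x / 2)

theorem qHalf_add (b : ℝ) (x y : ℤ) : qHalf b (x + y) = qHalf b x * qHalf b y := by
  rw [qHalf, qHalf, qHalf, ← Complex.exp_add]; congr 1; push_cast; ring

theorem qHalf_zero (b : ℝ) : qHalf b 0 = 1 := by simp [qHalf]

theorem qHalf_neg (b : ℝ) (x : ℤ) : qHalf b (-x) = (qHalf b x)⁻¹ := by
  refine eq_inv_of_mul_eq_one_left ?_
  rw [← qHalf_add, neg_add_cancel, qHalf_zero]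

theorem conj_qHalf (b : ℝ) (x : ℤ) : (starRingEnd ℂ) (qHalf b x) = qHalf b (-x) := by
  rw [qHalf, qHalf, ← Complex.exp_conj]
  congr 1
  simp [Complex.conj_ofReal, map_ofNat]

theorem qPar_zpow (b : ℝ) (x : ℤ) : qPar b ^ x = qHalf b (2 * x) := by
  rw [qPar, qHalf, ← Complex.exp_int_mul]; congr 1; push_cast; ring

theorem qPar_pow (b : ℝ) (x : ℕ) : qPar b ^ x = qHalf b (2 * x) := by
  rw [← qPar_zpow, zpow_natCast]

theorem qPar_eq (b : ℝ) : qPar b = qHalf b 2 := by simpa using qPar_pow b 1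

theorem qPar_ne_zero (b : ℝ) : qPar b ≠ 0 := Complex.exp_ne_zero _

/-- The function `exp (πb ∑ L_a z_a + c)`. -/
noncomputable def weylFun {n : ℕ} (b : ℝ) (L : Idx n → ℤ) (c : ℂ) (z : Idx n → ℂ) : ℂ :=
  cexp (Real.pi * b * (∑ a, (L a : ℂ) * z a) + c)

theorem tempered_weylFun {n : ℕ} (b : ℝ) (L : Idx n → ℤ) (c : ℂ) : Tempered (weylFun b L c) := by
  refine LinGrowth.tempered (LinGrowth.add ?_ (LinGrowth.const c))
  exact LinGrowth.const_mul _ (LinGrowth.sum _ fun a => (LinGrowth.apply a).const_mul _)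

/-- The exponential of `πb ∑ L_a u_a + 2πb ∑ s_a p_a`. -/
noncomputable def weyl {n : ℕ} (b : ℝ) (L s : Idx n → ℤ) : Module.End ℂ (Dom n) :=
  mulOp (weylFun b L (-(Real.pi * I * b ^ 2 * (L ⬝ᵥ s : ℤ) / 2))) (tempered_weylFun _ _ _) *
    pExp b s

theorem weyl_apply {n : ℕ} (b : ℝ) (L s : Idx n → ℤ) (g : Dom n) (z : Idx n → ℂ) :
    (weyl b L s g : (Idx n → ℂ) → ℂ) z =
      cexp (Real.pi * b * (∑ a, (L a : ℂ) * z a) - Real.pi * I * b ^ 2 * (L ⬝ᵥ s : ℤ) / 2) *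
        (g : (Idx n → ℂ) → ℂ) fun a => z a - I * b * s a := rfl

theorem smul_dom_apply {n : ℕ} (c : ℂ) (X : Module.End ℂ (Dom n)) (g : Dom n) (z : Idx n → ℂ) :
    ((c • X) g : (Idx n → ℂ) → ℂ) z = c * (X g : (Idx n → ℂ) → ℂ) z := rfl

theorem add_dom_apply {n : ℕ} (X Y : Module.End ℂ (Dom n)) (g : Dom n) (z : Idx n → ℂ) :
    ((X + Y) g : (Idx n → ℂ) → ℂ) z =
      (X g : (Idx n → ℂ) → ℂ) z + (Y g : (Idx n → ℂ) → ℂ) z := rfl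

/-- The symmetric normalization of `weyl` absorbs the symmetric half of the reordering phase; only
the symplectic form of the exponents remains. -/
theorem weyl_mul {n : ℕ} (b : ℝ) (L s L' s' : Idx n → ℤ) :
    weyl b L s * weyl b L' s' = qHalf b (L ⬝ᵥ s' - L' ⬝ᵥ s) • weyl b (L + L') (s + s') := by
  refine end_ext fun g z => ?_
  rw [smul_dom_apply, Module.End.mul_apply, weyl_apply, weyl_apply, weyl_apply, qHalf,
    ← mul_assoc, ← mul_assoc, ← Complex.exp_add, ← Complex.exp_add]
  congr 1
  · congr 1
    have h1 : ∑ a, (L' a : ℂ) * (z a - I * b * s a) =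
        (∑ a, (L' a : ℂ) * z a) - I * b * (L' ⬝ᵥ s : ℤ) := by
      simp only [mul_sub, Finset.sum_sub_distrib, dotProduct]
      push_cast
      rw [Finset.mul_sum]
      congr 1
      exact Finset.sum_congr rfl fun a _ => by ring
    have h2 : ∑ a, ((L + L') a : ℂ) * z a = (∑ a, (L a : ℂ) * z a) + ∑ a, (L' a : ℂ) * z a := by
      simp only [Pi.add_apply, Int.cast_add, add_mul, Finset.sum_add_distrib]
    rw [h1, h2, add_dotProduct, dotProduct_add, dotProduct_add]
    push_cast
    ring
  · refine congrArg (g : (Idx n → ℂ) → ℂ) (funext fun a => ?_)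
    simp only [Pi.add_apply]
    push_cast
    ring

theorem weyl_zero {n : ℕ} (b : ℝ) : weyl b (0 : Idx n → ℤ) 0 = 1 := by
  refine end_ext fun g z => ?_
  simp [weyl_apply]

/-- Exchange of two Weyl operators. -/
theorem weyl_comm {n : ℕ} (b : ℝ) (L s L' s' : Idx n → ℤ) :
    weyl b L s * weyl b L' s' = qHalf b (2 * (L ⬝ᵥ s' - L' ⬝ᵥ s)) • (weyl b L' s' * weyl b L s) := by
  rw [weyl_mul, weyl_mul, smul_smul, ← qHalf_add, add_comm L', add_comm s']
  congr 2
  ring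

/-- Even u-exponents are those available in the torus, since `weyl` measures u in units of πb and
`uExp` in units of 2πb. -/
theorem weyl_two_smul {n : ℕ} (b : ℝ) (m s : Idx n → ℤ) :
    weyl b ((2 : ℤ) • m) s = qHalf b (-(2 * (m ⬝ᵥ s))) • (uExp b m * pExp b s) := by
  refine end_ext fun g z => ?_
  rw [smul_dom_apply, Module.End.mul_apply, weyl_apply, qHalf, uExp, mulOp_apply, ← mul_assoc,
    ← Complex.exp_add, pExp_apply, smul_dotProduct]
  congr 2
  simp only [Pi.smul_apply, smul_eq_mul]
  push_cast
  simp only [mul_assoc, ← Finset.mul_sum]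
  ring

/-- A shift by i b⁻¹ s changes the exponent 2πb m(u) by an integral multiple of 2πi. Without the
factor 2 a sign could remain. -/
theorem weyl_comm_inv {n : ℕ} {b : ℝ} (hb : b ≠ 0) (m s m' s' : Idx n → ℤ) :
    weyl b ((2 : ℤ) • m) s * weyl b⁻¹ ((2 : ℤ) • m') s' =
      weyl b⁻¹ ((2 : ℤ) • m') s' * weyl b ((2 : ℤ) • m) s := by
  have key : ∀ (c : ℝ) (m s : Idx n → ℤ) (z : Idx n → ℂ), c ≠ 0 →
      Real.pi * c * ∑ a, (((2 : ℤ) • m) a : ℂ) * (z a - I * (c⁻¹ : ℝ) * s a) =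
        Real.pi * c * ∑ a, (((2 : ℤ) • m) a : ℂ) * z a -
          (m ⬝ᵥ s : ℤ) * (2 * Real.pi * I) := by
    intro c m s z hc
    have hc' : (c : ℂ) ≠ 0 := by exact_mod_cast hc
    simp only [mul_sub, Finset.sum_sub_distrib, dotProduct, Pi.smul_apply, smul_eq_mul]
    push_cast
    rw [Finset.sum_mul]
    congr 1
    rw [Finset.mul_sum]
    refine Finset.sum_congr rfl fun a _ => ?_
    field_simp
  refine end_ext fun g z => ?_
  rw [Module.End.mul_apply, Module.End.mul_apply, weyl_apply, weyl_apply, weyl_apply, weyl_apply,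
    ← mul_assoc, ← mul_assoc, ← Complex.exp_add, ← Complex.exp_add]
  congr 1
  · have h1 := key b⁻¹ m' s z (inv_ne_zero hb)
    rw [inv_inv] at h1
    rw [h1, key b m s' z hb, Complex.exp_eq_exp_iff_exists_int]
    refine ⟨m ⬝ᵥ s' - m' ⬝ᵥ s, ?_⟩
    push_cast
    ring
  · exact congrArg (g : (Idx n → ℂ) → ℂ) (funext fun a => by ring)

/-! ## Conjugation with the Gaussian -/

/-- The real matrix with the entries of an integral matrix. -/
noncomputable def realMatrix {n : ℕ} (C : Matrix (Idx n) (Idx n) ℤ) : Matrix (Idx n) (Idx n) ℝ :=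
  C.map fun x => (x : ℝ)

theorem quad_sub {n : ℕ} {C : Matrix (Idx n) (Idx n) ℤ} (hC : C.IsSymm) (b : ℝ) (s : Idx n → ℤ)
    (z : Idx n → ℂ) : quad (realMatrix C) (fun a => z a - I * b * s a) = quad (realMatrix C) z
      - 2 * I * b * (∑ a, (C.mulVec s a : ℂ) * z a) - b ^ 2 * (C.mulVec s ⬝ᵥ s : ℤ) := by
  have h1 : ∑ a, ∑ c, (C a c : ℂ) * z a * s c = ∑ a, (C.mulVec s a : ℂ) * z a := by
    refine Finset.sum_congr rfl fun a _ => ?_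
    simp only [Matrix.mulVec, dotProduct]
    push_cast
    rw [Finset.sum_mul]
    exact Finset.sum_congr rfl fun c _ => by ring
  have h2 : ∑ a, ∑ c, (C a c : ℂ) * s a * z c = ∑ a, (C.mulVec s a : ℂ) * z a := by
    rw [← h1, Finset.sum_comm]
    refine Finset.sum_congr rfl fun a _ => Finset.sum_congr rfl fun c _ => ?_
    rw [hC.apply c a]
    ring
  have h3 : ∑ a, ∑ c, (C a c : ℂ) * s a * s c = (C.mulVec s ⬝ᵥ s : ℤ) := by
    simp only [Matrix.mulVec, dotProduct]
    push_cast
    refine Finset.sum_congr rfl fun a _ => ?_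
    rw [Finset.sum_mul]
    exact Finset.sum_congr rfl fun c _ => by ring
  have h4 : quad (realMatrix C) (fun a => z a - I * b * s a) = quad (realMatrix C) z
      - I * b * (∑ a, ∑ c, (C a c : ℂ) * z a * s c) - I * b * (∑ a, ∑ c, (C a c : ℂ) * s a * z c)
      - b ^ 2 * ∑ a, ∑ c, (C a c : ℂ) * s a * s c := by
    simp only [quad, realMatrix, Matrix.map_apply, Finset.mul_sum, ← Finset.sum_sub_distrib]
    refine Finset.sum_congr rfl fun a _ => Finset.sum_congr rfl fun c _ => ?_
    push_cast
    linear_combination ((C a c : ℂ) * b ^ 2 * s a * s c) * I_sq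
  rw [h4, h1, h2, h3]
  ring

/-- The quotient of the Gaussian by its shift is the exponential of a linear form (`quad_sub`). The
constant left over is just the one that renormalizes the Weyl operator. -/
theorem conj_weyl {n : ℕ} {C : Matrix (Idx n) (Idx n) ℤ} (hC : C.IsSymm) (b : ℝ)
    (L s : Idx n → ℤ) :
    (gaussMul (realMatrix C)).conj (weyl b L s) = weyl b (L - C.mulVec s) s := by
  refine end_ext fun g z => ?_
  have : ((gaussMul (realMatrix C)).conj (weyl b L s) g : (Idx n → ℂ) → ℂ) z =
    cexp (Real.pi * I / 2 * quad (realMatrix C) z) *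
     (cexp (Real.pi * b * (∑ a, (L a : ℂ) * z a) - Real.pi * I * b ^ 2 * (L ⬝ᵥ s : ℤ) / 2) *
      (cexp (Real.pi * I / 2 * quad (-realMatrix C) (fun a => z a - I * b * s a)) *
        (g : (Idx n → ℂ) → ℂ) fun a => z a - I * b * s a)) := rfl
  rw [this, weyl_apply, ← mul_assoc, ← mul_assoc, ← Complex.exp_add, ← Complex.exp_add, quad_neg,
    quad_sub hC, sub_dotProduct]
  congr 2
  simp only [Pi.sub_apply, Int.cast_sub, sub_mul, Finset.sum_sub_distrib]
  linear_combination (Real.pi * b * ∑ a, (C.mulVec s a : ℂ) * z a) * I_sq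

/-! ## Expansion of the generators in Weyl operators -/

theorem sum_coord {n : ℕ} (s : Finset ℕ) (f g : ℕ → ℕ) (z : Idx n → ℂ) :
    ∑ j ∈ s, coord z (f j) (g j) =
      ∑ p : Idx n, (∑ j ∈ s, if (p.1.1 : ℕ) = f j ∧ (p.1.2 : ℕ) = g j then 1 else 0 : ℂ) * z p := by
  simp only [coord]
  rw [Finset.sum_comm]
  refine Finset.sum_congr rfl fun p _ => ?_
  rw [Finset.sum_mul]
  exact Finset.sum_congr rfl fun j _ => by split_ifs <;> simp

theorem sum_ite_eq_and {s : Finset ℕ} (a : ℕ) (P : ℕ → Prop) [DecidablePred P] :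
    (∑ j ∈ s, if a = j ∧ P j then 1 else 0 : ℂ) = if a ∈ s ∧ P a then 1 else 0 := by
  simp only [ite_and, Finset.sum_ite_eq]

theorem idx_lt {n : ℕ} (p : Idx n) : 0 < (p.1.1 : ℕ) ∧ (p.1.1 : ℕ) < p.1.2 ∧ (p.1.2 : ℕ) ≤ n :=
  ⟨p.2.1, p.2.2, by omega⟩

theorem wE_eq {n : ℕ} (α : ℕ → ℝ) (i k : ℕ) (z : Idx n → ℂ) :
    wE α i k z = α k + ∑ a, (linE n i k a : ℂ) * z a := by
  rw [wE, sum_coord, sub_eq_add_neg, ← Finset.sum_neg_distrib]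
  congr 1
  refine Finset.sum_congr rfl fun p _ => ?_
  rw [sum_ite_eq_and (p.1.1 : ℕ) fun j => (p.1.2 : ℕ) = i + j, ← neg_mul]
  congr 1
  have := idx_lt p
  simp only [linE, form, Finset.mem_Icc]
  push_cast
  split_ifs <;> first | omega | simp

theorem wF_eq {n : ℕ} (α : ℕ → ℝ) (i k : ℕ) (z : Idx n → ℂ) :
    wF α i k z = α k + ∑ a, (linF n i k a : ℂ) * z a := by
  rw [wF, sum_coord, sum_coord, sub_eq_add_neg, ← Finset.sum_neg_distrib, add_assoc,
    ← Finset.sum_add_distrib]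
  congr 1
  refine Finset.sum_congr rfl fun p _ => ?_
  rw [sum_ite_eq_and (p.1.1 : ℕ) fun j => (p.1.2 : ℕ) = i]
  simp only [and_comm (a := (p.1.1 : ℕ) = i)]
  rw [sum_ite_eq_and (p.1.2 : ℕ) fun j => (p.1.1 : ℕ) = i, ← neg_mul, ← add_mul]
  congr 1
  have := idx_lt p
  simp only [linF, form, Finset.mem_Icc]
  push_cast
  split_ifs <;> first | omega | simp

theorem wH_eq {n : ℕ} (i : ℕ) (z : Idx n → ℂ) :
    wH i z = ∑ a, (linH n i a : ℂ) * z a := by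
  rw [wH, sum_coord, sum_coord, sum_coord, ← Finset.sum_sub_distrib, ← Finset.sum_sub_distrib]
  refine Finset.sum_congr rfl fun p _ => ?_
  rw [sum_ite_eq_and (p.1.1 : ℕ) fun j => (p.1.2 : ℕ) = i,
    sum_ite_eq_and (p.1.1 : ℕ) fun j => (p.1.2 : ℕ) = i + j]
  simp only [and_comm (a := (p.1.1 : ℕ) = i)]
  rw [sum_ite_eq_and (p.1.2 : ℕ) fun j => (p.1.1 : ℕ) = i, ← sub_mul, ← sub_mul]
  congr 1
  have := idx_lt p
  simp only [linH, linE, linF, form, Finset.mem_Icc, Pi.sub_apply]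
  push_cast
  split_ifs <;> first | omega | simp

theorem opK_eq (n : ℕ) (b : ℝ) (i : ℕ) (m : ℤ) : opK n b i m = weyl b (m • linH n i) 0 := by
  refine end_ext fun g z => ?_
  rw [opK, mulOp_apply, weyl_apply, wH_eq]
  simp only [dotProduct_zero, Pi.smul_apply, smul_eq_mul, Int.cast_mul, Int.cast_zero, mul_zero,
    zero_div, sub_zero, Pi.zero_apply, mul_assoc, ← Finset.mul_sum]

/-- The real number `(2 sin (π b²))⁻¹ = i / (q - q⁻¹)`. -/
noncomputable def sinCoef (b : ℝ) : ℝ := (2 * Real.sin (Real.pi * b ^ 2))⁻¹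

theorem qPar_sub_inv (b : ℝ) :
    qPar b - (qPar b)⁻¹ = I * ((2 * Real.sin (Real.pi * b ^ 2) : ℝ) : ℂ) := by
  have h : qPar b = cexp ((Real.pi * b ^ 2 : ℝ) * I) := by
    rw [qPar]; congr 1; push_cast; ring
  rw [h, ← Complex.exp_neg, ← neg_mul]
  push_cast
  rw [Complex.sin]
  linear_combination (cexp (Real.pi * b ^ 2 * I) - cexp (-(Real.pi * b ^ 2) * I)) * I_sq

theorem sinCoef_eq (b : ℝ) : (sinCoef b : ℂ) = I * (qPar b - (qPar b)⁻¹)⁻¹ := by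
  rw [qPar_sub_inv, mul_inv, sinCoef, ← mul_assoc, Complex.mul_inv_cancel I_ne_zero, one_mul,
    Complex.ofReal_inv]

/-- One of the two Weyl operators in a term of `E_i` or `F_i`. -/
noncomputable def weylTerm {n : ℕ} (b a : ℝ) (L s : Idx n → ℤ) (σ : ℤ) : Module.End ℂ (Dom n) :=
  (Real.exp (-(σ * (Real.pi * b * a))) : ℂ) • weyl b (-σ • L) s

/-- In the exponent πi b² · Q/2b = πi/2 + πi b²/2 the first part gives the factor i that makes the
coefficient real. The second is the Weyl normalization phase, thanks to L·s = 1. -/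
theorem qNum_mul_pExp {n : ℕ} {b : ℝ} (hb : b ≠ 0) (a : ℝ) {L s : Idx n → ℤ} (hLs : L ⬝ᵥ s = 1)
    {w : (Idx n → ℂ) → ℂ} (hw : ∀ z, w z = a + ∑ c, (L c : ℂ) * z c)
    (h : Tempered fun z => qNum b ((b + b⁻¹) / (2 * b) + I / b * w z)) :
    mulOp (fun z => qNum b ((b + b⁻¹) / (2 * b) + I / b * w z)) h * pExp b s =
      (sinCoef b : ℂ) • ∑ σ ∈ ({1, -1} : Finset ℤ), weylTerm b a L s σ := by
  have hb' : (b : ℂ) ≠ 0 := by exact_mod_cast hb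
  refine end_ext fun g z => ?_
  rw [Finset.sum_pair (by norm_num), smul_dom_apply, add_dom_apply, weylTerm, weylTerm,
    smul_dom_apply, smul_dom_apply, Module.End.mul_apply, mulOp_apply, pExp_apply, weyl_apply,
    weyl_apply]
  generalize (g : (Idx n → ℂ) → ℂ) (fun c => z c - I * b * s c) = G
  rw [← mul_assoc _ _ G, ← mul_assoc _ _ G, ← add_mul, ← mul_assoc _ _ G]
  congr 1
  rw [sinCoef_eq, qNum, hw, div_eq_mul_inv, Complex.ofReal_exp, Complex.ofReal_exp,
    ← Complex.exp_add, ← Complex.exp_add, Complex.ofReal_inv]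
  set S := ∑ c, (L c : ℂ) * z c with hS
  have e1 : ∀ σ : ℤ, ∑ c, ((-σ • L) c : ℂ) * z c = -(σ * S) := by
    intro σ
    rw [hS, Finset.mul_sum, ← Finset.sum_neg_distrib]
    refine Finset.sum_congr rfl fun c _ => ?_
    simp only [Pi.smul_apply, smul_eq_mul]
    push_cast
    ring
  have e2 : Real.pi * I * b ^ 2 * ((b + (b : ℂ)⁻¹) / (2 * b) + I / b * (a + S)) =
      Real.pi / 2 * I + (-(Real.pi * b * (a + S)) + Real.pi * I * b ^ 2 / 2) := by
    field_simp
    linear_combination (2 * b * (a + S)) * I_sq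
  have e3 : cexp (Real.pi / 2 * I) = I := Complex.exp_pi_div_two_mul_I
  have e4 : cexp (-(Real.pi / 2 * I)) = -I := by
    rw [Complex.exp_neg, e3, Complex.inv_I]
  rw [e1, e1, smul_dotProduct, smul_dotProduct, hLs, e2, neg_add (Real.pi / 2 * I),
    Complex.exp_add, Complex.exp_add (-(Real.pi / 2 * I)), e3, e4]
  have e5 : -(Real.pi * b * (a + S)) + Real.pi * I * b ^ 2 / 2 =
      (-(((1 : ℤ) : ℝ) * (Real.pi * b * a)) : ℝ) + (Real.pi * b * -((1 : ℤ) * S)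
        - Real.pi * I * b ^ 2 * ((-1 • 1 : ℤ) : ℂ) / 2) := by
    simp only [smul_eq_mul]
    push_cast
    ring
  have e6 : -(-(Real.pi * b * (a + S)) + Real.pi * I * b ^ 2 / 2) =
      (-(((-1 : ℤ) : ℝ) * (Real.pi * b * a)) : ℝ) + (Real.pi * b * -((-1 : ℤ) * S)
        - Real.pi * I * b ^ 2 * ((- -1 • 1 : ℤ) : ℂ) / 2) := by
    simp only [smul_eq_mul]
    push_cast
    ring
  rw [e6, e5]
  ring

theorem opE_eq {n : ℕ} {b : ℝ} (hb : b ≠ 0) (α : ℕ → ℝ) {i : ℕ} (hi : 1 ≤ i) :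
    opE n b α i = (sinCoef b : ℂ) • ∑ k ∈ Finset.Icc 1 (n - i), ∑ σ ∈ ({1, -1} : Finset ℤ),
      weylTerm b (α k) (linE n i k) (shiftE n i k) σ := by
  rw [opE, Finset.smul_sum]
  refine Finset.sum_congr rfl fun k hk => ?_
  rw [Finset.mem_Icc] at hk
  refine qNum_mul_pExp hb (α k) ?_ (fun z => wE_eq α i k z) _
  rw [linE_dot_shiftE n i i k k hi hk.1 hi hk.1 (by omega)]
  simp [pairing]

theorem opF_eq {n : ℕ} {b : ℝ} (hb : b ≠ 0) (α : ℕ → ℝ) {i : ℕ} (hi : i < n) :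
    opF n b α i = (sinCoef b : ℂ) • ∑ k ∈ Finset.Icc 1 i, ∑ σ ∈ ({1, -1} : Finset ℤ),
      weylTerm b (α k) (linF n i k) (shiftF n i k) σ := by
  rw [opF, Finset.smul_sum]
  refine Finset.sum_congr rfl fun k hk => ?_
  rw [Finset.mem_Icc] at hk
  refine qNum_mul_pExp hb (α k) ?_ (fun z => wF_eq α i k z) _
  rw [linF_dot_shiftF n i i k k hk.1 hk.2 hk.1 hk.2 hi]
  simp [pairing]

/-! ## Sums of `q`-commuting elements -/

section Abstract

variable {A : Type*} [Ring A]

/-- The commutator `x y - y x`. -/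
def bracket (x y : A) : A := x * y - y * x

theorem bracket_eq_zero {x y : A} (h : x * y = y * x) : bracket x y = 0 := sub_eq_zero.2 h

theorem bracket_sum_sum {ι κ : Type*} (s : Finset ι) (t : Finset κ) (x : ι → A) (y : κ → A) :
    bracket (∑ k ∈ s, x k) (∑ l ∈ t, y l) = ∑ k ∈ s, ∑ l ∈ t, bracket (x k) (y l) := by
  simp only [bracket, Finset.sum_sub_distrib]
  rw [Finset.sum_mul_sum, Finset.sum_mul_sum, Finset.sum_comm (s := t)]

variable [Algebra ℂ A]

/-- The trilinear form of the quantum Serre relation. -/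
noncomputable def serreForm (q : ℂ) (x x' y : A) : A :=
  x * x' * y - (q + q⁻¹) • (x * y * x') + y * x * x'

/-- All six monomials are multiples of y x' x. If f = f' the total coefficient is (q^e + 1)(q^f -
q)(q^f - q⁻¹) = 0; if f' = -f it vanishes exactly because e = -2f. -/
theorem serreForm_add_swap {q : ℂ} (hq : q ≠ 0) {x x' y : A} {e f f' : ℤ}
    (h : x * x' = q ^ e • (x' * x)) (hf : x * y = q ^ f • (y * x)) (hf' : x' * y = q ^ f' • (y * x'))
    (h1 : f = 1 ∨ f = -1) (h2 : f' = 1 ∨ f' = -1) (he : f ≠ f' → e = f' - f) :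
    serreForm q x x' y + serreForm q x' x y = 0 := by
  have a1 : x' * x * y = (q ^ f * q ^ f') • (y * x' * x) := by
    rw [mul_assoc, hf, mul_smul_comm, ← mul_assoc, hf', smul_mul_assoc, smul_smul]
  have a2 : x * x' * y = (q ^ e * (q ^ f * q ^ f')) • (y * x' * x) := by
    rw [h, smul_mul_assoc, a1, smul_smul]
  have a3 : y * x * x' = q ^ e • (y * x' * x) := by
    rw [mul_assoc, h, mul_smul_comm, mul_assoc]
  have a4 : x * y * x' = (q ^ f * q ^ e) • (y * x' * x) := by
    rw [hf, smul_mul_assoc, a3, smul_smul]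
  have a5 : x' * y * x = q ^ f' • (y * x' * x) := by
    rw [hf', smul_mul_assoc]
  rw [serreForm, serreForm, a1, a2, a3, a4, a5]
  generalize y * x' * x = P
  have : (q ^ e * (q ^ f * q ^ f') - (q + q⁻¹) * (q ^ f * q ^ e) + q ^ e +
      (q ^ f * q ^ f' - (q + q⁻¹) * q ^ f' + 1)) = 0 := by
    rcases h1 with rfl | rfl <;> rcases h2 with rfl | rfl
    · simp only [zpow_one]
      field_simp
      ring
    · rw [he (by norm_num)]
      norm_num [zpow_ofNat]
      field_simp
      ring
    · rw [he (by norm_num)]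
      norm_num [zpow_ofNat]
      field_simp
      ring
    · simp only [zpow_neg, zpow_one]
      field_simp
      ring
  calc _ = (q ^ e * (q ^ f * q ^ f') - (q + q⁻¹) * (q ^ f * q ^ e) + q ^ e +
      (q ^ f * q ^ f' - (q + q⁻¹) * q ^ f' + 1)) • P := by module
    _ = 0 := by rw [this, zero_smul]

theorem serreForm_sum_left {ι : Type*} (q : ℂ) (s : Finset ι) (x : ι → A) (x' y : A) :
    serreForm q (∑ k ∈ s, x k) x' y = ∑ k ∈ s, serreForm q (x k) x' y := by
  simp only [serreForm, Finset.sum_mul, Finset.mul_sum, Finset.smul_sum, Finset.sum_add_distrib,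
    Finset.sum_sub_distrib]

theorem serreForm_sum_mid {ι : Type*} (q : ℂ) (s : Finset ι) (x : A) (x' : ι → A) (y : A) :
    serreForm q x (∑ k ∈ s, x' k) y = ∑ k ∈ s, serreForm q x (x' k) y := by
  simp only [serreForm, Finset.sum_mul, Finset.mul_sum, Finset.smul_sum, Finset.sum_add_distrib,
    Finset.sum_sub_distrib]

theorem serreForm_sum_right {ι : Type*} (q : ℂ) (s : Finset ι) (x x' : A) (y : ι → A) :
    serreForm q x x' (∑ l ∈ s, y l) = ∑ l ∈ s, serreForm q x x' (y l) := by
  simp only [serreForm, Finset.sum_mul, Finset.mul_sum, Finset.smul_sum, Finset.sum_add_distrib,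
    Finset.sum_sub_distrib]

/-- The double sum over k and k' is unchanged by exchanging them, so twice it is a sum of
symmetrized terms. -/
theorem serre_sum {ι κ : Type*} (q : ℂ) (s : Finset ι) (t : Finset κ) (x : ι → A) (y : κ → A)
    (h : ∀ k ∈ s, ∀ k' ∈ s, ∀ l ∈ t,
      serreForm q (x k) (x k') (y l) + serreForm q (x k') (x k) (y l) = 0) :
    serreForm q (∑ k ∈ s, x k) (∑ k ∈ s, x k) (∑ l ∈ t, y l) = 0 := by
  have h1 : serreForm q (∑ k ∈ s, x k) (∑ k ∈ s, x k) (∑ l ∈ t, y l) =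
      ∑ k ∈ s, ∑ k' ∈ s, ∑ l ∈ t, serreForm q (x k) (x k') (y l) := by
    rw [serreForm_sum_left]
    refine Finset.sum_congr rfl fun k _ => ?_
    rw [serreForm_sum_mid]
    exact Finset.sum_congr rfl fun k' _ => serreForm_sum_right ..
  have h2 : serreForm q (∑ k ∈ s, x k) (∑ k ∈ s, x k) (∑ l ∈ t, y l) =
      ∑ k ∈ s, ∑ k' ∈ s, ∑ l ∈ t, serreForm q (x k') (x k) (y l) := by
    rw [h1, Finset.sum_comm]
  have h3 : (2 : ℂ) • serreForm q (∑ k ∈ s, x k) (∑ k ∈ s, x k) (∑ l ∈ t, y l) = 0 := by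
    rw [two_smul]
    nth_rewrite 1 [h1]
    rw [h2]
    simp only [← Finset.sum_add_distrib]
    exact Finset.sum_eq_zero fun k hk => Finset.sum_eq_zero fun k' hk' =>
      Finset.sum_eq_zero fun l hl => h k hk k' hk' l hl
  exact (smul_eq_zero.1 h3).resolve_left two_ne_zero

theorem serreForm_smul (q c c' : ℂ) (x y : A) :
    serreForm q (c • x) (c • x) (c' • y) = (c * c * c') • serreForm q x x y := by
  simp only [serreForm, smul_mul_assoc, mul_smul_comm]
  module

theorem bracket_eq_smul {x y w : A} {c d : ℂ} (h : x * y = c • w) (h' : y * x = d • w) :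
    bracket x y = (c - d) • w := by
  rw [bracket, h, h', sub_smul]

theorem bracket_smul_smul (c d : ℂ) (x y : A) : bracket (c • x) (d • y) = (c * d) • bracket x y := by
  rw [bracket, bracket, smul_mul_smul_comm, smul_mul_smul_comm, smul_sub, mul_comm d]

end Abstract

/-! ## The Drinfeld-Jimbo relations -/

theorem weylTerm_comm {n : ℕ} (b a a' : ℝ) (L s L' s' : Idx n → ℤ) (σ σ' : ℤ) :
    weylTerm b a L s σ * weylTerm b a' L' s' σ' =
      qPar b ^ (σ' * (L' ⬝ᵥ s) - σ * (L ⬝ᵥ s')) •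
        (weylTerm b a' L' s' σ' * weylTerm b a L s σ) := by
  simp only [weylTerm, smul_mul_assoc, mul_smul_comm, smul_smul]
  rw [weyl_comm, smul_smul, qPar_zpow, smul_dotProduct, smul_dotProduct, smul_eq_mul, smul_eq_mul,
    show 2 * (-σ * (L ⬝ᵥ s') - -σ' * (L' ⬝ᵥ s)) = 2 * (σ' * (L' ⬝ᵥ s) - σ * (L ⬝ᵥ s')) by ring]
  congr 1
  ring

/-- These are the hypotheses of `serreForm_add_swap` on the exponents in `weylTerm_comm`. Between
neighbours exactly one of the two pairings is -1 and the other is 0, whence the values ±1. The root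
r is arbitrary because the self-pairing does not depend on it. -/
theorem pairing_adjacent {i j : ℕ} (hij : i + 1 = j ∨ j + 1 = i) (k k' l : ℕ) {σ σ' τ : ℤ}
    (hσ : σ = 1 ∨ σ = -1) (hσ' : σ' = 1 ∨ σ' = -1) (hτ : τ = 1 ∨ τ = -1) :
    (τ * pairing j i l k - σ * pairing i j k l = 1 ∨
      τ * pairing j i l k - σ * pairing i j k l = -1) ∧
    (τ * pairing j i l k - σ * pairing i j k l ≠ τ * pairing j i l k' - σ' * pairing i j k' l →
      ∀ r, σ' * pairing r r k' k - σ * pairing r r k k' =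
        (τ * pairing j i l k' - σ' * pairing i j k' l) -
          (τ * pairing j i l k - σ * pairing i j k l)) := by
  have hself : ∀ r k l, pairing r r k l = (if k < l then 1 else 0) + (if k ≤ l then 1 else 0) :=
    fun r k l => if_pos rfl
  have hsucc : ∀ i k l, pairing i (i + 1) k l = -(if k < l then 1 else 0) := by
    intro i k l; rw [pairing, if_neg (by omega), if_pos rfl]
  have hpred : ∀ i k l, pairing (i + 1) i k l = -(if k ≤ l then 1 else 0) := by
    intro i k l; rw [pairing, if_neg (by omega), if_neg (by omega), if_pos rfl]
  simp only [hself]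
  rcases hij with rfl | rfl <;> simp only [hsucc, hpred] <;> constructor
  · split_ifs <;> omega
  · intro h _
    revert h
    split_ifs <;> omega
  · split_ifs <;> omega
  · intro h _
    revert h
    split_ifs <;> omega

theorem mem_signs {σ : ℤ} : σ ∈ ({1, -1} : Finset ℤ) ↔ σ = 1 ∨ σ = -1 := by simp

section
variable {n : ℕ} {b : ℝ}

theorem smul_sum_terms_comm {S T : Finset ℕ} (c c' : ℂ) (a a' : ℕ → ℝ) (L s L' s' : ℕ → Idx n → ℤ)
    (h : ∀ k ∈ S, ∀ l ∈ T, L k ⬝ᵥ s' l = 0 ∧ L' l ⬝ᵥ s k = 0) :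
    (c • ∑ k ∈ S, ∑ σ ∈ ({1, -1} : Finset ℤ), weylTerm b (a k) (L k) (s k) σ) *
      (c' • ∑ l ∈ T, ∑ τ ∈ ({1, -1} : Finset ℤ), weylTerm b (a' l) (L' l) (s' l) τ) =
    (c' • ∑ l ∈ T, ∑ τ ∈ ({1, -1} : Finset ℤ), weylTerm b (a' l) (L' l) (s' l) τ) *
      (c • ∑ k ∈ S, ∑ σ ∈ ({1, -1} : Finset ℤ), weylTerm b (a k) (L k) (s k) σ) := by
  refine ((Commute.sum_right _ _ _ fun l hl => Commute.sum_right _ _ _ fun τ _ =>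
    Commute.sum_left _ _ _ fun k hk => Commute.sum_left _ _ _ fun σ _ => ?_).smul_left
      c).smul_right c'
  rw [Commute, SemiconjBy, weylTerm_comm, (h k hk l hl).1, (h k hk l hl).2]
  simp

theorem serre_terms {S T : Finset ℕ} (c c' : ℂ) (a a' : ℕ → ℝ) (L s L' s' : ℕ → Idx n → ℤ)
    {i j : ℕ} (hij : i + 1 = j ∨ j + 1 = i)
    (hself : ∀ k ∈ S, ∀ l ∈ S, L k ⬝ᵥ s l = pairing i i k l)
    (h1 : ∀ k ∈ S, ∀ l ∈ T, L k ⬝ᵥ s' l = pairing i j k l)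
    (h2 : ∀ k ∈ S, ∀ l ∈ T, L' l ⬝ᵥ s k = pairing j i l k) :
    serreForm (qPar b)
      (c • ∑ k ∈ S, ∑ σ ∈ ({1, -1} : Finset ℤ), weylTerm b (a k) (L k) (s k) σ)
      (c • ∑ k ∈ S, ∑ σ ∈ ({1, -1} : Finset ℤ), weylTerm b (a k) (L k) (s k) σ)
      (c' • ∑ l ∈ T, ∑ τ ∈ ({1, -1} : Finset ℤ), weylTerm b (a' l) (L' l) (s' l) τ) = 0 := by
  rw [serreForm_smul]
  refine smul_eq_zero_of_right _ ?_
  rw [← Finset.sum_product', ← Finset.sum_product']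
  refine serre_sum (qPar b) _ _ _ _ fun p hp p' hp' r hr => ?_
  rw [Finset.mem_product, mem_signs] at hp hp' hr
  have e1 := pairing_adjacent hij p.1 p'.1 r.1 hp.2 hp'.2 hr.2
  have e2 := pairing_adjacent hij p'.1 p.1 r.1 hp'.2 hp.2 hr.2
  refine serreForm_add_swap (qPar_ne_zero b) (weylTerm_comm ..) (weylTerm_comm ..)
    (weylTerm_comm ..) ?_ ?_ ?_
  · rw [h1 _ hp.1 _ hr.1, h2 _ hp.1 _ hr.1]
    exact e1.1
  · rw [h1 _ hp'.1 _ hr.1, h2 _ hp'.1 _ hr.1]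
    exact e2.1
  · rw [h1 _ hp.1 _ hr.1, h2 _ hp.1 _ hr.1, h1 _ hp'.1 _ hr.1, h2 _ hp'.1 _ hr.1,
      hself _ hp.1 _ hp'.1, hself _ hp'.1 _ hp.1]
    exact fun h => e1.2 h i

theorem opE_comm (hb : b ≠ 0) (α : ℕ → ℝ) {i j : ℕ} (hi : 1 ≤ i) (hj : 1 ≤ j) (h0 : i ≠ j)
    (h1 : i + 1 ≠ j) (h2 : j + 1 ≠ i) :
    opE n b α i * opE n b α j = opE n b α j * opE n b α i := by
  rw [opE_eq hb α hi, opE_eq hb α hj]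
  refine smul_sum_terms_comm _ _ _ _ _ _ _ _ fun k hk l hl => ?_
  rw [Finset.mem_Icc] at hk hl
  rw [linE_dot_shiftE n i j k l hi hk.1 hj hl.1 (by omega),
    linE_dot_shiftE n j i l k hj hl.1 hi hk.1 (by omega)]
  simp [pairing, h0, h0.symm, h1, h2]

theorem opF_comm (hb : b ≠ 0) (α : ℕ → ℝ) {i j : ℕ} (hi : i < n) (hj : j < n) (h0 : i ≠ j)
    (h1 : i + 1 ≠ j) (h2 : j + 1 ≠ i) :
    opF n b α i * opF n b α j = opF n b α j * opF n b α i := by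
  rw [opF_eq hb α hi, opF_eq hb α hj]
  refine smul_sum_terms_comm _ _ _ _ _ _ _ _ fun k hk l hl => ?_
  rw [Finset.mem_Icc] at hk hl
  rw [linF_dot_shiftF n i j k l hk.1 hk.2 hl.1 hl.2 hj,
    linF_dot_shiftF n j i l k hl.1 hl.2 hk.1 hk.2 hi]
  simp [pairing, h0, h0.symm, h1, h2]

theorem opE_serre (hb : b ≠ 0) (α : ℕ → ℝ) {i j : ℕ} (hi : 1 ≤ i) (hj : 1 ≤ j)
    (hij : i + 1 = j ∨ j + 1 = i) :
    serreForm (qPar b) (opE n b α i) (opE n b α i) (opE n b α j) = 0 := by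
  rw [opE_eq hb α hi, opE_eq hb α hj]
  -- The roots are interchanged because the E-pairing has them in the opposite order.
  refine serre_terms (i := j) (j := i) _ _ _ _ _ _ _ _ hij.symm (fun k hk l hl => ?_)
    (fun k hk l hl => ?_) (fun k hk l hl => ?_)
  all_goals rw [Finset.mem_Icc] at hk hl
  · rw [linE_dot_shiftE n i i k l hi hk.1 hi hl.1 (by omega), pairing, pairing, if_pos rfl,
      if_pos rfl]
  · rw [linE_dot_shiftE n i j k l hi hk.1 hj hl.1 (by omega)]
  · rw [linE_dot_shiftE n j i l k hj hl.1 hi hk.1 (by omega)]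

theorem opF_serre (hb : b ≠ 0) (α : ℕ → ℝ) {i j : ℕ} (hi : i < n) (hj : j < n)
    (hij : i + 1 = j ∨ j + 1 = i) :
    serreForm (qPar b) (opF n b α i) (opF n b α i) (opF n b α j) = 0 := by
  rw [opF_eq hb α hi, opF_eq hb α hj]
  refine serre_terms _ _ _ _ _ _ _ _ hij (fun k hk l hl => ?_)
    (fun k hk l hl => ?_) (fun k hk l hl => ?_)
  all_goals rw [Finset.mem_Icc] at hk hl
  · rw [linF_dot_shiftF n i i k l hk.1 hk.2 hl.1 hl.2 hi]
  · rw [linF_dot_shiftF n i j k l hk.1 hk.2 hl.1 hl.2 hj]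
  · rw [linF_dot_shiftF n j i l k hl.1 hl.2 hk.1 hk.2 hi]

theorem opK_mul (i : ℕ) (m m' : ℤ) : opK n b i m * opK n b i m' = opK n b i (m + m') := by
  rw [opK_eq, opK_eq, opK_eq, weyl_mul]
  simp [qHalf_zero, add_smul]

theorem opK_zero (i : ℕ) : opK n b i 0 = 1 := by
  rw [opK_eq, zero_smul, weyl_zero]

theorem opK_pow (i : ℕ) (m : ℤ) (k : ℕ) : opK n b i m ^ k = opK n b i (k * m) := by
  induction k with
  | zero => simp [opK_zero]
  | succ k ih => rw [pow_succ, ih, opK_mul]; congr 1; push_cast; ring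

theorem opK_comm (i j : ℕ) (m m' : ℤ) : opK n b i m * opK n b j m' = opK n b j m' * opK n b i m := by
  rw [opK_eq, opK_eq, weyl_comm]
  simp [qHalf_zero]

theorem opK_mul_weylTerm (i : ℕ) (a : ℝ) (L s : Idx n → ℤ) (σ : ℤ) :
    opK n b i 1 * weylTerm b a L s σ =
      qPar b ^ (linH n i ⬝ᵥ s) • (weylTerm b a L s σ * opK n b i 1) := by
  rw [opK_eq, one_smul, weylTerm, mul_smul_comm, weyl_comm, qPar_zpow, smul_mul_assoc, smul_comm,
    dotProduct_zero, sub_zero]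

theorem opK_mul_opE (hb : b ≠ 0) (α : ℕ → ℝ) {i j : ℕ} (hi : 1 ≤ i) (hj : 1 ≤ j) :
    opK n b i 1 * opE n b α j = qPar b ^ cartanNat i j • (opE n b α j * opK n b i 1) := by
  rw [opE_eq hb α hj, mul_smul_comm, smul_mul_assoc, smul_comm]
  congr 1
  simp only [Finset.mul_sum, Finset.sum_mul, Finset.smul_sum]
  refine Finset.sum_congr rfl fun k hk => Finset.sum_congr rfl fun σ _ => ?_
  rw [Finset.mem_Icc] at hk
  rw [opK_mul_weylTerm, linH_dot_shiftE n i j k hi hj hk.1 (by omega)]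

theorem opK_mul_opF (hb : b ≠ 0) (α : ℕ → ℝ) {i j : ℕ} (hi : 1 ≤ i) (hj : j < n) :
    opK n b i 1 * opF n b α j = qPar b ^ (-cartanNat i j) • (opF n b α j * opK n b i 1) := by
  rw [opF_eq hb α hj, mul_smul_comm, smul_mul_assoc, smul_comm]
  congr 1
  simp only [Finset.mul_sum, Finset.sum_mul, Finset.smul_sum]
  refine Finset.sum_congr rfl fun k hk => Finset.sum_congr rfl fun σ _ => ?_
  rw [Finset.mem_Icc] at hk
  rw [opK_mul_weylTerm, linH_dot_shiftF n i j k hi hk.1 hk.2 hj]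

/-! ### The commutator of `E_i` and `F_j` -/

/-- The commutator of the `k`-th term of `E_i` and the `l`-th term of `F_j`. -/
noncomputable def termBracket (n : ℕ) (b : ℝ) (α : ℕ → ℝ) (i j k l : ℕ) : Module.End ℂ (Dom n) :=
  ∑ σ ∈ ({1, -1} : Finset ℤ), ∑ τ ∈ ({1, -1} : Finset ℤ),
    bracket (weylTerm b (α k) (linE n i k) (shiftE n i k) σ)
      (weylTerm b (α l) (linF n j l) (shiftF n j l) τ)

theorem bracket_opE_opF (hb : b ≠ 0) (α : ℕ → ℝ) {i j : ℕ} (hi : 1 ≤ i) (hj : j < n) :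
    bracket (opE n b α i) (opF n b α j) =
      ((sinCoef b : ℂ) ^ 2) • ∑ k ∈ Finset.Icc 1 (n - i), ∑ l ∈ Finset.Icc 1 j,
        termBracket n b α i j k l := by
  rw [opE_eq hb α hi, opF_eq hb α hj, bracket_smul_smul, sq, bracket_sum_sum]
  congr 1
  exact Finset.sum_congr rfl fun k _ => Finset.sum_congr rfl fun l _ => bracket_sum_sum ..

theorem termBracket_eq_zero (α : ℕ → ℝ) {i j k l : ℕ} (hi : 1 ≤ i) (hk : 1 ≤ k) (hik : i + k ≤ n)
    (hl : 1 ≤ l) (hlj : l ≤ j) (hj : j < n) (h : crossPairing i j k l = 0) :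
    termBracket n b α i j k l = 0 := by
  refine Finset.sum_eq_zero fun σ _ => Finset.sum_eq_zero fun τ _ => bracket_eq_zero ?_
  rw [weylTerm_comm, linE_dot_shiftF n i j k l hi hk hl hlj hj,
    linF_dot_shiftE n i j k l hi hk hik hl hlj, h]
  simp

/-- For opposite signs and equal parameter the factors that contain α cancel, which is why the
commutators of E_i and F_j do not depend on α. -/
theorem weylTerm_mul_neg (a : ℝ) (L s L' s' : Idx n → ℤ) (σ : ℤ) :
    weylTerm b a L s σ * weylTerm b a L' s' (-σ) =
      qHalf b (-(σ * (L ⬝ᵥ s' + L' ⬝ᵥ s))) • weyl b (-σ • (L - L')) (s + s') := by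
  rw [weylTerm, weylTerm, smul_mul_smul_comm, weyl_mul, ← Complex.ofReal_mul, ← Real.exp_add]
  rw [show -(σ * (Real.pi * b * a)) + -(((-σ : ℤ) : ℝ) * (Real.pi * b * a)) = 0 by push_cast; ring,
    Real.exp_zero, Complex.ofReal_one, one_smul]
  congr 2
  · simp only [smul_dotProduct, smul_eq_mul]; ring
  · rw [smul_sub, neg_neg]
    simp [sub_eq_add_neg]

/-- Of the four sign combinations the two with equal signs commute. The other two have inverse
commutation phases, hence opposite coefficients. -/
theorem termBracket_self (α : ℕ → ℝ) {i j k : ℕ} (hi : 1 ≤ i) (hk : 1 ≤ k) (hik : i + k ≤ n)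
    (hkj : k ≤ j) (hj : j < n) : termBracket n b α i j k k =
      (qPar b ^ (-crossPairing i j k k) - qPar b ^ crossPairing i j k k) •
        weyl b (linF n j k - linE n i k) (shiftE n i k + shiftF n j k) +
      (qPar b ^ crossPairing i j k k - qPar b ^ (-crossPairing i j k k)) •
        weyl b (linE n i k - linF n j k) (shiftE n i k + shiftF n j k) := by
  have h1 := linE_dot_shiftF n i j k k hi hk hk hkj hj
  have h2 := linF_dot_shiftE n i j k k hi hk hik hk hkj
  have hdiag : ∀ σ, bracket (weylTerm b (α k) (linE n i k) (shiftE n i k) σ)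
      (weylTerm b (α k) (linF n j k) (shiftF n j k) σ) = 0 := by
    intro σ
    refine bracket_eq_zero ?_
    rw [weylTerm_comm, h1, h2, sub_self, zpow_zero, one_smul]
  have hoff : ∀ σ, bracket (weylTerm b (α k) (linE n i k) (shiftE n i k) σ)
      (weylTerm b (α k) (linF n j k) (shiftF n j k) (-σ)) =
      (qPar b ^ (-σ * crossPairing i j k k) - qPar b ^ (σ * crossPairing i j k k)) •
        weyl b (-σ • (linE n i k - linF n j k)) (shiftE n i k + shiftF n j k) := by
    intro σ
    refine bracket_eq_smul ?_ ?_
    · rw [weylTerm_mul_neg, h1, h2, qPar_zpow]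
      congr 2
      ring
    · have e := weylTerm_mul_neg (b := b) (α k) (linF n j k) (shiftF n j k) (linE n i k)
        (shiftE n i k) (-σ)
      rw [neg_neg] at e
      rw [e, h1, h2, qPar_zpow, add_comm (shiftF n j k), neg_smul, ← smul_neg, neg_sub]
      congr 2
      ring
  have h3 := hoff 1
  have h4 := hoff (-1)
  rw [neg_neg] at h4
  rw [termBracket, Finset.sum_pair (by norm_num), Finset.sum_pair (by norm_num),
    Finset.sum_pair (by norm_num), hdiag, hdiag, h3, h4]
  simp only [neg_mul, one_mul, neg_smul, one_smul, neg_sub, zero_add, add_zero]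

/-- For i = j the cross pairing is nonzero only at k = l = 1, where the two shifts are opposite and
the difference of the u-exponents is `linH`. -/
theorem bracket_opE_opF_self (hb : b ≠ 0) (hq : qPar b - (qPar b)⁻¹ ≠ 0) (α : ℕ → ℝ) {i : ℕ}
    (hi : 1 ≤ i) (hin : i < n) : bracket (opE n b α i) (opF n b α i) =
      (qPar b - (qPar b)⁻¹)⁻¹ • opK n b i 1 + (-(qPar b - (qPar b)⁻¹)⁻¹) • opK n b i (-1) := by
  have hzero : ∀ k ∈ Finset.Icc 1 (n - i), ∀ l ∈ Finset.Icc 1 i, ¬(k = 1 ∧ l = 1) →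
      termBracket n b α i i k l = 0 := by
    intro k hk l hl hkl
    rw [Finset.mem_Icc] at hk hl
    refine termBracket_eq_zero α hi hk.1 (by omega) hl.1 hl.2 hin ?_
    rw [crossPairing]
    split_ifs <;> omega
  -- For k = 1 the basis vectors with first index k - 1 = 0 vanish, and the remaining ones cancel in
  -- pairs.
  have hS : shiftE n i 1 + shiftF n i 1 = 0 := by
    have e : ∀ c, delta n 0 c = 0 := fun c => delta_eq_zero (by omega)
    simp only [shiftE, shiftF, Nat.sub_self, Nat.add_sub_cancel, e]
    abel
  have hL : linF n i 1 - linE n i 1 = -linH n i := by rw [linH, neg_sub]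
  rw [bracket_opE_opF hb α hi hin,
    Finset.sum_eq_single 1 (fun k hk h1 => Finset.sum_eq_zero fun l hl =>
      hzero k hk l hl fun h => h1 h.1) (fun h => absurd (Finset.mem_Icc.2 ⟨le_rfl, by omega⟩) h),
    Finset.sum_eq_single 1 (fun l hl h1 => hzero 1 (Finset.mem_Icc.2 ⟨le_rfl, by omega⟩) l hl
      fun h => h1 h.2) (fun h => absurd (Finset.mem_Icc.2 ⟨le_rfl, hi⟩) h),
    termBracket_self α hi le_rfl (by omega) hi hin, hS, hL, opK_eq, opK_eq, one_smul, neg_smul,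
    one_smul, show linE n i 1 - linF n i 1 = linH n i from rfl,
    show crossPairing i i 1 1 = -1 by simp [crossPairing], neg_neg, zpow_one, zpow_neg_one,
    smul_add, smul_smul, smul_smul, sinCoef_eq, add_comm]
  congr 2
  · rw [mul_pow, I_sq]
    generalize qPar b = q at hq ⊢
    generalize q⁻¹ = r at hq ⊢
    field_simp
    ring
  · rw [mul_pow, I_sq]
    generalize qPar b = q at hq ⊢
    generalize q⁻¹ = r at hq ⊢
    field_simp

/-- For j < i all terms commute. For j = i + k only the diagonal terms k and k + 1 contribute; they
involve the same Weyl operators and their cross pairings are 1 and -1, so they cancel. -/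
theorem bracket_opE_opF_of_ne (hb : b ≠ 0) (α : ℕ → ℝ) {i j : ℕ}
    (hi : 1 ≤ i) (hj : j < n) (hij : i ≠ j) :
    bracket (opE n b α i) (opF n b α j) = 0 := by
  have hzero : ∀ k ∈ Finset.Icc 1 (n - i), ∀ l ∈ Finset.Icc 1 j,
      ¬(k = l ∧ (j = i + k ∨ j + 1 = i + k)) → termBracket n b α i j k l = 0 := by
    intro k hk l hl hkl
    rw [Finset.mem_Icc] at hk hl
    refine termBracket_eq_zero α hi hk.1 (by omega) hl.1 hl.2 hj ?_
    rw [crossPairing]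
    split_ifs <;> omega
  rw [bracket_opE_opF hb α hi hj]
  refine smul_eq_zero_of_right _ ?_
  rcases lt_or_gt_of_ne hij with h | h
  · obtain ⟨k, rfl⟩ : ∃ k, j = i + k := ⟨j - i, by omega⟩
    have hk : 1 ≤ k := by omega
    have hinner : ∀ k' ∈ Finset.Icc 1 (n - i), k' = k ∨ k' = k + 1 →
        ∑ l ∈ Finset.Icc 1 (i + k), termBracket n b α i (i + k) k' l =
          termBracket n b α i (i + k) k' k' := fun k' hk' hor =>
      Finset.sum_eq_single k' (fun l hl hne => hzero k' hk' l hl fun h => hne h.1.symm)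
        fun hn => absurd (Finset.mem_Icc.2 ⟨by omega, by omega⟩) hn
    have hS : shiftE n i k + shiftF n (i + k) k =
        shiftE n i (k + 1) + shiftF n (i + k) (k + 1) := by
      simp only [shiftE, shiftF, Nat.add_sub_cancel, ← add_assoc]
      abel
    have hL : linE n i k - linF n (i + k) k = linE n i (k + 1) - linF n (i + k) (k + 1) := by
      ext p
      simp only [linE, linF, form, Pi.sub_apply]
      split_ifs <;> omega
    have hL' : linF n (i + k) k - linE n i k = linF n (i + k) (k + 1) - linE n i (k + 1) := by
      rw [← neg_sub, hL, neg_sub]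
    have m1 : k ∈ Finset.Icc 1 (n - i) := Finset.mem_Icc.2 ⟨by omega, by omega⟩
    have m2 : k + 1 ∈ Finset.Icc 1 (n - i) := Finset.mem_Icc.2 ⟨by omega, by omega⟩
    rw [Finset.sum_eq_add_of_mem k (k + 1) m1 m2 (by omega) fun c hc hne =>
        Finset.sum_eq_zero fun l hl => hzero c hc l hl (by omega),
      hinner k m1 (Or.inl rfl), hinner (k + 1) m2 (Or.inr rfl),
      termBracket_self α hi hk (by omega) (by omega) hj,
      termBracket_self α hi (by omega) (by omega) (by omega) hj, hS, hL, hL',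
      show crossPairing i (i + k) k k = 1 by simp [crossPairing],
      show crossPairing i (i + k) (k + 1) (k + 1) = -1 by simp [crossPairing, add_assoc],
      neg_neg]
    module
  · refine Finset.sum_eq_zero fun k hk => Finset.sum_eq_zero fun l hl => hzero k hk l hl ?_
    rw [Finset.mem_Icc] at hk
    omega

end

/-! ## The representation of the quantum group -/

/-- The difference is 2i sin(πb²), whose vanishing would force b² to be an integer. -/
theorem qPar_sub_inv_ne_zero {b : ℝ} (hb : Irrational (b ^ 2)) : qPar b - (qPar b)⁻¹ ≠ 0 := by
  rw [qPar_sub_inv]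
  refine mul_ne_zero I_ne_zero ?_
  rw [Complex.ofReal_ne_zero]
  refine mul_ne_zero two_ne_zero fun h => ?_
  obtain ⟨m, hm⟩ := Real.sin_eq_zero_iff.1 h
  rw [mul_comm] at hm
  exact hb ⟨m, by exact_mod_cast mul_left_cancel₀ Real.pi_ne_zero hm⟩

theorem cartan_eq {n : ℕ} (i j : Fin (n - 1)) :
    cartan i j = cartanNat ((i : ℕ) + 1) ((j : ℕ) + 1) := by
  simp only [cartan, cartanNat, Fin.ext_iff, add_left_inj]

theorem cartan_eq_zero {n : ℕ} {i j : Fin (n - 1)} (h : cartan i j = 0) :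
    (i : ℕ) + 1 ≠ j + 1 ∧ (i : ℕ) + 1 + 1 ≠ j + 1 ∧ (j : ℕ) + 1 + 1 ≠ i + 1 := by
  rw [cartan_eq, cartanNat] at h
  split_ifs at h <;> omega

theorem cartan_eq_neg_one {n : ℕ} {i j : Fin (n - 1)} (h : cartan i j = -1) :
    (i : ℕ) + 1 + 1 = j + 1 ∨ (j : ℕ) + 1 + 1 = i + 1 := by
  rw [cartan_eq, cartanNat] at h
  split_ifs at h
  omega

/-- The operators representing the generators of `U_q(sl(n))`. -/
noncomputable def uqOp (n : ℕ) (b : ℝ) (α : ℕ → ℝ) : QGen n → Module.End ℂ (Dom n)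
  | .E i => opE n b α (i + 1)
  | .F i => opF n b α (i + 1)
  | .K i => opK n b (i + 1) 1
  | .Kinv i => opK n b (i + 1) (-1)

theorem smul_add_neg_smul {A : Type*} [Ring A] [Algebra ℂ A] (c : ℂ) (x y : A) :
    c • x + (-c) • y = c • (x - y) := by module

theorem uqOp_rel {n : ℕ} {b : ℝ} (hb : 0 < b) (hb2 : Irrational (b ^ 2)) (α : ℕ → ℝ)
    {x y : FreeAlgebra ℂ (QGen n)} (h : QRel n (qPar b) x y) :
    FreeAlgebra.lift ℂ (uqOp n b α) x = FreeAlgebra.lift ℂ (uqOp n b α) y := by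
  have hlt : ∀ i : Fin (n - 1), (i : ℕ) + 1 < n := fun i => by omega
  have hpos : ∀ i : Fin (n - 1), 1 ≤ (i : ℕ) + 1 := fun i => by omega
  induction h with
  | K_Kinv i =>
    simp only [map_mul, map_one, FreeAlgebra.lift_ι_apply, uqOp, opK_mul]
    exact opK_zero _
  | Kinv_K i =>
    simp only [map_mul, map_one, FreeAlgebra.lift_ι_apply, uqOp, opK_mul]
    exact opK_zero _
  | K_K i j =>
    simp only [map_mul, FreeAlgebra.lift_ι_apply, uqOp]
    exact opK_comm _ _ _ _
  | K_E i j =>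
    simp only [map_mul, map_smul, FreeAlgebra.lift_ι_apply, uqOp, cartan_eq]
    exact opK_mul_opE hb.ne' α (hpos i) (hpos j)
  | K_F i j =>
    simp only [map_mul, map_smul, FreeAlgebra.lift_ι_apply, uqOp, cartan_eq]
    exact opK_mul_opF hb.ne' α (hpos i) (hlt j)
  | E_F i j =>
    simp only [map_mul, map_sub, FreeAlgebra.lift_ι_apply, uqOp]
    split_ifs with hij
    · subst hij
      simp only [map_smul, map_sub, FreeAlgebra.lift_ι_apply, uqOp]
      have h1 := bracket_opE_opF_self hb.ne' (qPar_sub_inv_ne_zero hb2) α (hpos i) (hlt i)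
      have h2 := smul_add_neg_smul (qPar b - (qPar b)⁻¹)⁻¹ (opK n b (i + 1) 1) (opK n b (i + 1) (-1))
      exact h1.trans h2
    · rw [map_zero]
      exact bracket_opE_opF_of_ne hb.ne' α (hpos i) (hlt j) fun h => hij (Fin.ext (by omega))
  | E_E i j hij =>
    simp only [map_mul, FreeAlgebra.lift_ι_apply, uqOp]
    have h := cartan_eq_zero hij
    exact opE_comm hb.ne' α (hpos i) (hpos j) h.1 h.2.1 h.2.2
  | F_F i j hij =>
    simp only [map_mul, FreeAlgebra.lift_ι_apply, uqOp]
    have h := cartan_eq_zero hij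
    exact opF_comm hb.ne' α (hlt i) (hlt j) h.1 h.2.1 h.2.2
  | serre_E i j hij =>
    simp only [map_add, map_sub, map_mul, map_smul, map_zero, FreeAlgebra.lift_ι_apply, uqOp]
    exact opE_serre hb.ne' α (hpos i) (hpos j) (cartan_eq_neg_one hij)
  | serre_F i j hij =>
    simp only [map_add, map_sub, map_mul, map_smul, map_zero, FreeAlgebra.lift_ι_apply, uqOp]
    exact opF_serre hb.ne' α (hlt i) (hlt j) (cartan_eq_neg_one hij)

/-- The positive representation of `U_q(sl(n))`. -/
noncomputable def uqRep (n : ℕ) {b : ℝ} (hb : 0 < b) (hb2 : Irrational (b ^ 2)) (α : ℕ → ℝ) :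
    Uq n (qPar b) →ₐ[ℂ] Module.End ℂ (Dom n) :=
  RingQuot.liftAlgHom ℂ ⟨FreeAlgebra.lift ℂ (uqOp n b α), fun _ _ h => uqOp_rel hb hb2 α h⟩

theorem uqRep_gen {n : ℕ} {b : ℝ} (hb : 0 < b) (hb2 : Irrational (b ^ 2)) (α : ℕ → ℝ)
    (g : QGen n) : uqRep n hb hb2 α (Uq.gen (qPar b) g) = uqOp n b α g := by
  rw [uqRep, Uq.gen, RingQuot.liftAlgHom_mkAlgHom_apply, FreeAlgebra.lift_ι_apply]

theorem uqRep_modGen {n : ℕ} {b : ℝ} (hb : 0 < b) (hb2 : Irrational (b ^ 2)) (α : ℕ → ℝ)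
    (g : QGen n) : uqRep n hb hb2 α (Uq.modGen (qPar b) g) = modOp n b α g := by
  cases g <;>
    simp only [Uq.modGen, modOp, map_smul, map_mul, map_pow, uqRep_gen, uqOp, opK_pow, mul_one,
      mul_neg, Nat.cast_add, Nat.cast_one, Nat.cast_ofNat]

/-! ## The modified operators -/

section
variable {n : ℕ} {b : ℝ}

theorem weylTerm_mul_opK (a : ℝ) (L s : Idx n → ℤ) (σ : ℤ) (i : ℕ) (m : ℤ) :
    weylTerm b a L s σ * opK n b i m = (Real.exp (-(σ * (Real.pi * b * a))) : ℂ) •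
      (qHalf b (-(m * (linH n i ⬝ᵥ s))) • weyl b (-σ • L + m • linH n i) s) := by
  rw [weylTerm, opK_eq, smul_mul_assoc, weyl_mul, dotProduct_zero, zero_sub, smul_dotProduct,
    smul_eq_mul, add_zero]

/-- The operator `𝐄_i` as a sum of Weyl operators. -/
theorem modOp_E_eq (hb : b ≠ 0) (α : ℕ → ℝ) (i : Fin (n - 1)) :
    modOp n b α (.E i) = ∑ k ∈ Finset.Icc 1 (n - (i + 1)), ∑ σ ∈ ({1, -1} : Finset ℤ),
      ((sinCoef b * Real.exp (-(σ * (Real.pi * b * α k))) : ℝ) : ℂ) •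
        weyl b (-σ • linE n (i + 1) k + ((i : ℤ) + 1) • linH n (i + 1)) (shiftE n (i + 1) k) := by
  rw [modOp, opE_eq hb α (by omega), smul_mul_assoc, Finset.sum_mul]
  simp only [Finset.smul_sum, Finset.sum_mul]
  refine Finset.sum_congr rfl fun k hk => Finset.sum_congr rfl fun σ _ => ?_
  rw [Finset.mem_Icc] at hk
  rw [weylTerm_mul_opK, linH_dot_shiftE n _ _ k (by omega) (by omega) hk.1 (by omega), qPar_pow,
    smul_smul, smul_smul, smul_smul, cartanNat, if_pos rfl]
  congr 1
  -- The prefactor of the modified generator is exactly the inverse of the phase from merging the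
  -- K-power into the Weyl operator. The coefficients therefore stay real.
  have e : qHalf b (2 * ((i : ℕ) + 1 : ℕ)) * qHalf b (-(((i : ℤ) + 1) * 2)) = 1 := by
    rw [← qHalf_add, ← qHalf_zero b]; congr 1; push_cast; ring
  push_cast at e ⊢
  linear_combination (sinCoef b * cexp (-(σ * (Real.pi * b * α k)))) * e

/-- The operator `𝐅_i` as a sum of Weyl operators. -/
theorem modOp_F_eq (hb : b ≠ 0) (α : ℕ → ℝ) (i : Fin (n - 1)) :
    modOp n b α (.F i) = ∑ k ∈ Finset.Icc 1 ((i : ℕ) + 1), ∑ σ ∈ ({1, -1} : Finset ℤ),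
      ((sinCoef b * Real.exp (-(σ * (Real.pi * b * α k))) : ℝ) : ℂ) •
        weyl b (-σ • linF n (i + 1) k + (-(i : ℤ)) • linH n (i + 1)) (shiftF n (i + 1) k) := by
  rw [modOp, opF_eq hb α (by omega), smul_mul_assoc, Finset.sum_mul]
  simp only [Finset.smul_sum, Finset.sum_mul]
  refine Finset.sum_congr rfl fun k hk => Finset.sum_congr rfl fun σ _ => ?_
  rw [Finset.mem_Icc] at hk
  rw [weylTerm_mul_opK, linH_dot_shiftF n _ _ k (by omega) hk.1 hk.2 (by omega), qPar_pow,
    smul_smul, smul_smul, smul_smul, cartanNat, if_pos rfl]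
  congr 1
  have e : qHalf b (2 * (i : ℕ)) * qHalf b (-(-(i : ℤ) * -2)) = 1 := by
    rw [← qHalf_add, ← qHalf_zero b]; congr 1; ring
  push_cast at e ⊢
  linear_combination (sinCoef b * cexp (-(σ * (Real.pi * b * α k)))) * e

end

/-! ## Conjugation of the modified operators -/

/-- The congruences modulo `2` that an integral quadratic form has to satisfy. -/
structure IsAdapted {n : ℕ} (C : Matrix (Idx n) (Idx n) ℤ) : Prop where
  symm : C.IsSymm
  shiftF : ∀ i k, 1 ≤ k → k ≤ i → i < n →
    ∀ a, (2 : ℤ) ∣ modLinF n i k a - (C.mulVec (PosRep.shiftF n i k)) a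
  shiftE : ∀ i k, 1 ≤ i → 1 ≤ k → i + k ≤ n →
    ∀ a, (2 : ℤ) ∣ modLinE n i k a - (C.mulVec (PosRep.shiftE n i k)) a

theorem exists_two_smul {ι : Type*} {x : ι → ℤ} (h : ∀ a, (2 : ℤ) ∣ x a) :
    ∃ m : ι → ℤ, x = (2 : ℤ) • m := by
  choose m hm using h
  exact ⟨m, funext hm⟩

section
variable {n : ℕ} {b : ℝ} {C : Matrix (Idx n) (Idx n) ℤ}

/-- The sign σ is invisible modulo 2, so one congruence per term settles both of its Weyl operators.
-/
theorem IsAdapted.exists_E (hC : IsAdapted C) {i k : ℕ} (hi : 1 ≤ i) (hk : 1 ≤ k) (hik : i + k ≤ n)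
    {σ : ℤ} (hσ : σ = 1 ∨ σ = -1) : ∃ m : Idx n → ℤ,
      -σ • linE n i k + (i : ℤ) • linH n i - C.mulVec (PosRep.shiftE n i k) = (2 : ℤ) • m := by
  refine exists_two_smul fun a => ?_
  have := hC.shiftE i k hi hk hik a
  simp only [modLinE, Pi.add_apply, Pi.sub_apply, Pi.smul_apply, smul_eq_mul] at this ⊢
  generalize (i : ℤ) * linH n i a = x at this ⊢
  rcases hσ with rfl | rfl <;> omega

theorem IsAdapted.exists_F (hC : IsAdapted C) {i k : ℕ} (hk : 1 ≤ k) (hki : k ≤ i) (hi : i < n)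
    {σ : ℤ} (hσ : σ = 1 ∨ σ = -1) : ∃ m : Idx n → ℤ,
      -σ • linF n i k + (-((i : ℤ) - 1)) • linH n i - C.mulVec (PosRep.shiftF n i k) =
        (2 : ℤ) • m := by
  refine exists_two_smul fun a => ?_
  have := hC.shiftF i k hk hki hi a
  simp only [modLinF, Pi.add_apply, Pi.sub_apply, Pi.smul_apply, smul_eq_mul, neg_mul] at this ⊢
  generalize ((i : ℤ) - 1) * linH n i a = x at this ⊢
  rcases hσ with rfl | rfl <;> omega

theorem IsAdapted.conj_E (hC : IsAdapted C) (i : Fin (n - 1)) :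
    ∃ m : ℕ → ℤ → Idx n → ℤ, ∀ (b : ℝ), b ≠ 0 → ∀ α : ℕ → ℝ,
      (gaussMul (realMatrix C)).conj (modOp n b α (.E i)) =
        ∑ k ∈ Finset.Icc 1 (n - (i + 1)), ∑ σ ∈ ({1, -1} : Finset ℤ),
          ((sinCoef b * Real.exp (-(σ * (Real.pi * b * α k))) : ℝ) : ℂ) •
            weyl b ((2 : ℤ) • m k σ) (PosRep.shiftE n (i + 1) k) := by
  have h : ∀ (k : ℕ) (σ : ℤ), ∃ m : Idx n → ℤ, k ∈ Finset.Icc 1 (n - (i + 1)) →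
      σ ∈ ({1, -1} : Finset ℤ) → -σ • linE n (i + 1) k + ((i : ℤ) + 1) • linH n (i + 1) -
        C.mulVec (PosRep.shiftE n (i + 1) k) = (2 : ℤ) • m := by
    intro k σ
    by_cases hk : k ∈ Finset.Icc 1 (n - (i + 1)) ∧ σ ∈ ({1, -1} : Finset ℤ)
    · have h1 := Finset.mem_Icc.1 hk.1
      obtain ⟨m, hm⟩ := hC.exists_E (i := i + 1) (k := k) (by omega) h1.1 (by omega)
        (mem_signs.1 hk.2)
      refine ⟨m, fun _ _ => ?_⟩
      rw [← hm]
      push_cast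
      rfl
    -- Outside the range of summation the exponent is irrelevant.
    · exact ⟨0, fun h1 h2 => absurd ⟨h1, h2⟩ hk⟩
  choose m hm using h
  refine ⟨m, fun b hb α => ?_⟩
  rw [modOp_E_eq hb, map_sum]
  refine Finset.sum_congr rfl fun k hk => ?_
  rw [map_sum]
  refine Finset.sum_congr rfl fun σ hσ => ?_
  rw [map_smul, conj_weyl hC.symm, hm k σ hk hσ]

theorem IsAdapted.conj_F (hC : IsAdapted C) (i : Fin (n - 1)) :
    ∃ m : ℕ → ℤ → Idx n → ℤ, ∀ (b : ℝ), b ≠ 0 → ∀ α : ℕ → ℝ,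
      (gaussMul (realMatrix C)).conj (modOp n b α (.F i)) =
        ∑ k ∈ Finset.Icc 1 ((i : ℕ) + 1), ∑ σ ∈ ({1, -1} : Finset ℤ),
          ((sinCoef b * Real.exp (-(σ * (Real.pi * b * α k))) : ℝ) : ℂ) •
            weyl b ((2 : ℤ) • m k σ) (PosRep.shiftF n (i + 1) k) := by
  have h : ∀ (k : ℕ) (σ : ℤ), ∃ m : Idx n → ℤ, k ∈ Finset.Icc 1 ((i : ℕ) + 1) →
      σ ∈ ({1, -1} : Finset ℤ) → -σ • linF n (i + 1) k + (-(i : ℤ)) • linH n (i + 1) -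
        C.mulVec (PosRep.shiftF n (i + 1) k) = (2 : ℤ) • m := by
    intro k σ
    by_cases hk : k ∈ Finset.Icc 1 ((i : ℕ) + 1) ∧ σ ∈ ({1, -1} : Finset ℤ)
    · have h1 := Finset.mem_Icc.1 hk.1
      obtain ⟨m, hm⟩ := hC.exists_F (i := i + 1) (k := k) h1.1 h1.2 (by omega)
        (mem_signs.1 hk.2)
      refine ⟨m, fun _ _ => ?_⟩
      rw [← hm]
      push_cast
      rw [add_sub_cancel_right]
    · exact ⟨0, fun h1 h2 => absurd ⟨h1, h2⟩ hk⟩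
  choose m hm using h
  refine ⟨m, fun b hb α => ?_⟩
  rw [modOp_F_eq hb, map_sum]
  refine Finset.sum_congr rfl fun k hk => ?_
  rw [map_sum]
  refine Finset.sum_congr rfl fun σ hσ => ?_
  rw [map_smul, conj_weyl hC.symm, hm k σ hk hσ]

theorem conj_opK (hC : C.IsSymm) (i : ℕ) (m : ℤ) :
    (gaussMul (realMatrix C)).conj (opK n b i m) = weyl b (m • linH n i) 0 := by
  rw [opK_eq, conj_weyl hC, Matrix.mulVec_zero, sub_zero]

theorem pExp_zero : pExp b (0 : Idx n → ℤ) = 1 :=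
  end_ext fun g z => by simp [pExp_apply]

theorem weyl_two_smul_zero (m : Idx n → ℤ) : weyl b ((2 : ℤ) • m) 0 = uExp b m := by
  rw [weyl_two_smul, dotProduct_zero, mul_zero, neg_zero, qHalf_zero, one_smul, pExp_zero, mul_one]

theorem weyl_zero_left (s : Idx n → ℤ) : weyl b 0 s = pExp b s :=
  end_ext fun g z => by simp [pExp_apply, weyl_apply]

theorem sum_signs_weyl (r : ℤ → ℝ) (m : ℤ → Idx n → ℤ) (s : Idx n → ℤ) :
    ∑ σ ∈ ({1, -1} : Finset ℤ), (r σ : ℂ) • weyl b ((2 : ℤ) • m σ) s =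
      ((r 1 * qHalf b (-(2 * (m 1 ⬝ᵥ s)))) • uExp b (m 1) +
        (r (-1) * qHalf b (-(2 * (m (-1) ⬝ᵥ s)))) • uExp b (m (-1))) * pExp b s := by
  rw [Finset.sum_pair (by norm_num), weyl_two_smul, weyl_two_smul, smul_smul, smul_smul, add_mul,
    smul_mul_assoc, smul_mul_assoc]

end

/-! ## Ordered monomials in projectively commuting units -/

section Abstract

variable {A : Type*} [Ring A] [Algebra ℂ A]

/-- Two units which commute up to a nonzero scalar. -/
def ProjComm (x y : Aˣ) : Prop := ∃ c : ℂ, c ≠ 0 ∧ (x * y : A) = c • (y * x : A)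

theorem ProjComm.symm {x y : Aˣ} (h : ProjComm x y) : ProjComm y x := by
  obtain ⟨c, hc, h⟩ := h
  exact ⟨c⁻¹, inv_ne_zero hc, by rw [h, smul_smul, inv_mul_cancel₀ hc, one_smul]⟩

theorem ProjComm.mul_right {x y z : Aˣ} (h : ProjComm x y) (h' : ProjComm x z) :
    ProjComm x (y * z) := by
  obtain ⟨c, hc, h⟩ := h
  obtain ⟨d, hd, h'⟩ := h'
  refine ⟨c * d, mul_ne_zero hc hd, ?_⟩
  rw [Units.val_mul, ← mul_assoc, h, smul_mul_assoc, mul_assoc, h', mul_smul_comm, smul_smul,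
    mul_assoc]

theorem ProjComm.inv_right {x y : Aˣ} (h : ProjComm x y) : ProjComm x y⁻¹ := by
  obtain ⟨c, hc, h⟩ := h.symm
  refine ⟨c, hc, ?_⟩
  have : (x * ↑y⁻¹ : A) = ↑y⁻¹ * (y * x) * ↑y⁻¹ := by
    rw [← mul_assoc, Units.inv_mul, one_mul]
  rw [this, h, mul_smul_comm, smul_mul_assoc, mul_assoc, mul_assoc, Units.mul_inv, mul_one]

theorem ProjComm.one_right (x : Aˣ) : ProjComm x 1 := ⟨1, one_ne_zero, by simp⟩

theorem ProjComm.zpow_right {x y : Aˣ} (h : ProjComm x y) (k : ℤ) : ProjComm x (y ^ k) := by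
  induction k using Int.induction_on with
  | zero => rw [zpow_zero]; exact ProjComm.one_right x
  | succ k ih => rw [zpow_add_one]; exact ih.mul_right h
  | pred k ih => rw [zpow_sub_one]; exact ih.mul_right h.inv_right

variable {ι : Type*} [DecidableEq ι]

/-- The product of the powers `U i ^ v i` in the order of a list. -/
def listMonomial (U : ι → Aˣ) (l : List ι) (v : ι → ℤ) : A := (l.map fun i => ((U i ^ v i : Aˣ) : A)).prod

/-- The new power moves to the right, collecting scalars, until it meets the power of the same unit;
without repetitions in the list this slot is unique. -/
theorem zpow_mul_listMonomial {U : ι → Aˣ} (hU : ∀ i j, ProjComm (U i) (U j)) (h : ι) (e : ℤ)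
    (v : ι → ℤ) : ∀ l : List ι, l.Nodup → h ∈ l →
      ∃ d : ℂ, ((U h ^ e : Aˣ) : A) * listMonomial U l v =
        d • listMonomial U l (v + Pi.single h e)
  | [], _, hl => absurd hl (by simp)
  | i :: t, hnd, hl => by
    rw [List.nodup_cons] at hnd
    by_cases hi : h = i
    · subst hi
      refine ⟨1, ?_⟩
      have ht : listMonomial U t (v + Pi.single h e) = listMonomial U t v := by
        unfold listMonomial
        congr 1
        refine List.map_congr_left fun j hj => ?_
        have : j ≠ h := fun hjh => hnd.1 (hjh ▸ hj)
        simp [this]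
      have e1 : ∀ w, listMonomial U (h :: t) w = ((U h ^ w h : Aˣ) : A) * listMonomial U t w :=
        fun w => rfl
      rw [one_smul, e1, e1, ht, ← mul_assoc, ← Units.val_mul, ← zpow_add]
      simp [add_comm]
    · have hmem : h ∈ t := (List.mem_cons.1 hl).resolve_left hi
      obtain ⟨d, hd⟩ := zpow_mul_listMonomial hU h e v t hnd.2 hmem
      obtain ⟨c, -, hc⟩ := ((((hU h i).zpow_right (v i)).symm).zpow_right e).symm
      refine ⟨c * d, ?_⟩
      have e1 : ∀ w, listMonomial U (i :: t) w = ((U i ^ w i : Aˣ) : A) * listMonomial U t w :=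
        fun w => rfl
      rw [e1, e1, ← mul_assoc, hc, smul_mul_assoc, mul_assoc, hd, mul_smul_comm, smul_smul]
      simp [Ne.symm hi]

/-- The span contains 1 and is stable under left multiplication by the generators, hence is
everything. -/
theorem span_listMonomial {U : ι → Aˣ} (hU : ∀ i j, ProjComm (U i) (U j)) {l : List ι}
    (hl : l.Nodup) (hmem : ∀ i, i ∈ l)
    (hgen : Algebra.adjoin ℂ {x : A | ∃ i, x = U i ∨ x = ((U i)⁻¹ : Aˣ)} = ⊤) :
    Submodule.span ℂ (Set.range (listMonomial U l)) = ⊤ := by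
  have key : ∀ (h : ι) (e : ℤ), ∀ y ∈ Submodule.span ℂ (Set.range (listMonomial U l)),
      ((U h ^ e : Aˣ) : A) * y ∈ Submodule.span ℂ (Set.range (listMonomial U l)) := by
    intro h e y hy
    induction hy using Submodule.span_induction with
    | mem y hy =>
      obtain ⟨v, rfl⟩ := hy
      obtain ⟨d, hd⟩ := zpow_mul_listMonomial hU h e v l hl (hmem h)
      rw [hd]
      exact Submodule.smul_mem _ _ (Submodule.subset_span ⟨_, rfl⟩)
    | zero => rw [mul_zero]; exact Submodule.zero_mem _
    | add x y _ _ hx hy => rw [mul_add]; exact Submodule.add_mem _ hx hy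
    | smul c x _ hx => rw [mul_smul_comm]; exact Submodule.smul_mem _ _ hx
  have main : ∀ x ∈ Algebra.adjoin ℂ {x : A | ∃ i, x = U i ∨ x = ((U i)⁻¹ : Aˣ)},
      ∀ y ∈ Submodule.span ℂ (Set.range (listMonomial U l)),
        x * y ∈ Submodule.span ℂ (Set.range (listMonomial U l)) := by
    intro x hx
    induction hx using Algebra.adjoin_induction with
    | mem x hx =>
      obtain ⟨i, rfl | rfl⟩ := hx
      · intro y hy
        simpa using key i 1 y hy
      · intro y hy
        simpa using key i (-1) y hy
    | algebraMap c =>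
      intro y hy
      rw [← Algebra.smul_def]
      exact Submodule.smul_mem _ _ hy
    | add x x' _ _ hx hx' =>
      intro y hy
      rw [add_mul]
      exact Submodule.add_mem _ (hx y hy) (hx' y hy)
    | mul x x' _ _ hx hx' =>
      intro y hy
      rw [mul_assoc]
      exact hx _ (hx' y hy)
  have hone : (1 : A) ∈ Submodule.span ℂ (Set.range (listMonomial U l)) :=
    Submodule.subset_span ⟨0, by simp [listMonomial]⟩
  rw [eq_top_iff]
  intro x _
  simpa using main x (hgen ▸ Algebra.mem_top) 1 hone

end Abstract

/-! ## The quantum torus and its representation -/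

theorem par_ne_zero {b : ℝ} (hb : b ≠ 0) (s : Bool) : par b s ≠ 0 := by
  cases s <;> simp [par, hb]

theorem weyl_comm_par {n : ℕ} {b : ℝ} (hb : b ≠ 0) {s t : Bool} (hst : s ≠ t)
    (m v m' v' : Idx n → ℤ) :
    weyl (par b s) ((2 : ℤ) • m) v * weyl (par b t) ((2 : ℤ) • m') v' =
      weyl (par b t) ((2 : ℤ) • m') v' * weyl (par b s) ((2 : ℤ) • m) v := by
  cases s <;> cases t <;> simp only [par] at *
  · exact absurd rfl hst
  · exact weyl_comm_inv hb m v m' v'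
  · exact (weyl_comm_inv hb m' v' m v).symm
  · exact absurd rfl hst

/-- The exponents of `𝐮` and `𝐯` in a generator of the torus, and the copy it belongs to. -/
def TGen.exps {n : ℕ} : TGen n → Bool × (Idx n → ℤ) × (Idx n → ℤ)
  | .u s a => (s, Pi.single a 1, 0)
  | .uInv s a => (s, Pi.single a (-1), 0)
  | .v s a => (s, 0, Pi.single a 1)
  | .vInv s a => (s, 0, Pi.single a (-1))

theorem torusOp_eq {n : ℕ} (b : ℝ) (g : TGen n) : torusOp n b g =
    weyl (par b g.exps.1) ((2 : ℤ) • g.exps.2.1) g.exps.2.2 := by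
  cases g <;> simp only [torusOp, TGen.exps, weyl_two_smul_zero, smul_zero, weyl_zero_left]

theorem torusOp_rel {n : ℕ} {b : ℝ} (hb : b ≠ 0) {x y : FreeAlgebra ℂ (TGen n)}
    (h : TRel n b x y) :
    FreeAlgebra.lift ℂ (torusOp n b) x = FreeAlgebra.lift ℂ (torusOp n b) y := by
  classical
  have hneg : ∀ a : Idx n, (Pi.single a (-1) : Idx n → ℤ) = -Pi.single a 1 :=
    fun a => by rw [Pi.single_neg]
  induction h with
  | u_uInv s a | uInv_u s a | v_vInv s a | vInv_v s a =>
    simp only [map_mul, map_one, FreeAlgebra.lift_ι_apply, torusOp_eq, TGen.exps, weyl_mul, hneg]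
    simp [qHalf_zero, weyl_zero]
  | u_u s t a c =>
    simp only [map_mul, FreeAlgebra.lift_ι_apply, torusOp_eq, TGen.exps]
    by_cases hst : s = t
    · subst hst
      rw [weyl_comm]
      simp [qHalf_zero]
    · exact weyl_comm_par hb hst _ _ _ _
  | v_v s t a c =>
    simp only [map_mul, FreeAlgebra.lift_ι_apply, torusOp_eq, TGen.exps]
    by_cases hst : s = t
    · subst hst
      rw [weyl_comm]
      simp [qHalf_zero]
    · exact weyl_comm_par hb hst _ _ _ _
  | u_v s t a c hne =>
    simp only [map_mul, FreeAlgebra.lift_ι_apply, torusOp_eq, TGen.exps]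
    by_cases hst : s = t
    · subst hst
      have hac : a ≠ c := fun h => hne ⟨rfl, h⟩
      rw [weyl_comm]
      simp [qHalf_zero, hac]
    · exact weyl_comm_par hb hst _ _ _ _
  | u_v_same s a =>
    simp only [map_mul, map_smul, FreeAlgebra.lift_ι_apply, torusOp_eq, TGen.exps]
    rw [weyl_comm, qPar_pow]
    simp

/-- The representation of the quantum torus by multiplications and shifts. -/
noncomputable def torusRep (n : ℕ) {b : ℝ} (hb : b ≠ 0) : Torus n b →ₐ[ℂ] Module.End ℂ (Dom n) :=
  RingQuot.liftAlgHom ℂ ⟨FreeAlgebra.lift ℂ (torusOp n b), fun _ _ h => torusOp_rel hb h⟩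

theorem torusRep_gen {n : ℕ} {b : ℝ} (hb : b ≠ 0) (g : TGen n) :
    torusRep n hb (Torus.gen b g) = torusOp n b g := by
  rw [torusRep, Torus.gen, RingQuot.liftAlgHom_mkAlgHom_apply, FreeAlgebra.lift_ι_apply]

theorem Torus.adjoin_gen (n : ℕ) (b : ℝ) :
    Algebra.adjoin ℂ (Set.range (Torus.gen (n := n) b)) = ⊤ := by
  have h : Set.range (Torus.gen (n := n) b) =
      RingQuot.mkAlgHom ℂ (TRel n b) '' Set.range (FreeAlgebra.ι ℂ) := by
    rw [← Set.range_comp]; rfl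
  rw [h, ← AlgHom.map_adjoin, FreeAlgebra.adjoin_range_ι, Algebra.map_top,
    AlgHom.range_eq_top]
  exact RingQuot.mkAlgHom_surjective ℂ _

theorem Torus.mul_eq_of_rel {n : ℕ} {b : ℝ} {x y : FreeAlgebra ℂ (TGen n)} (h : TRel n b x y) :
    RingQuot.mkAlgHom ℂ (TRel n b) x = RingQuot.mkAlgHom ℂ (TRel n b) y :=
  RingQuot.mkAlgHom_rel ℂ h

/-- The generators `𝐮_a` (`false`) and `𝐯_a` (`true`) in both copies, as units of the torus. -/
def Torus.unit {n : ℕ} (b : ℝ) : Bool × Bool × Idx n → (Torus n b)ˣ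
  | (false, s, a) => ⟨gen b (.u s a), gen b (.uInv s a),
      by simpa [gen] using mul_eq_of_rel (TRel.u_uInv (b := b) s a),
      by simpa [gen] using mul_eq_of_rel (TRel.uInv_u (b := b) s a)⟩
  | (true, s, a) => ⟨gen b (.v s a), gen b (.vInv s a),
      by simpa [gen] using mul_eq_of_rel (TRel.v_vInv (b := b) s a),
      by simpa [gen] using mul_eq_of_rel (TRel.vInv_v (b := b) s a)⟩

theorem Torus.projComm {n : ℕ} (b : ℝ) : ∀ i j : Bool × Bool × Idx n,
    ProjComm (unit b i) (unit b j) := by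
  have huv : ∀ s t (a c : Idx n), ProjComm (unit b (false, s, a)) (unit b (true, t, c)) := by
    intro s t a c
    by_cases h : s = t ∧ a = c
    · obtain ⟨rfl, rfl⟩ := h
      exact ⟨qPar (par b s) ^ 2, pow_ne_zero 2 (qPar_ne_zero _),
        by simpa [gen, unit] using mul_eq_of_rel (TRel.u_v_same (b := b) s a)⟩
    · exact ⟨1, one_ne_zero, by simpa [gen, unit] using mul_eq_of_rel (TRel.u_v (b := b) s t a c h)⟩
  rintro ⟨i, s, a⟩ ⟨j, t, c⟩
  cases i <;> cases j
  · exact ⟨1, one_ne_zero, by simpa [gen, unit] using mul_eq_of_rel (TRel.u_u (b := b) s t a c)⟩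
  · exact huv s t a c
  · exact (huv t s c a).symm
  · exact ⟨1, one_ne_zero, by simpa [gen, unit] using mul_eq_of_rel (TRel.v_v (b := b) s t a c)⟩

/-- The ordered monomials of the quantum torus. -/
noncomputable def Torus.monomial {n : ℕ} (b : ℝ) (v : Bool × Bool × Idx n → ℤ) : Torus n b :=
  listMonomial (unit b) Finset.univ.toList v

open Classical in
theorem Torus.span_monomial (n : ℕ) (b : ℝ) :
    Submodule.span ℂ (Set.range (Torus.monomial (n := n) b)) = ⊤ := by
  refine span_listMonomial (projComm b) (Finset.nodup_toList _) (by simp) ?_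
  rw [eq_top_iff, ← adjoin_gen]
  refine Algebra.adjoin_mono ?_
  rintro _ ⟨g, rfl⟩
  cases g with
  | u s a => exact ⟨(false, s, a), Or.inl rfl⟩
  | uInv s a => exact ⟨(false, s, a), Or.inr rfl⟩
  | v s a => exact ⟨(true, s, a), Or.inl rfl⟩
  | vInv s a => exact ⟨(true, s, a), Or.inr rfl⟩

/-! ## Faithfulness -/

/-- `X` is a nonzero multiple of the multiplication by `exp (2π ∑ l_a z_a)` composed with the shift
by `i m`. -/
def IsMono {n : ℕ} (X : Module.End ℂ (Dom n)) (l m : Idx n → ℝ) : Prop :=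
  ∃ c : ℂ, c ≠ 0 ∧ ∀ (g : Dom n) (z : Idx n → ℂ), (X g : (Idx n → ℂ) → ℂ) z =
    c * cexp (2 * Real.pi * ∑ a, (l a : ℂ) * z a) * (g : (Idx n → ℂ) → ℂ) fun a => z a - I * m a

theorem IsMono.one {n : ℕ} : IsMono (1 : Module.End ℂ (Dom n)) 0 0 :=
  ⟨1, one_ne_zero, fun g z => by simp⟩

theorem IsMono.mul {n : ℕ} {X Y : Module.End ℂ (Dom n)} {l m l' m' : Idx n → ℝ}
    (hX : IsMono X l m) (hY : IsMono Y l' m') : IsMono (X * Y) (l + l') (m + m') := by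
  obtain ⟨c, hc, hX⟩ := hX
  obtain ⟨d, hd, hY⟩ := hY
  refine ⟨c * d * cexp (2 * Real.pi * ∑ a, (l' a : ℂ) * (-(I * m a))),
    mul_ne_zero (mul_ne_zero hc hd) (Complex.exp_ne_zero _), fun g z => ?_⟩
  rw [Module.End.mul_apply, hX, hY]
  have h1 : (fun a => z a - I * m a - I * m' a) = fun a => z a - I * ((m + m') a : ℝ) := by
    funext a
    simp only [Pi.add_apply]
    push_cast
    ring
  have h2 : ∑ a, (l' a : ℂ) * (z a - I * m a) =
      (∑ a, (l' a : ℂ) * z a) + ∑ a, (l' a : ℂ) * (-(I * m a)) := by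
    rw [← Finset.sum_add_distrib]
    exact Finset.sum_congr rfl fun a _ => by ring
  have h3 : ∑ a, ((l + l') a : ℝ) * z a = (∑ a, (l a : ℂ) * z a) + ∑ a, (l' a : ℂ) * z a := by
    rw [← Finset.sum_add_distrib]
    refine Finset.sum_congr rfl fun a _ => ?_
    simp only [Pi.add_apply]
    push_cast
    ring
  rw [h1, h2, h3, mul_add, mul_add, Complex.exp_add, Complex.exp_add]
  ring

theorem IsMono.weyl {n : ℕ} (b : ℝ) (m v : Idx n → ℤ) :
    IsMono (weyl b ((2 : ℤ) • m) v) (fun a => b * m a) (fun a => b * v a) := by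
  refine ⟨cexp (-(Real.pi * I * b ^ 2 * ((2 : ℤ) • m ⬝ᵥ v : ℤ) / 2)), Complex.exp_ne_zero _,
    fun g z => ?_⟩
  rw [weyl_apply, ← Complex.exp_add, neg_add_eq_sub]
  congr 1
  · congr 2
    rw [Finset.mul_sum, Finset.mul_sum]
    refine Finset.sum_congr rfl fun a _ => ?_
    simp only [Pi.smul_apply, smul_eq_mul]
    push_cast
    ring
  · refine congrArg (g : (Idx n → ℂ) → ℂ) (funext fun a => ?_)
    push_cast
    ring

/-- The exponents of `e^{2πu}` in the image of a monomial of the torus. -/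
noncomputable def realExp {n : ℕ} (b : ℝ) (k : Bool) (v : Bool × Bool × Idx n → ℤ) : Idx n → ℝ :=
  fun a => b * v (k, false, a) + b⁻¹ * v (k, true, a)

theorem realExp_add {n : ℕ} (b : ℝ) (k : Bool) (v w : Bool × Bool × Idx n → ℤ) :
    realExp b k (v + w) = realExp b k v + realExp b k w := by
  funext a
  simp only [realExp, Pi.add_apply]
  push_cast
  ring

theorem realExp_zero {n : ℕ} (b : ℝ) (k : Bool) :
    realExp b k (0 : Bool × Bool × Idx n → ℤ) = 0 := by
  funext a
  simp [realExp]

/-- Irrationality of b² makes b and b⁻¹ linearly independent over ℚ, so the two copies of the torus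
do not mix. -/
theorem realExp_injective {n : ℕ} {b : ℝ} (hb : 0 < b) (hb2 : Irrational (b ^ 2))
    {v w : Bool × Bool × Idx n → ℤ} (h : ∀ k, realExp b k v = realExp b k w) : v = w := by
  have key : ∀ x y x' y' : ℤ, b * x + b⁻¹ * y = b * x' + b⁻¹ * y' → x = x' ∧ y = y' := by
    intro x y x' y' h
    have h1 : b ^ 2 * ((x - x' : ℤ) : ℝ) = ((y' - y : ℤ) : ℝ) := by
      have : b * (b * x + b⁻¹ * y) = b * (b * x' + b⁻¹ * y') := by rw [h]
      rw [mul_add, mul_add, mul_inv_cancel_left₀ hb.ne', mul_inv_cancel_left₀ hb.ne'] at this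
      push_cast
      linarith
    have hx : x - x' = 0 := by
      by_contra hne
      exact (hb2.mul_intCast hne).ne_int _ h1
    rw [hx, Int.cast_zero, mul_zero] at h1
    have hy : y' - y = 0 := by exact_mod_cast h1.symm
    omega
  funext ⟨k, s, a⟩
  have := key _ _ _ _ (congrFun (h k) a)
  cases s
  · exact this.1
  · exact this.2

open Classical in
theorem isMono_unit {n : ℕ} {b : ℝ} (hb : b ≠ 0) (i : Bool × Bool × Idx n) (e : ℤ)
    (he : e = 1 ∨ e = -1) : IsMono (torusRep n hb ((Torus.unit b i ^ e : (Torus n b)ˣ) : Torus n b))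
      (realExp b false (Pi.single i e)) (realExp b true (Pi.single i e)) := by
  have h : ∃ g : TGen n, ((Torus.unit b i ^ e : (Torus n b)ˣ) : Torus n b) = Torus.gen b g ∧
      realExp b false (Pi.single i e) = (fun a => par b g.exps.1 * g.exps.2.1 a) ∧
      realExp b true (Pi.single i e) = (fun a => par b g.exps.1 * g.exps.2.2 a) := by
    obtain ⟨k, s, a⟩ := i
    cases k <;> rcases he with rfl | rfl
    · refine ⟨.u s a, by rw [zpow_one]; rfl, ?_, ?_⟩ <;> funext c <;> cases s <;>
        simp [realExp, TGen.exps, Pi.single_apply, par]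
    · refine ⟨.uInv s a, by rw [zpow_neg_one]; rfl, ?_, ?_⟩ <;> funext c <;> cases s <;>
        simp [realExp, TGen.exps, Pi.single_apply, par]
    · refine ⟨.v s a, by rw [zpow_one]; rfl, ?_, ?_⟩ <;> funext c <;> cases s <;>
        simp [realExp, TGen.exps, Pi.single_apply, par]
    · refine ⟨.vInv s a, by rw [zpow_neg_one]; rfl, ?_, ?_⟩ <;> funext c <;> cases s <;>
        simp [realExp, TGen.exps, Pi.single_apply, par]
  obtain ⟨g, h1, h2, h3⟩ := h
  rw [h1, torusRep_gen, torusOp_eq, h2, h3]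
  exact IsMono.weyl _ _ _

open Classical in
theorem isMono_unit_zpow {n : ℕ} {b : ℝ} (hb : b ≠ 0) (i : Bool × Bool × Idx n) (e : ℤ) :
    IsMono (torusRep n hb ((Torus.unit b i ^ e : (Torus n b)ˣ) : Torus n b))
      (realExp b false (Pi.single i e)) (realExp b true (Pi.single i e)) := by
  induction e using Int.induction_on with
  | zero =>
    simp only [zpow_zero, Units.val_one, map_one, Pi.single_zero, realExp_zero]
    exact IsMono.one
  | succ k ih =>
    rw [zpow_add, Units.val_mul, map_mul, Pi.single_add, realExp_add, realExp_add]
    exact ih.mul (isMono_unit hb i 1 (Or.inl rfl))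
  | pred k ih =>
    rw [sub_eq_add_neg, zpow_add, Units.val_mul, map_mul, Pi.single_add, realExp_add, realExp_add]
    exact ih.mul (isMono_unit hb i (-1) (Or.inr rfl))

open Classical in
theorem isMono_monomial {n : ℕ} {b : ℝ} (hb : b ≠ 0) (v : Bool × Bool × Idx n → ℤ) :
    IsMono (torusRep n hb (Torus.monomial b v)) (realExp b false v) (realExp b true v) := by
  have key : ∀ l : List (Bool × Bool × Idx n), l.Nodup →
      IsMono (torusRep n hb (listMonomial (Torus.unit b) l v))
        (realExp b false (∑ i ∈ l.toFinset, Pi.single i (v i)))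
        (realExp b true (∑ i ∈ l.toFinset, Pi.single i (v i))) := by
    intro l
    induction l with
    | nil =>
      intro _
      simpa [listMonomial, realExp_zero] using IsMono.one
    | cons i t ih =>
      intro hnd
      rw [List.nodup_cons] at hnd
      have e1 : listMonomial (Torus.unit b) (i :: t) v =
        ((Torus.unit b i ^ v i : (Torus n b)ˣ) : Torus n b) * listMonomial (Torus.unit b) t v := rfl
      rw [e1, map_mul, List.toFinset_cons, Finset.sum_insert (by simpa using hnd.1), realExp_add,
        realExp_add]
      exact (isMono_unit_zpow hb i (v i)).mul (ih hnd.2)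
  have h := key _ (Finset.nodup_toList Finset.univ)
  rwa [Finset.toList_toFinset, Finset.univ_sum_single] at h

/-- The Gaussian `exp (- ∑ z_a ^ 2)`. -/
noncomputable def gaussian (n : ℕ) : Dom n := ⟨fun z => cexp (-∑ a, z a ^ 2), by
  refine ⟨by fun_prop, fun r => ?_⟩
  -- For each coordinate z = x + iy one has y² ≤ r², and r|x| - x² ≤ r²/4 by completing the square.
  refine ⟨Real.exp (∑ _a : Idx n, (r ^ 2 + r ^ 2 / 4)), fun z hz => ?_⟩
  rw [Complex.norm_exp, ← Real.exp_add, Real.exp_le_exp, reNorm, Finset.mul_sum,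
    ← Finset.sum_add_distrib, Complex.neg_re, Complex.re_sum, ← Finset.sum_neg_distrib]
  refine Finset.sum_le_sum fun a _ => ?_
  have h1 : ((z a) ^ 2).re = (z a).re ^ 2 - (z a).im ^ 2 := by
    rw [sq, Complex.mul_re]; ring
  have h2 : (z a).im ^ 2 ≤ r ^ 2 := sq_le_sq' (by linarith [neg_abs_le (z a).im, hz a])
    ((le_abs_self _).trans (hz a))
  rw [h1]
  nlinarith [sq_nonneg (|(z a).re| - r / 2), sq_abs (z a).re]⟩

theorem gaussian_shift {n : ℕ} (m : Idx n → ℝ) (z : Idx n → ℂ) :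
    (gaussian n : (Idx n → ℂ) → ℂ) (fun a => z a - I * m a) =
      cexp (∑ a, (m a : ℂ) ^ 2) * cexp (∑ a, 2 * I * m a * z a) *
        (gaussian n : (Idx n → ℂ) → ℂ) z := by
  simp only [gaussian, ← Complex.exp_add, ← Finset.sum_neg_distrib, ← Finset.sum_add_distrib]
  congr 1
  refine Finset.sum_congr rfl fun a _ => ?_
  linear_combination (-(m a : ℂ) ^ 2) * I_sq

/-- The character `z ↦ exp (∑ w_a z_a)`. -/
noncomputable def expChar {n : ℕ} (w : Idx n → ℂ) : Multiplicative (Idx n → ℂ) →* ℂ where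
  toFun z := cexp (∑ a, w a * Multiplicative.toAdd z a)
  map_one' := by simp
  map_mul' z z' := by
    simp only [toAdd_mul, Pi.add_apply, mul_add, Finset.sum_add_distrib, Complex.exp_add]

theorem expChar_injective {n : ℕ} : Function.Injective (expChar (n := n)) := by
  classical
  intro w w' h
  funext a
  by_contra hne
  -- At this point the quotient of the two characters would be e, not 1.
  have h1 := DFunLike.congr_fun h (Multiplicative.ofAdd (Pi.single a (w a - w' a)⁻¹))
  simp only [expChar, MonoidHom.coe_mk, OneHom.coe_mk, toAdd_ofAdd, Pi.single_apply, mul_ite,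
    mul_zero, Finset.sum_ite_eq', Finset.mem_univ, if_true] at h1
  have h2 : cexp (w a * (w a - w' a)⁻¹ - w' a * (w a - w' a)⁻¹) = 1 := by
    rw [Complex.exp_sub, h1, div_self (Complex.exp_ne_zero _)]
  rw [← sub_mul, mul_inv_cancel₀ (sub_ne_zero.2 hne)] at h2
  have h3 : Real.exp 1 = 1 := Complex.ofReal_injective (by simpa using h2)
  linarith [Real.add_one_le_exp (1 : ℝ)]

/-- A monomial turns the Gaussian into a nonzero multiple of an exponential character times the same
Gaussian. Different monomials give different characters, so linear independence of characters kills
all coefficients. -/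
theorem torusRep_injective (n : ℕ) {b : ℝ} (hb : 0 < b) (hb2 : Irrational (b ^ 2)) :
    Function.Injective (torusRep n hb.ne') := by
  rw [injective_iff_map_eq_zero]
  intro x hx
  have hmem : x ∈ Submodule.span ℂ (Set.range (Torus.monomial (n := n) b)) := by
    rw [Torus.span_monomial]; trivial
  rw [Finsupp.mem_span_range_iff_exists_finsupp] at hmem
  obtain ⟨a, rfl⟩ := hmem
  choose c hc hmono using fun v => isMono_monomial (n := n) hb.ne' v
  -- The real part comes from the multiplication operator, the imaginary part from shifting the
  -- Gaussian; hence w recovers both exponents.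
  let w : (Bool × Bool × Idx n → ℤ) → Idx n → ℂ := fun v j =>
    2 * Real.pi * realExp b false v j + 2 * I * realExp b true v j
  have hw : Function.Injective w := by
    intro v v' h
    refine realExp_injective hb hb2 fun k => funext fun j => ?_
    have hj := congrFun h j
    have hre := congrArg Complex.re hj
    have him := congrArg Complex.im hj
    simp [w] at hre him
    cases k
    · simpa [Real.pi_ne_zero] using hre
    · simpa using him
  have hli : LinearIndependent ℂ fun v => (expChar (w v) : Multiplicative (Idx n → ℂ) → ℂ) :=
    (linearIndependent_monoidHom (Multiplicative (Idx n → ℂ)) ℂ).comp (fun v => expChar (w v))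
      (expChar_injective.comp hw)
  have hsum : ∑ v ∈ a.support, (a v * c v * cexp (∑ j, (realExp b true v j : ℂ) ^ 2)) •
      (expChar (w v) : Multiplicative (Idx n → ℂ) → ℂ) = 0 := by
    funext z
    have h1 : ((torusRep n hb.ne' (a.sum fun v t => t • Torus.monomial b v)) (gaussian n) :
        (Idx n → ℂ) → ℂ) (Multiplicative.toAdd z) = 0 := by
      rw [hx]; rfl
    rw [Finsupp.sum, map_sum, LinearMap.sum_apply, Submodule.coe_sum, Finset.sum_apply] at h1
    have h2 : ∀ v, ((torusRep n hb.ne' (a v • Torus.monomial b v)) (gaussian n) :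
        (Idx n → ℂ) → ℂ) (Multiplicative.toAdd z) =
        a v * c v * cexp (∑ j, (realExp b true v j : ℂ) ^ 2) * expChar (w v) z *
          (gaussian n : (Idx n → ℂ) → ℂ) (Multiplicative.toAdd z) := by
      intro v
      have h3 : expChar (w v) z = cexp (2 * Real.pi * ∑ j, (realExp b false v j : ℂ) *
          Multiplicative.toAdd z j) *
            cexp (∑ j, 2 * I * realExp b true v j * Multiplicative.toAdd z j) := by
        rw [← Complex.exp_add, Finset.mul_sum, ← Finset.sum_add_distrib]
        simp only [expChar, MonoidHom.coe_mk, OneHom.coe_mk, w]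
        congr 1
        exact Finset.sum_congr rfl fun j _ => by ring
      rw [map_smul, smul_dom_apply, hmono, gaussian_shift, h3]
      ring
    simp only [h2, ← Finset.sum_mul] at h1
    have h4 := (mul_eq_zero.1 h1).resolve_right (Complex.exp_ne_zero _)
    simpa [Finset.sum_apply] using h4
  have hzero := linearIndependent_iff'.1 hli a.support _ hsum
  refine Finset.sum_eq_zero fun v hv => ?_
  have h5 := hzero v hv
  have h6 : a v = 0 := by
    rcases mul_eq_zero.1 h5 with h | h
    · exact (mul_eq_zero.1 h).resolve_right (hc v)
    · exact absurd h (Complex.exp_ne_zero _)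
  simp [h6]

/-! ## The star structure -/

/-- The opposite algebra with complex conjugate scalar multiplication. -/
def ConjOp (A : Type*) : Type _ := Aᵐᵒᵖ

instance {A : Type*} [Ring A] : Ring (ConjOp A) := inferInstanceAs (Ring Aᵐᵒᵖ)

instance {A : Type*} [Ring A] [Algebra ℂ A] : Algebra ℂ (ConjOp A) :=
  RingHom.toAlgebra' ((algebraMap ℂ Aᵐᵒᵖ).comp (starRingEnd ℂ) : ℂ →+* Aᵐᵒᵖ)
    fun c x => Algebra.commutes (A := Aᵐᵒᵖ) ((starRingEnd ℂ) c) x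

/-- The canonical map to the conjugate opposite algebra. -/
def ConjOp.op {A : Type*} (x : A) : ConjOp A := MulOpposite.op x

/-- The canonical map from the conjugate opposite algebra. -/
def ConjOp.unop {A : Type*} (x : ConjOp A) : A := MulOpposite.unop x

theorem ConjOp.op_injective {A : Type*} : Function.Injective (ConjOp.op (A := A)) :=
  MulOpposite.op_injective

section
variable {A : Type*} [Ring A]

theorem ConjOp.op_mul_op (x y : A) : ConjOp.op x * ConjOp.op y = ConjOp.op (y * x) := rfl

theorem ConjOp.op_one : ConjOp.op (1 : A) = 1 := rfl

variable [Algebra ℂ A]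

theorem ConjOp.smul_op (c : ℂ) (x : A) : c • ConjOp.op x = ConjOp.op ((starRingEnd ℂ) c • x) := by
  rw [Algebra.smul_def, Algebra.smul_def]
  change ConjOp.op (algebraMap ℂ A ((starRingEnd ℂ) c)) * ConjOp.op x = _
  rw [ConjOp.op_mul_op, Algebra.commutes]

end

theorem conj_qPar (b : ℝ) : (starRingEnd ℂ) (qPar b) = (qPar b)⁻¹ := by
  rw [qPar_eq, conj_qHalf, qHalf_neg]

/-- A star that fixes the generators is an algebra homomorphism to the conjugate opposite algebra,
so only the relations need checking. Reversing a product and conjugating the unimodular q invert the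
commutation phase twice. -/
theorem conjOp_rel {n : ℕ} {b : ℝ} {x y : FreeAlgebra ℂ (TGen n)} (h : TRel n b x y) :
    FreeAlgebra.lift ℂ (fun g => ConjOp.op (Torus.gen b g)) x =
      FreeAlgebra.lift ℂ (fun g => ConjOp.op (Torus.gen b g)) y := by
  induction h with
  | u_uInv s a =>
    simp only [map_mul, map_one, FreeAlgebra.lift_ι_apply, ConjOp.op_mul_op, ← ConjOp.op_one]
    exact congrArg _ (by simpa [Torus.gen] using Torus.mul_eq_of_rel (TRel.uInv_u (b := b) s a))
  | uInv_u s a =>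
    simp only [map_mul, map_one, FreeAlgebra.lift_ι_apply, ConjOp.op_mul_op, ← ConjOp.op_one]
    exact congrArg _ (by simpa [Torus.gen] using Torus.mul_eq_of_rel (TRel.u_uInv (b := b) s a))
  | v_vInv s a =>
    simp only [map_mul, map_one, FreeAlgebra.lift_ι_apply, ConjOp.op_mul_op, ← ConjOp.op_one]
    exact congrArg _ (by simpa [Torus.gen] using Torus.mul_eq_of_rel (TRel.vInv_v (b := b) s a))
  | vInv_v s a =>
    simp only [map_mul, map_one, FreeAlgebra.lift_ι_apply, ConjOp.op_mul_op, ← ConjOp.op_one]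
    exact congrArg _ (by simpa [Torus.gen] using Torus.mul_eq_of_rel (TRel.v_vInv (b := b) s a))
  | u_u s t a c =>
    simp only [map_mul, FreeAlgebra.lift_ι_apply, ConjOp.op_mul_op]
    exact congrArg _ (by simpa [Torus.gen] using Torus.mul_eq_of_rel (TRel.u_u (b := b) t s c a))
  | v_v s t a c =>
    simp only [map_mul, FreeAlgebra.lift_ι_apply, ConjOp.op_mul_op]
    exact congrArg _ (by simpa [Torus.gen] using Torus.mul_eq_of_rel (TRel.v_v (b := b) t s c a))
  | u_v s t a c h =>
    simp only [map_mul, FreeAlgebra.lift_ι_apply, ConjOp.op_mul_op]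
    exact congrArg _
      (by simpa [Torus.gen] using (Torus.mul_eq_of_rel (TRel.u_v (b := b) s t a c h)).symm)
  | u_v_same s a =>
    simp only [map_mul, map_smul, FreeAlgebra.lift_ι_apply, ConjOp.op_mul_op, ConjOp.smul_op,
      map_pow, conj_qPar]
    refine congrArg _ ?_
    have h : Torus.gen b (.u s a) * Torus.gen b (.v s a) =
        qPar (par b s) ^ 2 • (Torus.gen b (.v s a) * Torus.gen b (.u s a)) := by
      simpa [Torus.gen] using Torus.mul_eq_of_rel (TRel.u_v_same (b := b) s a)
    rw [h, smul_smul, ← mul_pow, inv_mul_cancel₀ (qPar_ne_zero _), one_pow, one_smul]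

/-- The star structure as a homomorphism to the conjugate opposite algebra. -/
noncomputable def Torus.starHom (n : ℕ) (b : ℝ) : Torus n b →ₐ[ℂ] ConjOp (Torus n b) :=
  RingQuot.liftAlgHom ℂ
    ⟨FreeAlgebra.lift ℂ fun g => ConjOp.op (Torus.gen b g), fun _ _ h => conjOp_rel h⟩

/-- The star structure of the quantum torus. -/
noncomputable def Torus.starMap (n : ℕ) (b : ℝ) (x : Torus n b) : Torus n b :=
  (Torus.starHom n b x).unop

theorem Torus.op_starMap {n : ℕ} {b : ℝ} (x : Torus n b) :
    ConjOp.op (starMap n b x) = starHom n b x := rfl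

theorem Torus.starMap_gen {n : ℕ} {b : ℝ} (g : TGen n) : starMap n b (gen b g) = gen b g := by
  refine ConjOp.op_injective ?_
  rw [op_starMap, starHom, gen, RingQuot.liftAlgHom_mkAlgHom_apply, FreeAlgebra.lift_ι_apply]
  rfl

theorem Torus.starMap_add {n : ℕ} {b : ℝ} (x y : Torus n b) :
    starMap n b (x + y) = starMap n b x + starMap n b y := by
  refine ConjOp.op_injective ?_
  rw [op_starMap, map_add]
  rfl

theorem Torus.starMap_mul {n : ℕ} {b : ℝ} (x y : Torus n b) :
    starMap n b (x * y) = starMap n b y * starMap n b x := by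
  refine ConjOp.op_injective ?_
  rw [op_starMap, map_mul]
  rfl

theorem Torus.starMap_smul {n : ℕ} {b : ℝ} (c : ℂ) (x : Torus n b) :
    starMap n b (c • x) = (starRingEnd ℂ) c • starMap n b x := by
  refine ConjOp.op_injective ?_
  rw [op_starMap, map_smul, ← op_starMap, ConjOp.smul_op]

theorem Torus.starMap_one {n : ℕ} {b : ℝ} : starMap n b 1 = 1 := by
  refine ConjOp.op_injective ?_
  rw [op_starMap, map_one]
  rfl

theorem Torus.isStar_starMap (n : ℕ) (b : ℝ) : Torus.IsStar (starMap n b) where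
  map_add := starMap_add
  map_smul := starMap_smul
  map_mul := starMap_mul
  map_gen := starMap_gen
  involutive x := by
    have hx : x ∈ Algebra.adjoin ℂ (Set.range (Torus.gen (n := n) b)) := by
      rw [adjoin_gen]; trivial
    induction hx using Algebra.adjoin_induction with
    | mem x hx =>
      obtain ⟨g, rfl⟩ := hx
      rw [starMap_gen, starMap_gen]
    | algebraMap c =>
      rw [Algebra.algebraMap_eq_smul_one, starMap_smul, starMap_smul, starMap_one, starMap_one,
        Complex.conj_conj]
    | add x y _ _ hx hy => rw [starMap_add, starMap_add, hx, hy]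
    | mul x y _ _ hx hy => rw [starMap_mul, starMap_mul, hx, hy]

/-! ## Real combinations of Weyl operators -/

/-- Real linear combinations of Weyl operators with integral exponents. -/
inductive RealWeyl {n : ℕ} (b : ℝ) : Module.End ℂ (Dom n) → Prop
  | weyl (m v : Idx n → ℤ) : RealWeyl b (weyl b ((2 : ℤ) • m) v)
  | zero : RealWeyl b 0
  | add {X Y : Module.End ℂ (Dom n)} : RealWeyl b X → RealWeyl b Y → RealWeyl b (X + Y)
  | smul (r : ℝ) {X : Module.End ℂ (Dom n)} : RealWeyl b X → RealWeyl b ((r : ℂ) • X)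

theorem RealWeyl.sum {n : ℕ} {b : ℝ} {ι : Type*} (s : Finset ι) {X : ι → Module.End ℂ (Dom n)}
    (h : ∀ i ∈ s, RealWeyl b (X i)) : RealWeyl b (∑ i ∈ s, X i) :=
  Finset.sum_induction X (RealWeyl b) (fun _ _ => RealWeyl.add) RealWeyl.zero h

/-- This single property yields the commutation of the two copies, membership in the torus, and
self-adjointness. -/
theorem IsAdapted.realWeyl {n : ℕ} {C : Matrix (Idx n) (Idx n) ℤ} (hC : IsAdapted C) {b : ℝ}
    (hb : b ≠ 0) (α : ℕ → ℝ) (g : QGen n) :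
    RealWeyl b ((gaussMul (realMatrix C)).conj (modOp n b α g)) := by
  cases g with
  | E i =>
    obtain ⟨m, hm⟩ := hC.conj_E i
    rw [hm b hb α]
    exact .sum _ fun k _ => .sum _ fun σ _ => .smul _ (.weyl _ _)
  | F i =>
    obtain ⟨m, hm⟩ := hC.conj_F i
    rw [hm b hb α]
    exact .sum _ fun k _ => .sum _ fun σ _ => .smul _ (.weyl _ _)
  | K i =>
    rw [modOp, conj_opK hC.symm]
    exact .weyl _ _
  | Kinv i =>
    rw [modOp, conj_opK hC.symm, neg_smul, ← smul_neg]
    exact .weyl _ _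

theorem RealWeyl.commute {n : ℕ} {b : ℝ} (hb : b ≠ 0) {X Y : Module.End ℂ (Dom n)}
    (hX : RealWeyl b X) (hY : RealWeyl b⁻¹ Y) : Commute X Y := by
  induction hX with
  | weyl m v =>
    induction hY with
    | weyl m' v' => exact weyl_comm_inv hb m v m' v'
    | zero => exact Commute.zero_right _
    | add _ _ h h' => exact h.add_right h'
    | smul r _ h => exact h.smul_right _
  | zero => exact Commute.zero_left _
  | add _ _ h h' => exact h.add_left h'
  | smul r _ h => exact h.smul_left _

/-- The exponents for which the Weyl operator comes from a self-adjoint element of the torus. -/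
noncomputable def selfAdjointExps {n : ℕ} {b : ℝ} (hb : 0 < b) (hb2 : Irrational (b ^ 2)) (s : Bool) :
    AddSubmonoid ((Idx n → ℤ) × (Idx n → ℤ)) where
  carrier := {p | ∃ x : Torus n b, torusRep n hb.ne' x = weyl (par b s) ((2 : ℤ) • p.1) p.2 ∧
    Torus.starMap n b x = x}
  zero_mem' := ⟨1, by
    rw [Prod.fst_zero, Prod.snd_zero, smul_zero, weyl_zero, map_one], Torus.starMap_one⟩
  add_mem' := by
    rintro ⟨m, v⟩ ⟨m', v'⟩ ⟨x, hx, hx'⟩ ⟨y, hy, hy'⟩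
    simp only at hx hy
    set ω : ℤ := ((2 : ℤ) • m) ⬝ᵥ v' - ((2 : ℤ) • m') ⬝ᵥ v with hω
    have hxy : torusRep n hb.ne' (x * y) =
        qHalf (par b s) ω • weyl (par b s) ((2 : ℤ) • (m + m')) (v + v') := by
      rw [map_mul, hx, hy, weyl_mul, smul_add]
    have hyx : torusRep n hb.ne' (y * x) =
        qHalf (par b s) (-ω) • weyl (par b s) ((2 : ℤ) • (m + m')) (v + v') := by
      rw [map_mul, hx, hy, weyl_mul, smul_add, add_comm ((2 : ℤ) • m'), add_comm v', hω, neg_sub]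
    -- The phase is the one that turns x y into a Weyl operator. Its conjugate does the same for y
    -- x, so faithfulness gives self-adjointness.
    refine ⟨qHalf (par b s) (-ω) • (x * y), ?_, torusRep_injective n hb hb2 ?_⟩
    · rw [map_smul, hxy, smul_smul, ← qHalf_add, neg_add_cancel, qHalf_zero, one_smul]
      rfl
    · rw [Torus.starMap_smul, Torus.starMap_mul, hx', hy', conj_qHalf, neg_neg, map_smul, map_smul,
        hxy, hyx, smul_smul, smul_smul, mul_comm]

/-- The inverses of the generators are self-adjoint generators too, so closure under addition
reaches all integral exponents. -/
theorem selfAdjointExps_eq_top {n : ℕ} {b : ℝ} (hb : 0 < b) (hb2 : Irrational (b ^ 2)) (s : Bool) :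
    selfAdjointExps (n := n) hb hb2 s = ⊤ := by
  classical
  have hgen : ∀ g : TGen n, g.exps.2 ∈ selfAdjointExps (n := n) hb hb2 g.exps.1 := fun g =>
    ⟨Torus.gen b g, by rw [torusRep_gen, torusOp_eq], Torus.starMap_gen g⟩
  have hu : ∀ a (k : ℤ), ((Pi.single a k, 0) : (Idx n → ℤ) × (Idx n → ℤ)) ∈
      selfAdjointExps (n := n) hb hb2 s := by
    intro a k
    obtain ⟨k, rfl | rfl⟩ := k.eq_nat_or_neg
    · have := AddSubmonoid.nsmul_mem _ (hgen (.u s a)) k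
      simpa [TGen.exps, ← Pi.single_smul] using this
    · have := AddSubmonoid.nsmul_mem _ (hgen (.uInv s a)) k
      simpa [TGen.exps, ← Pi.single_smul] using this
  have hv : ∀ a (k : ℤ), ((0, Pi.single a k) : (Idx n → ℤ) × (Idx n → ℤ)) ∈
      selfAdjointExps (n := n) hb hb2 s := by
    intro a k
    obtain ⟨k, rfl | rfl⟩ := k.eq_nat_or_neg
    · have := AddSubmonoid.nsmul_mem _ (hgen (.v s a)) k
      simpa [TGen.exps, ← Pi.single_smul] using this
    · have := AddSubmonoid.nsmul_mem _ (hgen (.vInv s a)) k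
      simpa [TGen.exps, ← Pi.single_smul] using this
  rw [eq_top_iff]
  rintro ⟨m, v⟩ -
  have h : ((m, v) : (Idx n → ℤ) × (Idx n → ℤ)) =
      ∑ a, ((Pi.single a (m a), 0) + (0, Pi.single a (v a))) := by
    rw [Finset.sum_add_distrib]
    ext1
    · simp [Prod.fst_sum, Finset.univ_sum_single]
    · simp [Prod.snd_sum, Finset.univ_sum_single]
  rw [h]
  exact AddSubmonoid.sum_mem _ fun a _ => AddSubmonoid.add_mem _ (hu a _) (hv a _)

theorem RealWeyl.exists_selfAdjoint {n : ℕ} {b : ℝ} (hb : 0 < b) (hb2 : Irrational (b ^ 2))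
    {s : Bool} {X : Module.End ℂ (Dom n)} (hX : RealWeyl (par b s) X) :
    ∃ x : Torus n b, torusRep n hb.ne' x = X ∧ Torus.starMap n b x = x := by
  induction hX with
  | weyl m v =>
    have : ((m, v) : (Idx n → ℤ) × (Idx n → ℤ)) ∈ selfAdjointExps (n := n) hb hb2 s := by
      rw [selfAdjointExps_eq_top]; trivial
    exact this
  | zero => exact ⟨0, map_zero _, by
      simpa using Torus.starMap_smul (n := n) (b := b) 0 0⟩
  | add _ _ h h' =>
    obtain ⟨x, hx, hx'⟩ := h
    obtain ⟨y, hy, hy'⟩ := h'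
    exact ⟨x + y, by rw [map_add, hx, hy], by rw [Torus.starMap_add, hx', hy']⟩
  | smul r _ h =>
    obtain ⟨x, hx, hx'⟩ := h
    exact ⟨(r : ℂ) • x, by rw [map_smul, hx], by
      rw [Torus.starMap_smul, hx', Complex.conj_ofReal]⟩

/-! ## The unitary multiplication operator on `L²` -/

section Unimodular

variable {X : Type*} [MeasurableSpace X] {μ : Measure X}

theorem memLp_unimodular_mul {c : X → ℂ} (hc : AEStronglyMeasurable c μ) (h : ∀ x, ‖c x‖ = 1)
    (ψ : Lp ℂ 2 μ) : MemLp (fun x => c x * ψ x) 2 μ :=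
  (Lp.memLp ψ).congr_norm (hc.mul (Lp.aestronglyMeasurable ψ))
    (Filter.Eventually.of_forall fun x => by rw [norm_mul, h, one_mul])

/-- Multiplication by a unimodular function, as a linear map of `L²`. -/
noncomputable def unimodularMul {c : X → ℂ} (hc : AEStronglyMeasurable c μ) (h : ∀ x, ‖c x‖ = 1) :
    Lp ℂ 2 μ →ₗ[ℂ] Lp ℂ 2 μ where
  toFun ψ := (memLp_unimodular_mul hc h ψ).toLp _
  map_add' ψ φ := by
    rw [← MemLp.toLp_add]
    refine MemLp.toLp_congr _ _ ?_
    filter_upwards [Lp.coeFn_add ψ φ] with x hx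
    rw [hx, Pi.add_apply, mul_add]
    rfl
  map_smul' a ψ := by
    rw [RingHom.id_apply, ← MemLp.toLp_const_smul]
    refine MemLp.toLp_congr _ _ ?_
    filter_upwards [Lp.coeFn_smul a ψ] with x hx
    rw [hx, Pi.smul_apply, Pi.smul_apply, mul_smul_comm]

theorem coeFn_unimodularMul {c : X → ℂ} (hc : AEStronglyMeasurable c μ) (h : ∀ x, ‖c x‖ = 1)
    (ψ : Lp ℂ 2 μ) : ∀ᵐ x ∂μ, unimodularMul hc h ψ x = c x * ψ x :=
  (memLp_unimodular_mul hc h ψ).coeFn_toLp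

theorem unimodularMul_comp {c d : X → ℂ} (hc : AEStronglyMeasurable c μ) (h : ∀ x, ‖c x‖ = 1)
    (hd : AEStronglyMeasurable d μ) (h' : ∀ x, ‖d x‖ = 1) (hcd : ∀ x, c x * d x = 1) :
    unimodularMul hc h ∘ₗ unimodularMul hd h' = LinearMap.id := by
  refine LinearMap.ext fun ψ => Lp.ext ?_
  filter_upwards [coeFn_unimodularMul hc h (unimodularMul hd h' ψ),
    coeFn_unimodularMul hd h' ψ] with x h1 h2
  rw [LinearMap.comp_apply, h1, h2, ← mul_assoc, hcd, one_mul]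
  rfl

theorem norm_unimodularMul {c : X → ℂ} (hc : AEStronglyMeasurable c μ) (h : ∀ x, ‖c x‖ = 1)
    (ψ : Lp ℂ 2 μ) : ‖unimodularMul hc h ψ‖ = ‖ψ‖ := by
  rw [Lp.norm_def, Lp.norm_def]
  congr 1
  refine eLpNorm_congr_norm_ae ?_
  filter_upwards [coeFn_unimodularMul hc h ψ] with x hx
  rw [hx, norm_mul, h, one_mul]

end Unimodular

/-- The Gaussian phase on `ℝ^N`. -/
noncomputable def phase {n : ℕ} (C : Matrix (Idx n) (Idx n) ℝ) (x : Idx n → ℝ) : ℂ :=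
  cexp (Real.pi * I / 2 * quad C (realPt x))

theorem continuous_phase {n : ℕ} (C : Matrix (Idx n) (Idx n) ℝ) : Continuous (phase C) := by
  unfold phase quad realPt
  fun_prop

theorem norm_phase {n : ℕ} (C : Matrix (Idx n) (Idx n) ℝ) (x : Idx n → ℝ) : ‖phase C x‖ = 1 := by
  have : Real.pi * I / 2 * quad C (realPt x) =
      ((Real.pi / 2 * ∑ a, ∑ c, C a c * x a * x c : ℝ) : ℂ) * I := by
    simp only [quad, realPt]
    push_cast
    ring
  rw [phase, this, Complex.norm_exp_ofReal_mul_I]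

theorem phase_mul_phase_neg {n : ℕ} (C : Matrix (Idx n) (Idx n) ℝ) (x : Idx n → ℝ) :
    phase C x * phase (-C) x = 1 := by
  rw [phase, phase, quad_neg, ← Complex.exp_add, mul_neg, add_neg_cancel, Complex.exp_zero]

theorem phase_neg_mul_phase {n : ℕ} (C : Matrix (Idx n) (Idx n) ℝ) (x : Idx n → ℝ) :
    phase (-C) x * phase C x = 1 := by
  rw [mul_comm, phase_mul_phase_neg]

/-- The unitary operator of multiplication by the Gaussian phase. -/
noncomputable def phaseUnitary {n : ℕ} (C : Matrix (Idx n) (Idx n) ℝ) : L2 n ≃ₗᵢ[ℂ] L2 n where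
  toLinearEquiv := LinearEquiv.ofLinearMap
    (unimodularMul (continuous_phase C).aestronglyMeasurable (norm_phase C))
    (unimodularMul (continuous_phase (-C)).aestronglyMeasurable (norm_phase (-C)))
    (unimodularMul_comp _ _ _ _ (phase_mul_phase_neg C))
    (unimodularMul_comp _ _ _ _ (phase_neg_mul_phase C))
  norm_map' ψ :=
    norm_unimodularMul (continuous_phase C).aestronglyMeasurable (norm_phase C) ψ

theorem phaseUnitary_apply {n : ℕ} (C : Matrix (Idx n) (Idx n) ℝ) (ψ : L2 n) :
    ∀ᵐ x : Idx n → ℝ, phaseUnitary C ψ x =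
      cexp (Real.pi * I / 2 * quad C (realPt x)) * ψ x :=
  coeFn_unimodularMul (continuous_phase C).aestronglyMeasurable (norm_phase C) ψ

theorem coeFn_toL2 {n : ℕ} (g : Dom n) :
    ∀ᵐ x : Idx n → ℝ, toL2 g x = (g : (Idx n → ℂ) → ℂ) (realPt x) :=
  (memLp_real g).coeFn_toLp

theorem phaseUnitary_toL2 {n : ℕ} (C : Matrix (Idx n) (Idx n) ℝ) (g : Dom n) :
    phaseUnitary C (toL2 g) = toL2 (gaussMul C g) := by
  refine Lp.ext ?_
  filter_upwards [phaseUnitary_apply C (toL2 g), coeFn_toL2 g, coeFn_toL2 (gaussMul C g)]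
    with x h1 h2 h3
  rw [h1, h2, h3]
  rfl

/-! ## The modular double -/

theorem commute_of_mem_adjoin {A B D : Type*} [Semiring A] [Semiring B] [Semiring D] [Algebra ℂ A]
    [Algebra ℂ B] [Algebra ℂ D] (f : A →ₐ[ℂ] D) (g : B →ₐ[ℂ] D) {s : Set A} {t : Set B}
    (h : ∀ x ∈ s, ∀ y ∈ t, Commute (f x) (g y)) {x : A} (hx : x ∈ Algebra.adjoin ℂ s) {y : B}
    (hy : y ∈ Algebra.adjoin ℂ t) : Commute (f x) (g y) := by
  induction hx using Algebra.adjoin_induction with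
  | mem x hx =>
    induction hy using Algebra.adjoin_induction with
    | mem y hy => exact h x hx y hy
    | algebraMap c => rw [AlgHom.commutes]; exact (Algebra.commutes c (f x)).symm
    | add y y' _ _ h h' => rw [map_add]; exact h.add_right h'
    | mul y y' _ _ h h' => rw [map_mul]; exact h.mul_right h'
  | algebraMap c => rw [AlgHom.commutes]; exact Algebra.commutes c (g y)
  | add x x' _ _ h h' => rw [map_add]; exact h.add_left h'
  | mul x x' _ _ h h' => rw [map_mul]; exact h.mul_left h'

theorem irrational_inv_sq {b : ℝ} (hb2 : Irrational (b ^ 2)) : Irrational (b⁻¹ ^ 2) := by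
  rw [inv_pow]
  exact hb2.inv

section
variable {n : ℕ} {b : ℝ} {C : Matrix (Idx n) (Idx n) ℤ}

/-- The representation of the modified quantum group. -/
noncomputable def modUqRep (n : ℕ) {b : ℝ} (hb : 0 < b) (hb2 : Irrational (b ^ 2)) (α : ℕ → ℝ) :
    ModUq n (qPar b) →ₐ[ℂ] Module.End ℂ (Dom n) :=
  (uqRep n hb hb2 α).comp (ModUq n (qPar b)).val

theorem modUqRep_gen (hb : 0 < b) (hb2 : Irrational (b ^ 2)) (α : ℕ → ℝ) (g : QGen n) :
    modUqRep n hb hb2 α (ModUq.gen (qPar b) g) = modOp n b α g :=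
  uqRep_modGen hb hb2 α g

/-- Conjugation with the Gaussian as an automorphism of the algebra of operators. -/
noncomputable def gaussConj {n : ℕ} (C : Matrix (Idx n) (Idx n) ℝ) :
    Module.End ℂ (Dom n) ≃ₐ[ℂ] Module.End ℂ (Dom n) :=
  (gaussMul C).conjAlgEquiv ℂ

theorem gaussConj_apply (C : Matrix (Idx n) (Idx n) ℝ) (X : Module.End ℂ (Dom n)) :
    gaussConj C X = (gaussMul C).conj X := rfl

/-- Commutation may be tested on generators and after conjugation by the Gaussian, where only even
exponents occur. -/
theorem IsAdapted.commute_modUqRep (hC : IsAdapted C) (hb : 0 < b) (hb2 : Irrational (b ^ 2))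
    (α : ℕ → ℝ) (x : ModUq n (qPar b)) (y : ModUq n (qPar b⁻¹)) :
    Commute (modUqRep n hb hb2 α x)
      (modUqRep n (inv_pos.2 hb) (irrational_inv_sq hb2) α y) := by
  refine commute_of_mem_adjoin (uqRep n hb hb2 α)
    (uqRep n (inv_pos.2 hb) (irrational_inv_sq hb2) α) ?_ x.2 y.2
  rintro _ ⟨g, rfl⟩ _ ⟨g', rfl⟩
  rw [uqRep_modGen, uqRep_modGen]
  have h := (hC.realWeyl hb.ne' α g).commute hb.ne' (hC.realWeyl (inv_pos.2 hb).ne' α g')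
  rw [← gaussConj_apply, ← gaussConj_apply] at h
  exact (commute_map_iff (gaussConj (realMatrix C)).injective).1 h

/-- The representation of the modified modular double. -/
noncomputable def modDoubleRep (hC : IsAdapted C) (hb : 0 < b) (hb2 : Irrational (b ^ 2))
    (α : ℕ → ℝ) : ModDouble n b →ₐ[ℂ] Module.End ℂ (Dom n) :=
  Algebra.TensorProduct.lift (modUqRep n hb hb2 α)
    (modUqRep n (inv_pos.2 hb) (irrational_inv_sq hb2) α) (hC.commute_modUqRep hb hb2 α)

theorem modDoubleRep_gen (hC : IsAdapted C) (hb : 0 < b) (hb2 : Irrational (b ^ 2))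
    (α : ℕ → ℝ) (s : Bool) (g : QGen n) :
    modDoubleRep hC hb hb2 α (ModDouble.gen b s g) = modOp n (par b s) α g := by
  cases s
  · rw [ModDouble.gen, modDoubleRep, Algebra.TensorProduct.lift_tmul, map_one, mul_one,
      modUqRep_gen]
    rfl
  · rw [ModDouble.gen, modDoubleRep, Algebra.TensorProduct.lift_tmul, map_one, one_mul,
      modUqRep_gen]
    rfl

/-- The operators whose conjugates come from the torus form a subalgebra, so generators suffice. The
separate parameter c lets the statement cover b and b⁻¹ at once. -/
theorem IsAdapted.gaussConj_uqRep_mem (hC : IsAdapted C) (hb : 0 < b) (hb2 : Irrational (b ^ 2))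
    {c : ℝ} (hc : 0 < c) (hc2 : Irrational (c ^ 2)) (α : ℕ → ℝ) (s : Bool) (hs : c = par b s)
    (x : ModUq n (qPar c)) :
    gaussConj (realMatrix C) (modUqRep n hc hc2 α x) ∈ (torusRep n hb.ne').range := by
  have h : ModUq n (qPar c) ≤ (torusRep n hb.ne').range.comap
      ((gaussConj (realMatrix C)).toAlgHom.comp (uqRep n hc hc2 α)) := by
    refine Algebra.adjoin_le ?_
    rintro _ ⟨g, rfl⟩
    have h1 := hC.realWeyl hc.ne' α g
    rw [hs] at h1
    obtain ⟨y, hy, -⟩ := h1.exists_selfAdjoint hb hb2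
    refine ⟨y, ?_⟩
    change torusRep n hb.ne' y = gaussConj (realMatrix C) (uqRep n hc hc2 α (Uq.modGen (qPar c) g))
    rw [uqRep_modGen, hs]
    exact hy
  exact h x.2

theorem IsAdapted.gaussConj_mem (hC : IsAdapted C) (hb : 0 < b) (hb2 : Irrational (b ^ 2))
    (α : ℕ → ℝ) (X : (modDoubleRep hC hb hb2 α).range) :
    gaussConj (realMatrix C) X ∈ (torusRep n hb.ne').range := by
  obtain ⟨_, t, rfl⟩ := X
  change gaussConj (realMatrix C) (modDoubleRep hC hb hb2 α t) ∈ _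
  induction t using TensorProduct.induction_on with
  | zero => rw [map_zero, map_zero]; exact Subalgebra.zero_mem _
  | tmul x y =>
    rw [modDoubleRep, Algebra.TensorProduct.lift_tmul, map_mul]
    exact Subalgebra.mul_mem _ (hC.gaussConj_uqRep_mem hb hb2 hb hb2 α false rfl x)
      (hC.gaussConj_uqRep_mem hb hb2 _ _ α true rfl y)
  | add t t' h h' => rw [map_add, map_add]; exact Subalgebra.add_mem _ h h'

/-- The embedding of the image of the modified modular double into the quantum torus. -/
noncomputable def torusEmbedding (hC : IsAdapted C) (hb : 0 < b) (hb2 : Irrational (b ^ 2))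
    (α : ℕ → ℝ) : (modDoubleRep hC hb hb2 α).range →ₐ[ℂ] Torus n b :=
  (AlgEquiv.ofInjective (torusRep n hb.ne') (torusRep_injective n hb hb2)).symm.toAlgHom.comp
    (((gaussConj (realMatrix C)).toAlgHom.comp (modDoubleRep hC hb hb2 α).range.val).codRestrict
      (torusRep n hb.ne').range (hC.gaussConj_mem hb hb2 α))

theorem torusRep_torusEmbedding (hC : IsAdapted C) (hb : 0 < b) (hb2 : Irrational (b ^ 2))
    (α : ℕ → ℝ) (X : (modDoubleRep hC hb hb2 α).range) :
    torusRep n hb.ne' (torusEmbedding hC hb hb2 α X) = gaussConj (realMatrix C) X := by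
  have h := (AlgEquiv.ofInjective (torusRep n hb.ne') (torusRep_injective n hb hb2)).apply_symm_apply
    (((gaussConj (realMatrix C)).toAlgHom.comp (modDoubleRep hC hb hb2 α).range.val).codRestrict
      (torusRep n hb.ne').range (hC.gaussConj_mem hb hb2 α) X)
  exact congrArg Subtype.val h

theorem torusEmbedding_injective (hC : IsAdapted C) (hb : 0 < b) (hb2 : Irrational (b ^ 2))
    (α : ℕ → ℝ) : Function.Injective (torusEmbedding hC hb hb2 α) := by
  intro X Y h
  have h1 := congrArg (torusRep n hb.ne') h
  rw [torusRep_torusEmbedding, torusRep_torusEmbedding] at h1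
  exact Subtype.ext ((gaussConj (realMatrix C)).injective h1)

end

end PosRep

/-! ### Assembly of the theorem -/

open PosRep
theorem mainTheorem4 (n : ℕ) (hn : 2 ≤ n) :
    ∃ C : Matrix (Idx n) (Idx n) ℝ, C.IsSymm ∧
      (∃ W : L2 n ≃ₗᵢ[ℂ] L2 n,
        (∀ ψ : L2 n, ∀ᵐ x : Idx n → ℝ,
          W ψ x = Complex.exp (Real.pi * Complex.I / 2 * quad C (realPt x)) * ψ x) ∧
        ∀ g : Dom n, W (toL2 g) = toL2 (gaussMul C g)) ∧
      ∀ b : ℝ, 0 < b → Irrational (b ^ 2) → ∀ α : ℕ → ℝ,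
        (∀ (s : Bool) (i : Fin (n - 1)),
          (∃ (c c' : ℕ → ℂ) (m m' : ℕ → Idx n → ℤ),
            (gaussMul C).conj (modOp n (par b s) α (.E i)) =
              ∑ k ∈ Finset.Icc 1 (n - (i + 1)),
                (c k • uExp (par b s) (m k) + c' k • uExp (par b s) (m' k)) *
                  pExp (par b s) (shiftE n (i + 1) k)) ∧
          (∃ (c c' : ℕ → ℂ) (m m' : ℕ → Idx n → ℤ),
            (gaussMul C).conj (modOp n (par b s) α (.F i)) =
              ∑ k ∈ Finset.Icc 1 ((i : ℕ) + 1),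
                (c k • uExp (par b s) (m k) + c' k • uExp (par b s) (m' k)) *
                  pExp (par b s) (shiftF n (i + 1) k)) ∧
          (∃ m : Idx n → ℤ,
            (gaussMul C).conj (modOp n (par b s) α (.K i)) = uExp (par b s) m ∧
            (gaussMul C).conj (modOp n (par b s) α (.Kinv i)) = uExp (par b s) (-m))) ∧
        ∃ (π : ModDouble n b →ₐ[ℂ] Module.End ℂ (Dom n))
          (ρ : Torus n b →ₐ[ℂ] Module.End ℂ (Dom n))
          (Ψ : π.range →ₐ[ℂ] Torus n b)
          (σ : Torus n b → Torus n b),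
          (∀ s g, π (ModDouble.gen b s g) = modOp n (par b s) α g) ∧
          (∀ g, ρ (Torus.gen b g) = torusOp n b g) ∧
          Function.Injective ρ ∧
          Function.Injective Ψ ∧
          (∀ X : π.range, (gaussMul C).conj (X : Module.End ℂ (Dom n)) = ρ (Ψ X)) ∧
          Torus.IsStar σ ∧
          ∀ s g, σ (Ψ (π.rangeRestrict (ModDouble.gen b s g))) =
            Ψ (π.rangeRestrict (ModDouble.gen b s g)) := by
  obtain ⟨C, hsymm, hF, hE⟩ := exists_integral_form n
  have hC : IsAdapted C := ⟨hsymm, hF, hE⟩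
  refine ⟨realMatrix C, ?_, ⟨phaseUnitary _, phaseUnitary_apply _, phaseUnitary_toL2 _⟩,
    fun b hb hb2 α => ⟨fun s i => ⟨?_, ?_, ?_⟩, modDoubleRep hC hb hb2 α, torusRep n hb.ne',
      torusEmbedding hC hb hb2 α, Torus.starMap n b, modDoubleRep_gen hC hb hb2 α,
      torusRep_gen hb.ne', torusRep_injective n hb hb2, torusEmbedding_injective hC hb hb2 α,
      fun X => (torusRep_torusEmbedding hC hb hb2 α X).symm, Torus.isStar_starMap n b,
      fun s g => ?_⟩⟩
  · rw [Matrix.IsSymm, realMatrix, ← Matrix.transpose_map, hsymm]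
  · obtain ⟨m, hm⟩ := hC.conj_E i
    rw [hm _ (par_ne_zero hb.ne' s) α]
    simp_rw [sum_signs_weyl]
    exact ⟨_, _, _, _, rfl⟩
  · obtain ⟨m, hm⟩ := hC.conj_F i
    rw [hm _ (par_ne_zero hb.ne' s) α]
    simp_rw [sum_signs_weyl]
    exact ⟨_, _, _, _, rfl⟩
  -- No shift occurs in K_i, so the Gaussian leaves it alone; squaring alone makes its exponent
  -- even.
  · refine ⟨linH n (i + 1), ?_, ?_⟩
    · rw [modOp, conj_opK hsymm, weyl_two_smul_zero]
    · rw [modOp, conj_opK hsymm, neg_smul, ← smul_neg, weyl_two_smul_zero]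
  -- A self-adjoint preimage exists, and faithfulness identifies it with the image under the
  -- embedding.
  · obtain ⟨x, hx, hx'⟩ :=
      (hC.realWeyl (par_ne_zero hb.ne' s) α g).exists_selfAdjoint hb hb2
    have h : torusEmbedding hC hb hb2 α
        ((modDoubleRep hC hb hb2 α).rangeRestrict (ModDouble.gen b s g)) = x := by
      refine torusRep_injective n hb hb2 ?_
      rw [torusRep_torusEmbedding, hx, ← modDoubleRep_gen hC hb hb2]
      rfl
    rw [h, hx']
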